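/- Let $h:[0,1]^2\to[0,\infty)$ be continuous and symmetric, with $h(x,x)=0$ for all $x$ and $h(x,y)>0$ for all $x\neq y$ in $[0,1]$, and assume that $h$ is Lipschitz: there is $K_h\in(0,\infty)$ with $|h(y_1,z_1)-h(y_2,z_2)|\le K_h(|y_1-y_2|+|z_1-z_2|)$ for all $(y_1,z_1),(y_2,z_2)\in[0,1]^2$. Let $(X,Y)$ be a pair of real random variables such that $Y$ is continuous, i.e. its distribution function $F_Y$ is continuous. Let $(X_1,Y_1),(X_2,Y_2),\dots$ be i.i.d. copies of $(X,Y)$. For each $n$, let $Y_{[1]},\dots,Y_{[n]}$ be the $Y_i$'s ($i\le n$) reordered so that the corresponding $X_i$'s are non-decreasing, ties among the $X_i$'s being broken uniformly at random. Let $R(y)=\#\{j\le n: Y_j\le y\}$ and $$\breve\xi_n^{(h)}=1-\frac{\widetilde\zeta_n^{(h)}}{C_h},\qquad \widetilde\zeta_n^{(h)}=\frac1n\sum_{i=1}^{n-1}h\Big(\frac{R(Y_{[i]})}{n},\frac{R(Y_{[i+1]})}{n}\Big),\qquad C_h=\int_0^1\!\!\int_0^1 h(u,v)\,du\,dv .$$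 Write $\mu_X,\mu_Y$ for the laws of $X,Y$ and $\mu_{Y|x}$ for the conditional law of $Y$ given $X=x$. Then, as $n\to\infty$, $\breve\xi_n^{(h)}$ converges almost surely to $$\widetilde\xi^{(h)}=1-\frac{\int\!\int\!\int h(F_Y(y),F_Y(z))\,d\mu_{Y|x}(y)\,d\mu_{Y|x}(z)\,d\mu_X(x)}{\int\!\int h(F_Y(y),F_Y(z))\,d\mu_Y(y)\,d\mu_Y(z)} .$$ Moreover, if $X$ and $Y$ are independent, then $\sqrt n\,\breve\xi_n^{(h)}$ converges in distribution to $N(0,\widetilde\sigma^2)$ as $n\to\infty$, where, with $h_{ij}=h(F_Y(Y_i),F_Y(Y_j))$, $$\widetilde\sigma^2=\frac{\mathbb E[h_{12}^2]-2\,\mathbb E[h_{12}h_{13}]+(\mathbb E[h_{12}])^2}{(\mathbb E[h_{12}])^2}>0 .$$ -/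

import Mathlib

open MeasureTheory ProbabilityTheory Filter Topology

noncomputable section

/-- Regularity condition: `h` restricted to `[0,1]²` is non-negative, continuous and symmetric, it
vanishes on the diagonal and is positive off the diagonal. Values outside `[0,1]²` are never used. -/
structure RegularKernel (h : ℝ → ℝ → ℝ) : Prop where
  continuousOn : ContinuousOn (fun p : ℝ × ℝ => h p.1 p.2) (Set.Icc 0 1 ×ˢ Set.Icc 0 1)
  nonneg : ∀ x ∈ Set.Icc (0 : ℝ) 1, ∀ y ∈ Set.Icc (0 : ℝ) 1, 0 ≤ h x y
  symm : ∀ x ∈ Set.Icc (0 : ℝ) 1, ∀ y ∈ Set.Icc (0 : ℝ) 1, h x y = h y x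
  diag : ∀ x ∈ Set.Icc (0 : ℝ) 1, h x x = 0
  pos : ∀ x ∈ Set.Icc (0 : ℝ) 1, ∀ y ∈ Set.Icc (0 : ℝ) 1, x ≠ y → 0 < h x y

/-- Lipschitz condition on `h` over `[0,1]²`. -/
def LipschitzKernel (h : ℝ → ℝ → ℝ) : Prop :=
  ∃ K : ℝ, 0 < K ∧
    ∀ y₁ ∈ Set.Icc (0 : ℝ) 1, ∀ z₁ ∈ Set.Icc (0 : ℝ) 1,
    ∀ y₂ ∈ Set.Icc (0 : ℝ) 1, ∀ z₂ ∈ Set.Icc (0 : ℝ) 1,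
      |h y₁ z₁ - h y₂ z₂| ≤ K * (|y₁ - y₂| + |z₁ - z₂|)

/-- The permutations that arrange `x 0, …, x (n-1)` in non-decreasing order. -/
def sortingPerms {n : ℕ} (x : Fin n → ℝ) : Set (Equiv.Perm (Fin n)) :=
  {σ | Monotone (fun i => x (σ i))}

/-- The first `n` sample pairs, as a random vector. -/
def sampleVec {Ω : Type*} (Xs Ys : ℕ → Ω → ℝ) (n : ℕ) (ω : Ω) : Fin n → ℝ × ℝ :=
  fun i => (Xs i ω, Ys i ω)

/-- For each sample size `n`, the random permutation `π n` orders `X₁, …, Xₙ` increasingly, with ties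
broken uniformly at random: conditionally on the first `n` sample pairs, `π n` is uniformly
distributed on the set of all permutations that sort `X₁, …, Xₙ`. Nothing is assumed about the
joint behaviour of `π n` for different `n`. -/
structure IsUniformTieBreaking {Ω : Type*} [MeasurableSpace Ω] (P : Measure Ω)
    (Xs Ys : ℕ → Ω → ℝ) (π : (n : ℕ) → Ω → Equiv.Perm (Fin n)) : Prop where
  measurableSet_eq : ∀ (n : ℕ) (σ : Equiv.Perm (Fin n)), MeasurableSet {ω | π n ω = σ}
  condProb_eq : ∀ (n : ℕ) (σ : Equiv.Perm (Fin n)),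
    P⟦{ω | π n ω = σ} | MeasurableSpace.comap (sampleVec Xs Ys n) inferInstance⟧ =ᵐ[P]
      fun ω => (sortingPerms (fun i : Fin n => Xs i ω)).indicator
        (fun _ => ((sortingPerms (fun i : Fin n => Xs i ω)).ncard : ℝ)⁻¹) σ

/-- `R(t)`, the number of sample points `y j` with `y j ≤ t`. -/
def sampleRank {n : ℕ} (y : Fin n → ℝ) (t : ℝ) : ℝ :=
  ∑ j, (Set.Iic t).indicator (fun _ => (1 : ℝ)) (y j)

/-- The rank-based variation statistic
`n⁻¹ ∑_{i=1}^{n-1} h (R(Y_[i]) / n, R(Y_[i+1]) / n)`, with `Y_[i] = y (σ i)`. -/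
def rankVariation (h : ℝ → ℝ → ℝ) {n : ℕ} (y : Fin n → ℝ) (σ : Equiv.Perm (Fin n)) : ℝ :=
  (1 / (n : ℝ)) * ∑ i : Fin (n - 1),
    h (sampleRank y (y (σ ⟨i, by omega⟩)) / n) (sampleRank y (y (σ ⟨i + 1, by omega⟩)) / n)

/-- `C_h = ∫₀¹ ∫₀¹ h(u,v) du dv`. -/
def kernelMean (h : ℝ → ℝ → ℝ) : ℝ :=
  ∫ v in (0 : ℝ)..1, ∫ u in (0 : ℝ)..1, h u v

/-- The simplified rank-based correlation coefficient. -/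
def simplifiedCoeff (h : ℝ → ℝ → ℝ) {n : ℕ} (y : Fin n → ℝ) (σ : Equiv.Perm (Fin n)) : ℝ :=
  1 - rankVariation h y σ / kernelMean h

/-- `∫∫∫ h(F_Y(y), F_Y(z)) dμ_{Y|x}(y) dμ_{Y|x}(z) dμ_X(x)`. -/
def limitVariation {Ω : Type*} [MeasurableSpace Ω] (P : Measure Ω) [IsProbabilityMeasure P]
    (h : ℝ → ℝ → ℝ) (X Y : Ω → ℝ) : ℝ :=
  ∫ x, ∫ z, ∫ y, h (cdf (P.map Y) y) (cdf (P.map Y) z)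
    ∂(condDistrib Y X P x) ∂(condDistrib Y X P x) ∂(P.map X)

/-- `∫∫ h(F_Y(y), F_Y(z)) dμ_Y(y) dμ_Y(z)`. -/
def limitNormalization {Ω : Type*} [MeasurableSpace Ω] (P : Measure Ω)
    (h : ℝ → ℝ → ℝ) (Y : Ω → ℝ) : ℝ :=
  ∫ z, ∫ y, h (cdf (P.map Y) y) (cdf (P.map Y) z) ∂(P.map Y) ∂(P.map Y)

/-- The rank-based correlation measure. -/
def rankCorrelationMeasure {Ω : Type*} [MeasurableSpace Ω] (P : Measure Ω) [IsProbabilityMeasure P]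
    (h : ℝ → ℝ → ℝ) (X Y : Ω → ℝ) : ℝ :=
  1 - limitVariation P h X Y / limitNormalization P h Y

/-- With `Y₁, Y₂, Y₃` independent of law `ν` and `hᵢⱼ = h (F Yᵢ) (F Yⱼ)`, the quantity
`(E h₁₂² - 2 E (h₁₂ h₁₃) + (E h₁₂)²) / (E h₁₂)²`. -/
def asymptoticVariance (h : ℝ → ℝ → ℝ) (F : ℝ → ℝ) (ν : Measure ℝ) : ℝ :=
  ((∫ y₁, ∫ y₂, h (F y₁) (F y₂) ^ 2 ∂ν ∂ν)
      - 2 * (∫ y₁, ∫ y₂, ∫ y₃, h (F y₁) (F y₂) * h (F y₁) (F y₃) ∂ν ∂ν ∂ν)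
      + (∫ y₁, ∫ y₂, h (F y₁) (F y₂) ∂ν ∂ν) ^ 2)
    / (∫ y₁, ∫ y₂, h (F y₁) (F y₂) ∂ν ∂ν) ^ 2

end

/-! Write F for the distribution function of Y and C for the mean of h(U,V) with U, V independent
uniform variables. By the probability integral transform C is both `kernelMean` and the denominator
of the limit (`kernelMean_eq`, `limitNormalization_eq`), so everything reduces to the rank
variation.

Almost sure limit. Represent Y as G(X,V) with noise V independent of X
(`exists_noise_representation`). Given the X's and the sorting permutation, the responses are then
independent, with conditional laws attached to the sorted X's. Three replacements are made in the
rank sum. Ranks become values of F, by Glivenko–Cantelli and the Lipschitz bound. Each h(F,F)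
becomes its conditional mean `mixedKernel` at two neighbouring X's: Hoeffding's inequality, applied
to the even and to the odd pairs, gives exponentially small errors, and Borel–Cantelli requires
nothing about the permutations for different n jointly. Lastly the mixed kernel is moved to the
diagonal. This works because, for integrable g, the average of |g(X_[i+1]) - g(X_[i])| tends to zero
(`ae_eventually_sum_abs_sub_le`): g is close in L¹ to a compactly supported continuous function,
whose variation along a sorted sequence is small. The strong law finishes.

Central limit theorem. Under independence the reordered responses are again an i.i.d. sample
(`IsUniformTieBreaking.map_reordered`), so the permutation disappears. Decompose h(u,v) = γ(u) +
γ(v) - C + q(u,v), where γ is the projection and q is degenerate. Over ranks the γ-sums are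
deterministic Riemann sums up to boundary terms, so they contribute O(1)
(`abs_centered_rank_sum_add_le`), and √n times the coefficient is -1/(C√n) times the neighbour sum
of q over ranks, up to O(n^{-1/2}).

Ranks must then be replaced by F inside q. Each error is of order n^{-1/2}, and adding these bounds
is too crude. Exchangeability helps: errors over disjoint pairs all have the same mixed moment Q.
The sum of errors over all pairs has second moment O(n²), because rows of q over ranks are Riemann
sums of zero and q(F,F) is degenerate. Hence Q = O(n⁻²), and the neighbour sum of errors is O(1) in
L² (`integral_rankError_adjacent_sum_sq_le`).

What remains is a sum of q(F(Y_i),F(Y_{i+1})), whose terms are orthogonal and 1-dependent. Dropping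
one pair per block of length m leaves i.i.d. block sums obeying the classical theorem; letting n and
then m grow gives the limit (`DegenerateKernel.tendsto_charFun_adjacent_sum`). The variance is
E[q²]/C², which is positive because q = 0 would force h(0,1) = 0. -/

/-! ### Independent blocks, product measures and the strong law. -/

/-- Grouping an independent family into disjoint blocks gives an independent family. -/
theorem iIndepFun_blocks {Ω κ τ β : Type*} [MeasurableSpace Ω] [MeasurableSpace β] {P : Measure Ω}
    [IsProbabilityMeasure P] {f : κ × τ → Ω → β} (hf : ∀ p, Measurable (f p))
    (h : iIndepFun f P) : iIndepFun (fun k ω t => f (k, t) ω) P := by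
  have : ∀ p, IsProbabilityMeasure (P.map (f p)) :=
    fun p => Measure.isProbabilityMeasure_map (hf p).aemeasurable
  have hm : ∀ k, Measurable (fun ω t => f (k, t) ω) := fun k => measurable_pi_lambda _ fun t => hf _
  rw [iIndepFun_iff_map_fun_eq_infinitePi_map hm]
  have h1 := (iIndepFun_iff_map_fun_eq_infinitePi_map hf).1 h
  have h2 : ∀ k, P.map (fun ω t => f (k, t) ω) = Measure.infinitePi fun t => P.map (f (k, t)) :=
    fun k => (iIndepFun_iff_map_fun_eq_infinitePi_map (fun t => hf (k, t))).1
      (h.precomp (g := fun t => (k, t)) (fun a b hab => by simpa using hab))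
  simp_rw [h2]
  -- Independence means that the joint law is a product, and currying a product over `κ × τ` gives a
  -- product over `κ` of products over `τ`.
  have h3 := Measure.infinitePi_map_curry (X := β) (fun k t => P.map (f (k, t)))
  rw [← h3]
  change _ = (Measure.infinitePi fun p : κ × τ => P.map (f p)).map _
  rw [← h1, Measure.map_map (MeasurableEquiv.measurable _) (measurable_pi_lambda _ hf)]
  rfl

section ProductMeasure

variable {ι E : Type*} [Fintype ι] [MeasurableSpace E] (ν : Measure E) [IsProbabilityMeasure ν]

theorem pi_map_comp_perm (σ : Equiv.Perm ι) :
    (Measure.pi fun _ : ι => ν).map (fun y i => y (σ i)) = Measure.pi fun _ : ι => ν := by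
  symm
  refine Measure.pi_eq fun s hs => ?_
  have hm : Measurable fun (y : ι → E) i => y (σ i) := by fun_prop
  rw [Measure.map_apply hm (.univ_pi hs)]
  have : (fun (y : ι → E) i => y (σ i)) ⁻¹' Set.univ.pi s = Set.univ.pi fun i => s (σ.symm i) := by
    ext y
    simp only [Set.mem_preimage, Set.mem_pi, Set.mem_univ, forall_const]
    exact ⟨fun h i => by simpa using h (σ.symm i), fun h i => by simpa using h (σ i)⟩
  rw [this, Measure.pi_pi]
  exact Equiv.prod_comp σ.symm fun i => ν (s i)

/-- Resampling one coordinate by an independent copy preserves the product law. This is the form in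
which a single variable gets integrated out below. -/
theorem pi_prod_map_update [DecidableEq ι] (j : ι) :
    ((Measure.pi fun _ : ι => ν).prod ν).map (fun p => Function.update p.1 j p.2)
      = Measure.pi fun _ : ι => ν := by
  symm
  refine Measure.pi_eq fun s hs => ?_
  have hm : Measurable fun p : (ι → E) × E => Function.update p.1 j p.2 := by fun_prop
  rw [Measure.map_apply hm (.univ_pi hs)]
  have : (fun p : (ι → E) × E => Function.update p.1 j p.2) ⁻¹' Set.univ.pi s
      = (Set.univ.pi (Function.update s j Set.univ)) ×ˢ s j := by
    ext ⟨y, t⟩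
    simp only [Set.mem_preimage, Set.mem_pi, Set.mem_univ, forall_const, Set.mem_prod]
    constructor
    · intro h
      refine ⟨fun i => ?_, by simpa using h j⟩
      by_cases hi : i = j
      · subst hi; simp
      · simpa [hi] using h i
    · rintro ⟨h, h'⟩ i
      by_cases hi : i = j
      · subst hi; simpa
      · simpa [hi] using h i
  rw [this, Measure.prod_prod, Measure.pi_pi, ← Finset.prod_erase_mul _ _ (Finset.mem_univ j),
    ← Finset.prod_erase_mul (a := j) _ (fun i => ν (s i)) (Finset.mem_univ j)]
  simp only [Function.update_self, measure_univ, mul_one]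
  congr 1
  exact Finset.prod_congr rfl fun i hi => by rw [Function.update_of_ne (Finset.ne_of_mem_erase hi)]

/-- An integral over a product vanishes if integrating out one coordinate already gives zero. -/
theorem integral_pi_eq_zero_of_update [DecidableEq ι] (j : ι) {f : (ι → E) → ℝ} (hf : Measurable f)
    {B : ℝ} (hB : ∀ y, |f y| ≤ B) (h0 : ∀ y, ∫ t, f (Function.update y j t) ∂ν = 0) :
    ∫ y, f y ∂(Measure.pi fun _ : ι => ν) = 0 := by
  have hm : Measurable fun p : (ι → E) × E => Function.update p.1 j p.2 := by fun_prop
  rw [← pi_prod_map_update ν j, integral_map hm.aemeasurable hf.aestronglyMeasurable,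
    integral_prod]
  · simp [h0]
  · exact Integrable.of_bound (hf.comp hm).aestronglyMeasurable B (ae_of_all _ fun p => hB _)

theorem pi_map_pair {i j : ι} (hij : i ≠ j) :
    (Measure.pi fun _ : ι => ν).map (fun y => (y i, y j)) = ν.prod ν := by
  have h := iIndepFun_pi (μ := fun _ : ι => ν) (X := fun _ => id) (fun _ => aemeasurable_id)
  have h2 := (indepFun_iff_map_prod_eq_prod_map_map (measurable_pi_apply i).aemeasurable
    (measurable_pi_apply j).aemeasurable).1 (h.indepFun hij)
  have h3 := fun i => (measurePreserving_eval (fun _ : ι => ν) i).map_eq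
  have h4 : ∀ i, (Measure.pi fun _ : ι => ν).map (fun y => y i) = ν := h3
  simpa [h4] using h2

theorem integral_pi_pair {i j : ι} (hij : i ≠ j) {f : E → E → ℝ}
    (hf : Measurable (Function.uncurry f)) {B : ℝ} (hB : ∀ a b, |f a b| ≤ B) :
    ∫ y, f (y i) (y j) ∂(Measure.pi fun _ : ι => ν) = ∫ a, ∫ b, f a b ∂ν ∂ν := by
  have h := integral_prod (μ := ν) (ν := ν) (Function.uncurry f)
    (Integrable.of_bound hf.aestronglyMeasurable B (ae_of_all _ fun p => hB _ _))
  simp only [Function.uncurry] at h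
  rw [← h, ← pi_map_pair ν hij, integral_map (by fun_prop)]
  exact hf.aestronglyMeasurable

end ProductMeasure

/-- The strong law of large numbers for bounded functions of an i.i.d. sequence. -/
theorem tendsto_average_of_bounded {Ω E : Type*} [MeasurableSpace Ω] [MeasurableSpace E]
    {P : Measure Ω} [IsProbabilityMeasure P] {X : ℕ → Ω → E} (hX : ∀ i, Measurable (X i))
    (hind : iIndepFun X P) {μ : Measure E} (hlaw : ∀ i, P.map (X i) = μ) {f : E → ℝ}
    (hf : Measurable f) (hint : Integrable f μ) :
    ∀ᵐ ω ∂P, Tendsto (fun n : ℕ => (∑ i : Fin n, f (X i ω)) / n) atTop (𝓝 (∫ x, f x ∂μ)) := by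
  have h := strong_law_ae_real (μ := P) (fun i ω => f (X i ω)) ?_ ?_ ?_
  · have he : ∫ ω, f (X 0 ω) ∂P = ∫ x, f x ∂μ := by
      rw [← hlaw 0, integral_map (hX 0).aemeasurable hf.aestronglyMeasurable]
    rw [he] at h
    filter_upwards [h] with ω hω
    simpa only [Finset.sum_range] using hω
  · rw [← hlaw 0] at hint
    exact hint.comp_measurable (hX 0)
  · intro i j hij
    exact (hind.indepFun hij).comp hf hf
  · intro i
    have : IdentDistrib (X i) (X 0) P P :=
      ⟨(hX i).aemeasurable, (hX 0).aemeasurable, by rw [hlaw, hlaw]⟩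
    exact this.comp hf

/-! ### Uniform weights on sorting permutations. -/

/-- The conditional probability of the sorting permutation `σ`, given the values `x`. -/
noncomputable def tieWeight {n : ℕ} (x : Fin n → ℝ) (σ : Equiv.Perm (Fin n)) : ℝ :=
  (sortingPerms x).indicator (fun _ => ((sortingPerms x).ncard : ℝ)⁻¹) σ

theorem tieWeight_nonneg {n : ℕ} (x : Fin n → ℝ) (σ : Equiv.Perm (Fin n)) : 0 ≤ tieWeight x σ :=
  Set.indicator_nonneg (fun _ _ => by positivity) _

theorem tieWeight_le_one {n : ℕ} (x : Fin n → ℝ) (σ : Equiv.Perm (Fin n)) : tieWeight x σ ≤ 1 := by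
  refine Set.indicator_le' (fun _ _ => ?_) (fun _ _ => zero_le_one) σ
  exact Nat.cast_inv_le_one _

/-- An inequality is all that upper bounds on probabilities require, so the existence of a sorting
permutation never has to be shown. -/
theorem sum_tieWeight_le_one {n : ℕ} (x : Fin n → ℝ) : ∑ σ, tieWeight x σ ≤ 1 := by
  classical
  have h : ∑ σ, tieWeight x σ
      = ((sortingPerms x).ncard : ℝ) * ((sortingPerms x).ncard : ℝ)⁻¹ := by
    simp only [tieWeight, Set.indicator_apply]
    rw [← Finset.sum_filter, Finset.sum_const, nsmul_eq_mul, Set.ncard_eq_toFinset_card']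
    congr 3
    ext σ
    simp
  rw [h]
  exact mul_inv_le_one

theorem measurableSet_sorting {n : ℕ} (σ : Equiv.Perm (Fin n)) :
    MeasurableSet {x : Fin n → ℝ | σ ∈ sortingPerms x} := by
  have : {x : Fin n → ℝ | σ ∈ sortingPerms x}
      = ⋂ i, ⋂ j, {x : Fin n → ℝ | i ≤ j → x (σ i) ≤ x (σ j)} := by
    ext x
    simp only [sortingPerms, Set.mem_ofPred_eq, Set.mem_iInter]
    exact ⟨fun h i j hij => h hij, fun h i j hij => h i j hij⟩
  rw [this]
  refine .iInter fun i => .iInter fun j => ?_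
  by_cases hij : i ≤ j
  · simpa [hij] using measurableSet_le (measurable_pi_apply (σ i)) (measurable_pi_apply (σ j))
  · simp [hij]

theorem measurable_tieWeight {n : ℕ} (σ : Equiv.Perm (Fin n)) :
    Measurable fun x : Fin n → ℝ => tieWeight x σ := by
  classical
  have h1 : ∀ x : Fin n → ℝ, ((sortingPerms x).ncard : ℝ)
      = ∑ τ, ({x : Fin n → ℝ | τ ∈ sortingPerms x}.indicator (fun _ => (1 : ℝ)) x) := by
    intro x
    simp only [Set.indicator_apply, Set.mem_ofPred_eq, Finset.sum_boole]
    rw [Set.ncard_eq_toFinset_card']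
    congr 2
    ext σ
    simp
  have h2 : (fun x : Fin n → ℝ => tieWeight x σ)
      = {x : Fin n → ℝ | σ ∈ sortingPerms x}.indicator fun x => ((sortingPerms x).ncard : ℝ)⁻¹ := by
    ext x
    simp only [tieWeight, Set.indicator_apply, Set.mem_ofPred_eq]
  rw [h2]
  refine Measurable.indicator ?_ (measurableSet_sorting σ)
  simp_rw [h1]
  exact (Finset.measurable_sum _ fun τ _ =>
    measurable_const.indicator (measurableSet_sorting τ)).inv

theorem measurable_sampleVec {Ω : Type*} [MeasurableSpace Ω] {Xs Ys : ℕ → Ω → ℝ}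
    (hXs : ∀ i, Measurable (Xs i)) (hYs : ∀ i, Measurable (Ys i)) (n : ℕ) :
    Measurable (sampleVec Xs Ys n) :=
  measurable_pi_lambda _ fun i => (hXs i).prodMk (hYs i)

/-! ### Conditioning on the first coordinates and on the permutation. -/

section Ties

variable {Ω : Type*} [MeasurableSpace Ω] {P : Measure Ω} [IsProbabilityMeasure P]
  {Xs Ys : ℕ → Ω → ℝ} {π : (n : ℕ) → Ω → Equiv.Perm (Fin n)}

/-- Integrating the conditional probability over an event of the sample σ-algebra turns the
tie-breaking hypothesis into a formula for the joint law of the permutation and the sample. -/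
theorem IsUniformTieBreaking.measure_inter (hπ : IsUniformTieBreaking P Xs Ys π)
    (hXs : ∀ i, Measurable (Xs i)) (hYs : ∀ i, Measurable (Ys i)) {n : ℕ}
    (σ : Equiv.Perm (Fin n)) {A : Set (Fin n → ℝ × ℝ)} (hA : MeasurableSet A) :
    P ({ω | π n ω = σ} ∩ sampleVec Xs Ys n ⁻¹' A)
      = ∫⁻ s in A, ENNReal.ofReal (tieWeight (fun i => (s i).1) σ)
          ∂(P.map (sampleVec Xs Ys n)) := by
  have hS := measurable_sampleVec hXs hYs n
  have hw : Measurable fun s : Fin n → ℝ × ℝ => tieWeight (fun i => (s i).1) σ :=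
    (measurable_tieWeight σ).comp (by fun_prop)
  rw [setLIntegral_map hA hw.ennreal_ofReal hS, ← ofReal_integral_eq_lintegral_ofReal]
  rotate_left
  · refine Integrable.of_bound (hw.comp hS).aestronglyMeasurable 1 (ae_of_all _ fun ω => ?_)
    rw [Real.norm_of_nonneg (tieWeight_nonneg _ _)]
    exact tieWeight_le_one _ _
  · exact ae_of_all _ fun ω => tieWeight_nonneg _ _
  have h1 := setIntegral_condExp (μ := P) (m := MeasurableSpace.comap (sampleVec Xs Ys n)
    inferInstance) hS.comap_le (f := {ω | π n ω = σ}.indicator fun _ => (1 : ℝ))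
    ((integrable_const _).indicator (hπ.measurableSet_eq n σ)) ⟨A, hA, rfl⟩
  have h2 := setIntegral_congr_ae (s := sampleVec Xs Ys n ⁻¹' A) (hS hA)
    ((hπ.condProb_eq n σ).mono fun ω h _ => h)
  rw [integral_indicator_const _ (hπ.measurableSet_eq n σ)] at h1
  simp only [smul_eq_mul, mul_one] at h1
  rw [measureReal_restrict_apply (hπ.measurableSet_eq n σ)] at h1
  have h3 : ∫ ω in sampleVec Xs Ys n ⁻¹' A, tieWeight (fun i => (sampleVec Xs Ys n ω i).1) σ ∂P
      = P.real ({ω | π n ω = σ} ∩ sampleVec Xs Ys n ⁻¹' A) := by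
    rw [← h1, h2]; rfl
  rw [h3, ofReal_measureReal]

theorem map_sampleVec {X Y : Ω → ℝ} (hXs : ∀ i, Measurable (Xs i)) (hYs : ∀ i, Measurable (Ys i))
    (h_indep : iIndepFun (fun i ω => (Xs i ω, Ys i ω)) P)
    (h_ident : ∀ i, IdentDistrib (fun ω => (Xs i ω, Ys i ω)) (fun ω => (X ω, Y ω)) P P) (n : ℕ) :
    P.map (sampleVec Xs Ys n) = Measure.pi fun _ : Fin n => P.map fun ω => (X ω, Y ω) := by
  have h := h_indep.precomp (g := fun i : Fin n => (i : ℕ)) Fin.val_injective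
  have h2 := (iIndepFun_iff_map_fun_eq_pi_map (f := fun (i : Fin n) ω => (Xs i ω, Ys i ω))
    (fun i => ((hXs i).prodMk (hYs i)).aemeasurable)).1 h
  simp_rw [fun i => (h_ident i).map_eq] at h2
  exact h2

/-- With the sample written through independent noise, conditioning on the X's is plain Fubini:
freeze `x` and integrate over `v`. -/
theorem pi_map_noise {μ : Measure ℝ} [IsProbabilityMeasure μ] {E : Type*} [MeasurableSpace E]
    {lam : Measure E} [IsProbabilityMeasure lam] {G : ℝ → E → ℝ}
    (hG : Measurable (Function.uncurry G)) {ρ : Measure (ℝ × ℝ)}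
    (hρ : (μ.prod lam).map (fun p => (p.1, G p.1 p.2)) = ρ) (n : ℕ) :
    (Measure.pi fun _ : Fin n => ρ)
      = ((Measure.pi fun _ : Fin n => μ).prod (Measure.pi fun _ : Fin n => lam)).map
          fun p i => (p.1 i, G (p.1 i) (p.2 i)) := by
  have hm : Measurable fun p : ℝ × E => (p.1, G p.1 p.2) := measurable_fst.prodMk hG
  have : IsProbabilityMeasure ((μ.prod lam).map fun p => (p.1, G p.1 p.2)) :=
    Measure.isProbabilityMeasure_map hm.aemeasurable
  rw [← hρ, ← Measure.pi_map_pi (fun _ => hm.aemeasurable)]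
  have h := (measurePreserving_arrowProdEquivProdArrow ℝ E (Fin n) (fun _ => μ) fun _ => lam)
  have h' := h.symm
  rw [← h'.map_eq, Measure.map_map]
  · rfl
  · exact measurable_pi_lambda _ fun i => hm.comp (measurable_pi_apply i)
  · exact h'.measurable

/-- A bound on the probability of an event that depends on the sample and on the sorting
permutation, by conditioning on the first coordinates and on the permutation. -/
theorem IsUniformTieBreaking.measure_le (hπ : IsUniformTieBreaking P Xs Ys π) {X Y : Ω → ℝ}
    (hXs : ∀ i, Measurable (Xs i)) (hYs : ∀ i, Measurable (Ys i))
    (h_indep : iIndepFun (fun i ω => (Xs i ω, Ys i ω)) P)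
    (h_ident : ∀ i, IdentDistrib (fun ω => (Xs i ω, Ys i ω)) (fun ω => (X ω, Y ω)) P P)
    {μ : Measure ℝ} [IsProbabilityMeasure μ] {E : Type*} [MeasurableSpace E]
    {lam : Measure E} [IsProbabilityMeasure lam] {G : ℝ → E → ℝ}
    (hG : Measurable (Function.uncurry G))
    (hlaw : (μ.prod lam).map (fun p => (p.1, G p.1 p.2)) = P.map fun ω => (X ω, Y ω))
    {n : ℕ} {A : Equiv.Perm (Fin n) → Set (Fin n → ℝ × ℝ)} (hA : ∀ σ, MeasurableSet (A σ))
    {c : ENNReal} (hc : ∀ (x : Fin n → ℝ) (σ : Equiv.Perm (Fin n)), σ ∈ sortingPerms x →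
      (Measure.pi fun _ : Fin n => lam) {v | (fun i => (x i, G (x i) (v i))) ∈ A σ} ≤ c) :
    P {ω | sampleVec Xs Ys n ω ∈ A (π n ω)} ≤ c := by
  have hS := measurable_sampleVec hXs hYs n
  have h1 : {ω | sampleVec Xs Ys n ω ∈ A (π n ω)}
      = ⋃ σ, ({ω | π n ω = σ} ∩ sampleVec Xs Ys n ⁻¹' (A σ)) := by
    ext ω
    simp
  rw [h1]
  refine (measure_iUnion_fintype_le _ _).trans ?_
  have hw : ∀ σ, Measurable fun x : Fin n → ℝ => ENNReal.ofReal (tieWeight x σ) :=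
    fun σ => (measurable_tieWeight σ).ennreal_ofReal
  have hm : Measurable fun (p : (Fin n → ℝ) × (Fin n → E)) i => (p.1 i, G (p.1 i) (p.2 i)) := by
    refine measurable_pi_lambda _ fun i => ?_
    have h2 : Measurable fun p : (Fin n → ℝ) × (Fin n → E) => (p.1 i, p.2 i) := by fun_prop
    exact (measurable_fst.comp h2).prodMk (hG.comp h2)
  have h2 : ∀ σ, P ({ω | π n ω = σ} ∩ sampleVec Xs Ys n ⁻¹' (A σ))
      = ∫⁻ x, ENNReal.ofReal (tieWeight x σ) * (Measure.pi fun _ : Fin n => lam)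
          {v | (fun i => (x i, G (x i) (v i))) ∈ A σ} ∂(Measure.pi fun _ : Fin n => μ) := by
    intro σ
    have hw' : Measurable fun s : Fin n → ℝ × ℝ =>
      ENNReal.ofReal (tieWeight (fun i => (s i).1) σ) := (hw σ).comp (by fun_prop)
    rw [hπ.measure_inter hXs hYs σ (hA σ), map_sampleVec hXs hYs h_indep h_ident,
      pi_map_noise hG hlaw, ← lintegral_indicator (hA σ),
      lintegral_map (hw'.indicator (hA σ)) hm]
    refine (lintegral_prod _ ((hw'.indicator (hA σ)).comp hm).aemeasurable).trans ?_
    refine lintegral_congr fun x => ?_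
    have hs : MeasurableSet {v : Fin n → E | (fun i => (x i, G (x i) (v i))) ∈ A σ} :=
      (hm.comp (measurable_const.prodMk measurable_id)) (hA σ)
    rw [← lintegral_indicator_const hs]
    rfl
  simp_rw [h2]
  rw [← lintegral_finsetSum']
  · calc _ ≤ ∫⁻ x, c ∂(Measure.pi fun _ : Fin n => μ) := ?_
      _ = c := by simp
    refine lintegral_mono fun x => ?_
    calc _ ≤ ∑ σ, ENNReal.ofReal (tieWeight x σ) * c := by
          refine Finset.sum_le_sum fun σ _ => ?_
          -- Permutations that do not sort `x` have weight zero, so no bound is required for them.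
          by_cases hσ : σ ∈ sortingPerms x
          · gcongr
            exact hc x σ hσ
          · simp [tieWeight, hσ]
      _ = ENNReal.ofReal (∑ σ, tieWeight x σ) * c := by
          rw [← Finset.sum_mul, ENNReal.ofReal_sum_of_nonneg fun σ _ => tieWeight_nonneg x σ]
      _ ≤ 1 * c := by
          gcongr
          exact ENNReal.ofReal_le_one.2 (sum_tieWeight_le_one x)
      _ = c := one_mul c
  · intro σ _
    refine ((hw σ).mul ?_).aemeasurable
    exact measurable_measure_prodMk_left (hm (hA σ))

end Ties

/-! ### Hoeffding bounds for sums over neighbours. -/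

section Concentration

variable {E : Type*} [MeasurableSpace E] {lam : Measure E} [IsProbabilityMeasure lam] {n : ℕ}
  {B ε : ℝ} {D : Fin (n - 1) → E → E → ℝ}

/-- Hoeffding's inequality for the terms of one parity, which depend on disjoint coordinates. -/
theorem measure_parity_sum_ge_le (σ : Equiv.Perm (Fin n)) (hBpos : 0 < B) (hε : 0 < ε)
    (hD : ∀ i, Measurable (Function.uncurry (D i))) (hB : ∀ i a b, |D i a b| ≤ B)
    (h0 : ∀ i, ∫ a, ∫ b, D i a b ∂lam ∂lam = 0) (r : ℕ) :
    (Measure.pi fun _ : Fin n => lam).real {v | ε * n ≤ ∑ i : {i : Fin (n - 1) // (i : ℕ) % 2 = r},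
      D i (v (σ ⟨i, by omega⟩)) (v (σ ⟨i + 1, by omega⟩))} ≤ Real.exp (-ε ^ 2 * n / (2 * B ^ 2)) := by
  let J := {i : Fin (n - 1) // (i : ℕ) % 2 = r}
  let g : J × Fin 2 → Fin n := fun p => σ ⟨p.1.1 + p.2, by omega⟩
  -- Pairs {i, i+1} whose left ends have equal parity are disjoint, so the terms use disjoint sets
  -- of coordinates and are independent.
  have hg : Function.Injective g := by
    rintro ⟨⟨i, hi⟩, a⟩ ⟨⟨j, hj⟩, b⟩ hab
    have h1 := congrArg Fin.val (σ.injective hab)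
    simp only at h1
    have h2 : (i : ℕ) = j ∧ (a : ℕ) = b := by omega
    have h3 : i = j := Fin.ext h2.1
    have h4 : a = b := Fin.ext h2.2
    subst h3 h4
    rfl
  have hind := (iIndepFun_pi (μ := fun _ : Fin n => lam) (X := fun _ => id)
    (fun _ => aemeasurable_id)).precomp hg
  have hind2 := iIndepFun_blocks (fun p => measurable_pi_apply (g p)) hind
  have hmD : ∀ i : J, Measurable fun w : Fin 2 → E => D i (w 0) (w 1) := fun i =>
    (hD i).comp (g := Function.uncurry (D i)) (f := fun w : Fin 2 → E => (w 0, w 1)) (by fun_prop)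
  have hind3 := hind2.comp (fun (i : J) w => D i (w 0) (w 1)) hmD
  have hsub : ∀ i ∈ (Finset.univ : Finset J), HasSubgaussianMGF
      ((fun (w : Fin 2 → E) => D i (w 0) (w 1)) ∘ fun (ω : Fin n → E) t => ω (g (i, t)))
      ((‖B - (-B)‖₊ / 2) ^ 2) (Measure.pi fun _ : Fin n => lam) := by
    intro i _
    refine hasSubgaussianMGF_of_mem_Icc_of_integral_eq_zero ?_ ?_ ?_
    · refine ((hmD i).comp ?_).aemeasurable
      exact measurable_pi_lambda _ fun t => measurable_pi_apply _
    · exact ae_of_all _ fun ω => abs_le.1 (hB i _ _)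
    · have hne : g (i, 0) ≠ g (i, 1) := fun h => by simpa using hg h
      exact (integral_pi_pair lam hne (hD i) (hB i)).trans (h0 i)
  have hcard : (Fintype.card J : ℝ) ≤ n := by
    have h1 : Fintype.card J ≤ Fintype.card (Fin (n - 1)) := Fintype.card_subtype_le _
    rw [Fintype.card_fin] at h1
    exact_mod_cast h1.trans (Nat.sub_le n 1)
  -- The empty sum is treated apart, since the exponent of Hoeffding's bound has the number of terms
  -- in its denominator.
  rcases Nat.eq_zero_or_pos (Fintype.card J) with hJ | hJ
  · have hJe : IsEmpty J := Fintype.card_eq_zero_iff.1 hJ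
    rcases Nat.eq_zero_or_pos n with rfl | hn
    · simp
    · have : {v : Fin n → E | ε * n ≤ ∑ i : J,
          D i (v (σ ⟨i, by omega⟩)) (v (σ ⟨i + 1, by omega⟩))} = ∅ := by
        ext v
        simp only [Finset.univ_eq_empty, Finset.sum_empty, Set.mem_ofPred_eq, Set.mem_empty_iff_false,
          iff_false, not_le]
        positivity
      rw [this]
      simp [Real.exp_nonneg]
  · have hpos : (0 : ℝ) < Fintype.card J := by exact_mod_cast hJ
    refine (HasSubgaussianMGF.measure_sum_ge_le_of_iIndepFun hind3 hsub
      (ε := ε * n) (by positivity)).trans ?_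
    refine Real.exp_le_exp.2 ?_
    have hc : ((∑ _i : J, (‖B - (-B)‖₊ / 2) ^ 2 : NNReal) : ℝ) = Fintype.card J * B ^ 2 := by
      push_cast
      rw [Finset.sum_const, Finset.card_univ, nsmul_eq_mul, Real.norm_of_nonneg (by linarith)]
      ring
    rw [hc, neg_mul, neg_div, neg_div, neg_le_neg_iff, div_le_div_iff₀ (by positivity) (by positivity)]
    have : ε ^ 2 * n * (2 * B ^ 2) * Fintype.card J ≤ ε ^ 2 * n * (2 * B ^ 2) * n := by gcongr
    nlinarith

/-- A Hoeffding-type inequality for sums over adjacent pairs of independent variables. -/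
theorem measure_adjacent_sum_ge_le (σ : Equiv.Perm (Fin n)) (hBpos : 0 < B) (hε : 0 < ε)
    (hD : ∀ i, Measurable (Function.uncurry (D i))) (hB : ∀ i a b, |D i a b| ≤ B)
    (h0 : ∀ i, ∫ a, ∫ b, D i a b ∂lam ∂lam = 0) :
    (Measure.pi fun _ : Fin n => lam).real {v | ε * n ≤ ∑ i : Fin (n - 1),
      D i (v (σ ⟨i, by omega⟩)) (v (σ ⟨i + 1, by omega⟩))}
      ≤ 2 * Real.exp (-ε ^ 2 * n / (8 * B ^ 2)) := by
  -- If the whole sum reaches `ε * n`, one of the two parity sums reaches half of it; halving `ε`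
  -- turns 2 into 8 in the exponent.
  have h := fun r => measure_parity_sum_ge_le σ hBpos (half_pos hε) hD hB h0 r
  have he : Real.exp (-(ε / 2) ^ 2 * n / (2 * B ^ 2)) = Real.exp (-ε ^ 2 * n / (8 * B ^ 2)) := by
    congr 1
    field_simp
    ring
  rw [two_mul, ← he]
  refine le_trans ?_ (add_le_add (h 0) (h 1))
  refine (measureReal_mono ?_).trans (measureReal_union_le _ _)
  intro v hv
  simp only [Set.mem_ofPred_eq, Set.mem_union] at hv ⊢
  by_contra! hcon
  have hsplit : ∀ f : Fin (n - 1) → ℝ, ∑ i, f i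
      = (∑ i : {i : Fin (n - 1) // (i : ℕ) % 2 = 0}, f i)
        + ∑ i : {i : Fin (n - 1) // (i : ℕ) % 2 = 1}, f i := by
    intro f
    rw [← Fintype.sum_subtype_add_sum_subtype (fun i : Fin (n - 1) => (i : ℕ) % 2 = 0) f]
    congr 1
    exact Fintype.sum_equiv (Equiv.subtypeEquivRight fun i => by omega) _ _ fun i => rfl
  rw [hsplit] at hv
  linarith [hcon.1, hcon.2]

theorem measure_abs_adjacent_sum_ge_le (σ : Equiv.Perm (Fin n)) (hBpos : 0 < B) (hε : 0 < ε)
    (hD : ∀ i, Measurable (Function.uncurry (D i))) (hB : ∀ i a b, |D i a b| ≤ B)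
    (h0 : ∀ i, ∫ a, ∫ b, D i a b ∂lam ∂lam = 0) :
    (Measure.pi fun _ : Fin n => lam).real {v | ε * n ≤ |∑ i : Fin (n - 1),
      D i (v (σ ⟨i, by omega⟩)) (v (σ ⟨i + 1, by omega⟩))|}
      ≤ 4 * Real.exp (-ε ^ 2 * n / (8 * B ^ 2)) := by
  have h1 := measure_adjacent_sum_ge_le σ hBpos hε hD hB h0
  have h2 := measure_adjacent_sum_ge_le (lam := lam) (D := fun i a b => -D i a b) σ hBpos hε
    (fun i => (hD i).neg) (fun i a b => by simpa using hB i a b)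
    (fun i => by simp [integral_neg, h0 i])
  refine (measureReal_mono ?_).trans ((measureReal_union_le _ _).trans
    ((add_le_add h1 h2).trans_eq (by ring)))
  intro v hv
  simp only [Set.mem_ofPred_eq, Set.mem_union, Finset.sum_neg_distrib] at hv ⊢
  exact le_abs.1 hv

end Concentration

theorem summable_exp_neg_mul_nat {c : ℝ} (hc : 0 < c) :
    Summable fun n : ℕ => Real.exp (-c * n) := by
  have := Real.summable_exp_nat_mul_iff.2 (neg_neg_of_pos hc)
  simpa [mul_comm] using this

/-! ### Sums over neighbours and variation along monotone sequences. -/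

section AdjacentSums

theorem sum_adjacent_left_add_last {n : ℕ} (hn : 0 < n) (f : Fin n → ℝ) :
    (∑ i : Fin (n - 1), f ⟨i, by omega⟩) + f ⟨n - 1, by omega⟩ = ∑ j, f j := by
  cases n with
  | zero => omega
  | succ m => rw [Fin.sum_univ_castSucc]; rfl

theorem sum_adjacent_right_add_first {n : ℕ} (hn : 0 < n) (f : Fin n → ℝ) :
    (∑ i : Fin (n - 1), f ⟨i + 1, by omega⟩) + f ⟨0, hn⟩ = ∑ j, f j := by
  cases n with
  | zero => omega
  | succ m => rw [Fin.sum_univ_succ, add_comm]; rfl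

theorem sum_adjacent_left_le {n : ℕ} {f : Fin n → ℝ} (hf : ∀ j, 0 ≤ f j) :
    ∑ i : Fin (n - 1), f ⟨i, by omega⟩ ≤ ∑ j, f j := by
  rcases Nat.eq_zero_or_pos n with rfl | hn
  · simp
  · linarith [sum_adjacent_left_add_last hn f, hf ⟨n - 1, by omega⟩]

theorem sum_adjacent_right_le {n : ℕ} {f : Fin n → ℝ} (hf : ∀ j, 0 ≤ f j) :
    ∑ i : Fin (n - 1), f ⟨i + 1, by omega⟩ ≤ ∑ j, f j := by
  rcases Nat.eq_zero_or_pos n with rfl | hn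
  · simp
  · linarith [sum_adjacent_right_add_first hn f, hf ⟨0, hn⟩]

/-- The variation of a compactly supported continuous function along monotone sequences. -/
theorem exists_sum_abs_sub_le {g : ℝ → ℝ} (hg : Continuous g) (hs : HasCompactSupport g) {ε : ℝ}
    (hε : 0 < ε) : ∃ C : ℝ, ∀ (n : ℕ) (x : Fin n → ℝ), Monotone x →
      ∑ i : Fin (n - 1), |g (x ⟨i + 1, by omega⟩) - g (x ⟨i, by omega⟩)| ≤ ε * n + C := by
  obtain ⟨B, hB⟩ := hg.bounded_above_of_compact_support hs
  have hB0 : 0 ≤ B := (norm_nonneg _).trans (hB 0)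
  obtain ⟨δ, hδ, hu⟩ := Metric.uniformContinuous_iff.1 (hs.uniformContinuous_of_continuous hg) ε hε
  obtain ⟨r, hr⟩ := hs.isCompact.isBounded.subset_closedBall (0 : ℝ)
  let M := |r| + 1
  have hM : 0 < M := by positivity
  have hg0 : ∀ x, M ≤ |x| → g x = 0 := by
    intro x hx
    refine image_eq_zero_of_notMem_tsupport fun hx' => ?_
    have h1 := hr hx'
    rw [mem_closedBall_zero_iff, Real.norm_eq_abs] at h1
    have h2 := le_abs_self r
    simp only [M] at hx
    linarith
  -- Clipping to [-M, M] does not change `g`, which vanishes at and beyond ±M, and it makes the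
  -- total length travelled by a monotone sequence at most 2M.
  let c : ℝ → ℝ := fun x => max (-M) (min x M)
  have hc1 : ∀ x, -M ≤ c x := fun x => le_max_left _ _
  have hc2 : ∀ x, c x ≤ M := fun x => max_le (by linarith) (min_le_right _ _)
  have hcm : Monotone c := fun a b h => max_le_max le_rfl (min_le_min h le_rfl)
  have hgc : ∀ x, g x = g (c x) := by
    intro x
    by_cases h1 : x ≤ -M
    · have : c x = -M := by simp only [c]; rw [min_eq_left (by linarith), max_eq_left h1]
      rw [this, hg0 x (by rw [abs_of_nonpos (by linarith)]; linarith), hg0 (-M) (by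
        rw [abs_neg]; exact le_abs_self M)]
    · by_cases h2 : M ≤ x
      · have : c x = M := by simp only [c]; rw [min_eq_right h2, max_eq_right (by linarith)]
        rw [this, hg0 x (h2.trans (le_abs_self x)), hg0 M (le_abs_self M)]
      · have : c x = x := by
          simp only [c]; rw [min_eq_left (by linarith), max_eq_right (by linarith)]
        rw [this]
  -- A clipped step shorter than `δ` costs at most `ε` by uniform continuity; a longer one costs at
  -- most 2B, which is charged to its length. The lengths telescope.
  have key : ∀ a b, a ≤ b → |g b - g a| ≤ ε + 2 * B / δ * (c b - c a) := by
    intro a b hab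
    have hcab := hcm hab
    rw [hgc a, hgc b]
    by_cases h : c b - c a < δ
    · have h1 := hu (a := c b) (b := c a) (by rw [Real.dist_eq, abs_of_nonneg (by linarith)]; exact h)
      rw [Real.dist_eq] at h1
      have : 0 ≤ 2 * B / δ * (c b - c a) := mul_nonneg (by positivity) (by linarith)
      linarith
    · have h1 : |g (c b) - g (c a)| ≤ 2 * B := by
        have h2 := hB (c b); have h3 := hB (c a)
        rw [Real.norm_eq_abs] at h2 h3
        exact (abs_sub _ _).trans (by linarith)
      have h2 : 2 * B ≤ 2 * B / δ * (c b - c a) := by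
        rw [div_mul_eq_mul_div, le_div_iff₀ hδ]
        exact mul_le_mul_of_nonneg_left (not_lt.1 h) (by positivity)
      linarith
  refine ⟨2 * B / δ * (2 * M), fun n x hx => ?_⟩
  rcases Nat.eq_zero_or_pos n with rfl | hn
  · simp; positivity
  calc _ ≤ ∑ i : Fin (n - 1), (ε + 2 * B / δ * (c (x ⟨i + 1, by omega⟩) - c (x ⟨i, by omega⟩))) :=
        Finset.sum_le_sum fun i _ => key _ _ (hx (by simp [Fin.le_def]))
    _ = ε * (n - 1 : ℕ) + 2 * B / δ * (c (x ⟨n - 1, by omega⟩) - c (x ⟨0, hn⟩)) := by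
        have h1 := sum_adjacent_left_add_last hn (fun j => c (x j))
        have h2 := sum_adjacent_right_add_first hn (fun j => c (x j))
        rw [Finset.sum_add_distrib, ← Finset.mul_sum, Finset.sum_sub_distrib]
        simp only [Finset.sum_const, Finset.card_univ, Fintype.card_fin, nsmul_eq_mul]
        have h3 : ∑ i : Fin (n - 1), c (x ⟨i + 1, by omega⟩) - ∑ i : Fin (n - 1), c (x ⟨i, by omega⟩)
          = c (x ⟨n - 1, by omega⟩) - c (x ⟨0, hn⟩) := by linarith
        rw [h3]; ring
    _ ≤ _ := by
        gcongr
        · omega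
        · linarith [hc2 (x ⟨n - 1, by omega⟩), hc1 (x ⟨0, hn⟩)]

end AdjacentSums

/-! ### Integrable functions along the sorted sample. -/

section Sorted

variable {Ω : Type*} [MeasurableSpace Ω] {P : Measure Ω} [IsProbabilityMeasure P]
  {X : ℕ → Ω → ℝ} {μ : Measure ℝ} [IsProbabilityMeasure μ]

theorem eventually_le_mul_nat (C : ℝ) {ε : ℝ} (hε : 0 < ε) : ∀ᶠ n : ℕ in atTop, C ≤ ε * n := by
  filter_upwards [eventually_ge_atTop ⌈C / ε⌉₊] with n hn
  have := Nat.ceil_le.1 hn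
  rw [div_le_iff₀ hε] at this
  linarith

/-- Consecutive values of `g` along the sorted sample are close on average. -/
theorem ae_eventually_sum_abs_sub_le (hX : ∀ i, Measurable (X i)) (hind : iIndepFun X P)
    (hlaw : ∀ i, P.map (X i) = μ) {g : ℝ → ℝ} (hg : Measurable g) (hint : Integrable g μ)
    {ε : ℝ} (hε : 0 < ε) :
    ∀ᵐ ω ∂P, ∀ᶠ n : ℕ in atTop, ∀ σ ∈ sortingPerms (fun i : Fin n => X i ω),
      ∑ i : Fin (n - 1), |g (X (σ ⟨i + 1, by omega⟩) ω) - g (X (σ ⟨i, by omega⟩) ω)| ≤ ε * n := by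
  -- Approximate `g` by `f` in L¹. Each sample point lies in at most two neighbour pairs, so the
  -- strong law bounds the replacement error by 2ε/5 per point; the variation of `f` and the
  -- constant `C` cost ε/5 each.
  obtain ⟨f, hfs, hf, hfc, hfi⟩ := hint.exists_hasCompactSupport_integral_sub_le
    (ε := ε / 6) (by positivity)
  obtain ⟨C, hC⟩ := exists_sum_abs_sub_le hfc hfs (ε := ε / 5) (by positivity)
  have hm : Measurable fun x => ‖g x - f x‖ := (hg.sub hfc.measurable).norm
  have hi : Integrable (fun x => ‖g x - f x‖) μ := (hint.sub hfi).norm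
  filter_upwards [tendsto_average_of_bounded hX hind hlaw hm hi] with ω hω
  filter_upwards [hω.eventually (gt_mem_nhds (show _ < ε / 5 by linarith)),
    eventually_le_mul_nat C (show 0 < ε / 5 by positivity), eventually_gt_atTop 0]
    with n h1 h2 hn σ hσ
  have h3 := hC n _ hσ
  beta_reduce at h3
  have hn' : (0 : ℝ) < n := by exact_mod_cast hn
  rw [div_lt_iff₀ hn'] at h1
  have h4 : ∑ j : Fin n, ‖g (X (σ j) ω) - f (X (σ j) ω)‖ = ∑ j : Fin n, ‖g (X j ω) - f (X j ω)‖ :=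
    Equiv.sum_comp σ fun j : Fin n => ‖g (X j ω) - f (X j ω)‖
  have h5 := sum_adjacent_left_le (f := fun j => ‖g (X (σ j) ω) - f (X (σ j) ω)‖)
    fun j => norm_nonneg _
  have h6 := sum_adjacent_right_le (f := fun j => ‖g (X (σ j) ω) - f (X (σ j) ω)‖)
    fun j => norm_nonneg _
  calc _ ≤ ∑ i : Fin (n - 1), (‖g (X (σ ⟨i + 1, by omega⟩) ω) - f (X (σ ⟨i + 1, by omega⟩) ω)‖
        + ‖g (X (σ ⟨i, by omega⟩) ω) - f (X (σ ⟨i, by omega⟩) ω)‖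
        + |f (X (σ ⟨i + 1, by omega⟩) ω) - f (X (σ ⟨i, by omega⟩) ω)|) := by
        refine Finset.sum_le_sum fun i _ => ?_
        simp only [Real.norm_eq_abs]
        generalize g (X (σ ⟨i + 1, by omega⟩) ω) = a
        generalize g (X (σ ⟨i, by omega⟩) ω) = b
        generalize f (X (σ ⟨i + 1, by omega⟩) ω) = a'
        generalize f (X (σ ⟨i, by omega⟩) ω) = b'
        have h7 : a - b = (a - a') - (b - b') + (a' - b') := by ring
        rw [h7]
        exact (abs_add_le _ _).trans (by gcongr; exact abs_sub _ _)
    _ ≤ _ := by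
        rw [Finset.sum_add_distrib, Finset.sum_add_distrib]
        have := mul_pos hε hn'
        linarith

end Sorted

/-! ### Bounded Lipschitz kernels. -/

/-- Data describing a bounded Lipschitz kernel on the real line. -/
structure BoundedLipschitz (h : ℝ → ℝ → ℝ) (K B : ℝ) : Prop where
  lip : ∀ a b c d, |h a b - h c d| ≤ K * (|a - c| + |b - d|)
  bdd : ∀ a b, |h a b| ≤ B

namespace BoundedLipschitz

variable {h : ℝ → ℝ → ℝ} {K B : ℝ} (hh : BoundedLipschitz h K B)
include hh

theorem nonneg_left : 0 ≤ K := by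
  have := (abs_nonneg _).trans (hh.lip 1 0 0 0)
  simpa using this

theorem nonneg_right : 0 ≤ B := (abs_nonneg _).trans (hh.bdd 0 0)

theorem continuous : Continuous (Function.uncurry h) := by
  have : LipschitzWith (2 * K).toNNReal (Function.uncurry h) := by
    refine LipschitzWith.of_dist_le_mul fun p q => ?_
    have hK := hh.nonneg_left
    rw [Real.coe_toNNReal _ (by positivity), Real.dist_eq, Prod.dist_eq, Real.dist_eq, Real.dist_eq]
    refine (hh.lip _ _ _ _).trans ?_
    have h1 := le_max_left |p.1 - q.1| |p.2 - q.2|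
    have h2 := le_max_right |p.1 - q.1| |p.2 - q.2|
    nlinarith
  exact this.continuous

theorem measurable : Measurable (Function.uncurry h) := hh.continuous.measurable

end BoundedLipschitz

/-! ### Conditional mean of the kernel at two neighbouring covariates. -/

section MixedKernel

variable {E : Type*} [MeasurableSpace E] {lam : Measure E} [IsProbabilityMeasure lam]
  {φ : ℝ → E → ℝ} {h : ℝ → ℝ → ℝ} {K B : ℝ}

/-- The mean of `h (U, U')` for independent `U`, `U'` with conditional laws given `x`, `x'`. -/
noncomputable def mixedKernel (lam : Measure E) (φ : ℝ → E → ℝ) (h : ℝ → ℝ → ℝ) (x x' : ℝ) : ℝ :=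
  ∫ a, ∫ b, h (φ x a) (φ x' b) ∂lam ∂lam

/-- The conditional probability that `⌊m U⌋ = k` given `x`. -/
noncomputable def cellProb (lam : Measure E) (φ : ℝ → E → ℝ) (m k : ℕ) (x : ℝ) : ℝ :=
  ∫ b, (if ⌊φ x b * m⌋₊ = k then (1 : ℝ) else 0) ∂lam

theorem abs_integral_le_of_bound {f : E → ℝ} {C : ℝ} (hf : ∀ a, |f a| ≤ C) :
    |∫ a, f a ∂lam| ≤ C := by
  have := norm_integral_le_of_norm_le_const (μ := lam) (ae_of_all _ fun a => (Real.norm_eq_abs _).trans_le (hf a))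
  simpa using this

theorem measurable_cellIndicator (hφ : Measurable (Function.uncurry φ)) (m k : ℕ) :
    Measurable (Function.uncurry fun x b => if ⌊φ x b * m⌋₊ = k then (1 : ℝ) else 0) := by
  refine Measurable.ite ?_ measurable_const measurable_const
  have : Measurable fun p : ℝ × E => ⌊Function.uncurry φ p * m⌋₊ :=
    Nat.measurable_floor.comp (hφ.mul_const _)
  exact this (measurableSet_singleton k)

theorem measurable_cellProb (hφ : Measurable (Function.uncurry φ)) (m k : ℕ) :
    Measurable (cellProb lam φ m k) :=
  (measurable_cellIndicator hφ m k).stronglyMeasurable.integral_prod_right.measurable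

theorem abs_cellProb_le (m k : ℕ) (x : ℝ) : |cellProb lam φ m k x| ≤ 1 :=
  abs_integral_le_of_bound fun b => by split_ifs <;> simp

/-- Rounding the second argument to a grid of mesh 1/m makes the dependence on `x` pass through
finitely many scalar functions, to which the variation bound along the sorted sample applies. The
index `k = m` is kept because the value 1 is possible. -/
theorem abs_integral_sub_sum_cellProb_le (hφ : Measurable (Function.uncurry φ))
    (hφ01 : ∀ x v, φ x v ∈ Set.Icc (0 : ℝ) 1) (hh : BoundedLipschitz h K B) {m : ℕ} (hm : 0 < m)
    (u x : ℝ) :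
    |∫ b, h u (φ x b) ∂lam - ∑ k ∈ Finset.range (m + 1), h u (k / m) * cellProb lam φ m k x|
      ≤ K / m := by
  have hφx : Measurable (φ x) := hφ.comp measurable_prodMk_left
  have hmR : (0 : ℝ) < m := by exact_mod_cast hm
  have hi1 : Integrable (fun b => h u (φ x b)) lam :=
    Integrable.of_bound ((hh.measurable.comp measurable_prodMk_left).comp hφx).aestronglyMeasurable
      B (ae_of_all _ fun b => hh.bdd _ _)
  have hi2 : ∀ k : ℕ, Integrable
      (fun b => h u (k / m) * (if ⌊φ x b * m⌋₊ = k then (1 : ℝ) else 0)) lam := fun k =>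
    (Integrable.of_bound ((measurable_cellIndicator hφ m k).comp
      measurable_prodMk_left).aestronglyMeasurable 1
      (ae_of_all _ fun b => by simp only [Function.comp, Function.uncurry]; split_ifs <;> simp)).const_mul _
  have h1 : ∑ k ∈ Finset.range (m + 1), h u (k / m) * cellProb lam φ m k x
      = ∫ b, ∑ k ∈ Finset.range (m + 1),
          h u (k / m) * (if ⌊φ x b * m⌋₊ = k then (1 : ℝ) else 0) ∂lam := by
    rw [integral_finsetSum _ fun k _ => hi2 k]
    simp only [cellProb, integral_const_mul]
  rw [h1, ← integral_sub hi1 (integrable_finsetSum _ fun k _ => hi2 k)]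
  refine abs_integral_le_of_bound fun b => ?_
  obtain ⟨h0, h2⟩ := hφ01 x b
  have hfl : ⌊φ x b * m⌋₊ ∈ Finset.range (m + 1) := by
    rw [Finset.mem_range, Nat.lt_succ_iff]
    have : φ x b * m ≤ m := by nlinarith
    exact (Nat.floor_le_floor this).trans_eq (Nat.floor_natCast m)
  rw [Finset.sum_eq_single_of_mem _ hfl (fun k _ hk => by simp [Ne.symm hk])]
  simp only [if_true, mul_one]
  refine (hh.lip _ _ _ _).trans ?_
  have h3 := Nat.floor_le (show 0 ≤ φ x b * m by positivity)
  have h4 := Nat.lt_floor_add_one (φ x b * m)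
  have h5 : |φ x b - ⌊φ x b * m⌋₊ / m| ≤ 1 / m := by
    rw [abs_le]
    constructor
    · have : (⌊φ x b * m⌋₊ : ℝ) / m ≤ φ x b := by rw [div_le_iff₀ hmR]; exact h3
      have : 0 ≤ 1 / (m : ℝ) := by positivity
      linarith
    · rw [sub_le_iff_le_add, ← add_div, le_div_iff₀ hmR]
      linarith
  rw [sub_self, abs_zero, zero_add, div_eq_mul_one_div K]
  exact mul_le_mul_of_nonneg_left h5 hh.nonneg_left

theorem integrable_inner (hφ : Measurable (Function.uncurry φ)) (hh : BoundedLipschitz h K B)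
    (x x' : ℝ) : Integrable (fun a => ∫ b, h (φ x a) (φ x' b) ∂lam) lam := by
  have h1 : Measurable (Function.uncurry fun a b => h (φ x a) (φ x' b)) :=
    hh.measurable.comp (((hφ.comp measurable_prodMk_left).comp measurable_fst).prodMk
      ((hφ.comp measurable_prodMk_left).comp measurable_snd))
  exact Integrable.of_bound h1.stronglyMeasurable.integral_prod_right.aestronglyMeasurable B
    (ae_of_all _ fun a => abs_integral_le_of_bound fun b => hh.bdd _ _)

theorem abs_mixedKernel_le (hh : BoundedLipschitz h K B) (x x' : ℝ) :
    |mixedKernel lam φ h x x'| ≤ B :=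
  abs_integral_le_of_bound fun _ => abs_integral_le_of_bound fun _ => hh.bdd _ _

theorem measurable_mixedKernel (hφ : Measurable (Function.uncurry φ))
    (hh : BoundedLipschitz h K B) : Measurable fun p : ℝ × ℝ => mixedKernel lam φ h p.1 p.2 := by
  have h1 : Measurable fun q : ((ℝ × ℝ) × E) × E => h (φ q.1.1.1 q.1.2) (φ q.1.1.2 q.2) :=
    hh.measurable.comp ((hφ.comp (show Measurable fun q : ((ℝ × ℝ) × E) × E => (q.1.1.1, q.1.2) by
      fun_prop)).prodMk (hφ.comp (show Measurable fun q : ((ℝ × ℝ) × E) × E => (q.1.1.2, q.2) by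
      fun_prop)))
  have h2 : StronglyMeasurable fun q : (ℝ × ℝ) × E => ∫ b, h (φ q.1.1 q.2) (φ q.1.2 b) ∂lam :=
    h1.stronglyMeasurable.integral_prod_right'
  exact h2.integral_prod_right'.measurable

/-- The term 2K/m is the rounding error at `x` and at `x'`; the rest compares cell probabilities and
no longer involves the first argument of `h`. -/
theorem abs_mixedKernel_sub_le (hφ : Measurable (Function.uncurry φ))
    (hφ01 : ∀ x v, φ x v ∈ Set.Icc (0 : ℝ) 1) (hh : BoundedLipschitz h K B) {m : ℕ} (hm : 0 < m)
    (x x' : ℝ) :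
    |mixedKernel lam φ h x x' - mixedKernel lam φ h x x|
      ≤ 2 * K / m + B * ∑ k ∈ Finset.range (m + 1),
          |cellProb lam φ m k x' - cellProb lam φ m k x| := by
  rw [mixedKernel, mixedKernel,
    ← integral_sub (integrable_inner hφ hh x x') (integrable_inner hφ hh x x)]
  refine abs_integral_le_of_bound fun a => ?_
  have h1 := abs_le.1 (abs_integral_sub_sum_cellProb_le (lam := lam) hφ hφ01 hh hm (φ x a) x')
  have h2 := abs_le.1 (abs_integral_sub_sum_cellProb_le (lam := lam) hφ hφ01 hh hm (φ x a) x)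
  have h3 : |∑ k ∈ Finset.range (m + 1), h (φ x a) (k / m) * cellProb lam φ m k x'
      - ∑ k ∈ Finset.range (m + 1), h (φ x a) (k / m) * cellProb lam φ m k x|
      ≤ B * ∑ k ∈ Finset.range (m + 1), |cellProb lam φ m k x' - cellProb lam φ m k x| := by
    rw [← Finset.sum_sub_distrib, Finset.mul_sum]
    refine (Finset.abs_sum_le_sum_abs _ _).trans (Finset.sum_le_sum fun k _ => ?_)
    rw [← mul_sub, abs_mul]
    exact mul_le_mul_of_nonneg_right (hh.bdd _ _) (abs_nonneg _)
  have h4 := abs_le.1 h3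
  have h5 : 2 * K / m = K / m + K / m := by ring
  rw [abs_le, h5]
  constructor <;> linarith [h1.1, h1.2, h2.1, h2.2, h4.1, h4.2]

variable {Ω : Type*} [MeasurableSpace Ω] {P : Measure Ω} [IsProbabilityMeasure P]
  {X : ℕ → Ω → ℝ} {μ : Measure ℝ} [IsProbabilityMeasure μ]

/-- Along the sorted sample, the averages of the mixed kernel converge to its diagonal mean. -/
theorem ae_eventually_mixedKernel_sum (hφ : Measurable (Function.uncurry φ))
    (hφ01 : ∀ x v, φ x v ∈ Set.Icc (0 : ℝ) 1) (hh : BoundedLipschitz h K B)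
    (hX : ∀ i, Measurable (X i)) (hind : iIndepFun X P) (hlaw : ∀ i, P.map (X i) = μ)
    {ε : ℝ} (hε : 0 < ε) :
    ∀ᵐ ω ∂P, ∀ᶠ n : ℕ in atTop, ∀ σ ∈ sortingPerms (fun i : Fin n => X i ω),
      |∑ i : Fin (n - 1), mixedKernel lam φ h (X (σ ⟨i, by omega⟩) ω) (X (σ ⟨i + 1, by omega⟩) ω)
        - n * ∫ x, mixedKernel lam φ h x x ∂μ| ≤ ε * n := by
  -- The budget `ε` is split into four quarters: rounding (hence m > 8K/ε), cell probabilities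
  -- (hence `η`, with B + 1 to avoid dividing by zero), the strong law on the diagonal, and the last
  -- diagonal term, which has no right neighbour.
  obtain ⟨m, hm⟩ := exists_nat_gt (max 1 (8 * K / ε))
  have hm0 : 0 < m := by
    have := (le_max_left _ _).trans_lt hm
    exact_mod_cast one_pos.trans this
  have hmR : (0 : ℝ) < m := by exact_mod_cast hm0
  have hm1 : 2 * K / m ≤ ε / 4 := by
    have := ((le_max_right _ _).trans_lt hm).le
    rw [div_le_iff₀ hε] at this
    rw [div_le_iff₀ hmR]
    linarith
  have hB := hh.nonneg_right
  let η := ε / (4 * (B + 1) * (m + 1))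
  have hη : 0 < η := by positivity
  have hcell := fun k : ℕ => ae_eventually_sum_abs_sub_le hX hind hlaw
    (measurable_cellProb (lam := lam) hφ m k) (Integrable.of_bound
      (measurable_cellProb hφ m k).aestronglyMeasurable 1 (ae_of_all _ (abs_cellProb_le m k))) hη
  have hmeas : Measurable fun x => mixedKernel lam φ h x x :=
    (measurable_mixedKernel hφ hh).comp (measurable_id.prodMk measurable_id)
  have hslln := tendsto_average_of_bounded hX hind hlaw hmeas
    (Integrable.of_bound hmeas.aestronglyMeasurable B (ae_of_all _ fun x => abs_mixedKernel_le hh x x))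
  filter_upwards [ae_all_iff.2 hcell, hslln] with ω h1 h2
  have h1' : ∀ᶠ n : ℕ in atTop, ∀ k ∈ Finset.range (m + 1),
      ∀ σ ∈ sortingPerms (fun i : Fin n => X i ω), ∑ i : Fin (n - 1),
        |cellProb lam φ m k (X (σ ⟨i + 1, by omega⟩) ω)
          - cellProb lam φ m k (X (σ ⟨i, by omega⟩) ω)| ≤ η * n :=
    (Filter.eventually_all_finset _).2 fun k _ => h1 k
  have h2' := Metric.tendsto_nhds.1 h2 (ε / 4) (by positivity)
  filter_upwards [h1', h2', eventually_le_mul_nat B (show 0 < ε / 4 by positivity),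
    eventually_gt_atTop 0] with n h3 h4 h5 hn σ hσ
  have hnR : (0 : ℝ) < n := by exact_mod_cast hn
  set H := mixedKernel lam φ h with hH
  set I := ∫ x, H x x ∂μ with hI
  have h6 : |∑ j : Fin n, H (X (σ j) ω) (X (σ j) ω) - n * I| ≤ ε / 4 * n := by
    rw [Equiv.sum_comp σ fun j : Fin n => H (X j ω) (X j ω)]
    rw [Real.dist_eq] at h4
    have h7 : ∑ j : Fin n, H (X j ω) (X j ω) - n * I
        = n * ((∑ j : Fin n, H (X j ω) (X j ω)) / n - I) := by field_simp
    rw [h7, abs_mul, abs_of_pos hnR, mul_comm]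
    exact mul_le_mul_of_nonneg_right h4.le hnR.le
  have h7 := sum_adjacent_left_add_last hn fun j => H (X (σ j) ω) (X (σ j) ω)
  have h8 := abs_mixedKernel_le (lam := lam) (φ := φ) hh (X (σ ⟨n - 1, by omega⟩) ω)
    (X (σ ⟨n - 1, by omega⟩) ω)
  have h9 : |∑ i : Fin (n - 1), H (X (σ ⟨i, by omega⟩) ω) (X (σ ⟨i + 1, by omega⟩) ω)
      - ∑ i : Fin (n - 1), H (X (σ ⟨i, by omega⟩) ω) (X (σ ⟨i, by omega⟩) ω)| ≤ ε / 2 * n := by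
    rw [← Finset.sum_sub_distrib]
    refine (Finset.abs_sum_le_sum_abs _ _).trans ?_
    refine (Finset.sum_le_sum fun i _ => abs_mixedKernel_sub_le hφ hφ01 hh hm0 _ _).trans ?_
    rw [Finset.sum_add_distrib, ← Finset.mul_sum, Finset.sum_comm, Finset.sum_const,
      Finset.card_univ, Fintype.card_fin, nsmul_eq_mul]
    have h10 : ∑ k ∈ Finset.range (m + 1), ∑ i : Fin (n - 1),
        |cellProb lam φ m k (X (σ ⟨i + 1, by omega⟩) ω)
          - cellProb lam φ m k (X (σ ⟨i, by omega⟩) ω)| ≤ (m + 1) * (η * n) := by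
      refine (Finset.sum_le_sum fun k hk => h3 k hk σ hσ).trans ?_
      simp
    have h11 : B * ((m + 1) * (η * n)) ≤ ε / 4 * n := by
      have : B * ((m + 1) * (η * n)) = B / (B + 1) * (ε / 4 * n) := by
        simp only [η]; field_simp
      rw [this]
      have : B / (B + 1) ≤ 1 := by rw [div_le_one (by positivity)]; linarith
      exact mul_le_of_le_one_left (by positivity) this
    have h12 : ((n - 1 : ℕ) : ℝ) * (2 * K / m) ≤ n * (ε / 4) := by
      have := hh.nonneg_left
      gcongr
      omega
    have := mul_le_mul_of_nonneg_left h10 hB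
    linarith
  rw [← hH] at h8
  have a6 := abs_le.1 h6; have a8 := abs_le.1 h8; have a9 := abs_le.1 h9
  rw [abs_le]
  constructor <;> linarith [a6.1, a6.2, a8.1, a8.2, a9.1, a9.2]

end MixedKernel

/-! ### Distribution functions, sample ranks and Glivenko–Cantelli. -/

theorem exists_cdf_eq {ν : Measure ℝ} (hc : Continuous (cdf ν)) {c : ℝ} (h0 : 0 < c) (h1 : c < 1) :
    ∃ t, cdf ν t = c := by
  obtain ⟨a, ha⟩ := ((tendsto_cdf_atBot ν).eventually (gt_mem_nhds h0)).exists
  obtain ⟨b, hb⟩ := ((tendsto_cdf_atTop ν).eventually (lt_mem_nhds h1)).exists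
  exact mem_range_of_exists_le_of_exists_ge hc ⟨a, ha.le⟩ ⟨b, hb.le⟩

theorem cdf_mem_Icc (ν : Measure ℝ) (t : ℝ) : cdf ν t ∈ Set.Icc (0 : ℝ) 1 :=
  ⟨cdf_nonneg ν t, cdf_le_one ν t⟩

theorem measurable_cdf (ν : Measure ℝ) : Measurable (cdf ν) := (monotone_cdf ν).measurable

theorem sampleRank_mono {n : ℕ} (y : Fin n → ℝ) : Monotone (sampleRank y) := by
  intro s t hst
  exact Finset.sum_le_sum fun j _ => Set.indicator_le_indicator_of_subset
    (Set.Iic_subset_Iic.2 hst) (fun _ => zero_le_one) _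

theorem sampleRank_nonneg {n : ℕ} (y : Fin n → ℝ) (t : ℝ) : 0 ≤ sampleRank y t :=
  Finset.sum_nonneg fun _ _ => Set.indicator_nonneg (fun _ _ => zero_le_one) _

theorem sampleRank_le {n : ℕ} (y : Fin n → ℝ) (t : ℝ) : sampleRank y t ≤ n := by
  have : sampleRank y t ≤ ∑ _ : Fin n, (1 : ℝ) :=
    Finset.sum_le_sum fun _ _ => Set.indicator_le' (fun _ _ => le_rfl) (fun _ _ => zero_le_one) _
  simpa using this

theorem sampleRank_div_mem_Icc {n : ℕ} (y : Fin n → ℝ) (t : ℝ) :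
    sampleRank y t / n ∈ Set.Icc (0 : ℝ) 1 :=
  ⟨div_nonneg (sampleRank_nonneg y t) (Nat.cast_nonneg n),
    div_le_one_of_le₀ (sampleRank_le y t) (Nat.cast_nonneg n)⟩

section GlivenkoCantelli

variable {Ω : Type*} [MeasurableSpace Ω] {P : Measure Ω} [IsProbabilityMeasure P]
  {Y : ℕ → Ω → ℝ} {ν : Measure ℝ} [IsProbabilityMeasure ν]

/-- Two monotone functions that nearly agree at the quantiles of level k/N differ elsewhere by at
most about two grid steps. Quantiles are used only for 0 < k < N, since the levels 0 and 1 may not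
be attained. -/
theorem abs_sub_le_of_grid {F G : ℝ → ℝ} (hF : Monotone F) (hG : Monotone G)
    (hF01 : ∀ t, F t ∈ Set.Icc (0 : ℝ) 1) (hG01 : ∀ t, G t ∈ Set.Icc (0 : ℝ) 1) {N : ℕ} (hN : 0 < N)
    {q : ℕ → ℝ} (hq : ∀ k, 0 < k → k < N → F (q k) = k / N) {ε : ℝ}
    (hG2 : ∀ k, 0 < k → k < N → |G (q k) - k / N| ≤ ε) (hε : 0 ≤ ε) (t : ℝ) :
    |G t - F t| ≤ ε + 2 / N := by
  have hNR : (0 : ℝ) < N := by exact_mod_cast hN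
  obtain ⟨h0, h1⟩ := hF01 t
  have hk1 := Nat.floor_le (show 0 ≤ F t * N by positivity)
  have hk2 := Nat.lt_floor_add_one (F t * N)
  set k := ⌊F t * N⌋₊
  have hk1' : (k : ℝ) / N ≤ F t := by rwa [div_le_iff₀ hNR]
  have hk2' : F t < (k + 1) / N := by rwa [lt_div_iff₀ hNR]
  have hsplit : ((k : ℝ) + 1) / N = k / N + 1 / N := add_div _ _ _
  have h2N : (2 : ℝ) / N = 1 / N + 1 / N := by ring
  have hNpos : 0 < 1 / (N : ℝ) := by positivity
  rw [abs_le]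
  constructor
  -- The index is k - 1 because F(q(k-1)) < F(t) must be strict to give q(k-1) ≤ t: `F` may be flat.
  -- It also keeps the index below `N` when F(t) = 1.
  · by_cases hk : 2 ≤ k
    · have hkN : k - 1 < N := by
        have : (k : ℝ) ≤ N := hk1.trans (by nlinarith)
        have : k ≤ N := by exact_mod_cast this
        omega
      have hcast : ((k - 1 : ℕ) : ℝ) = k - 1 := by push_cast [show 1 ≤ k by omega]; ring
      have e1 := hq (k - 1) (by omega) hkN
      have e2 := (abs_le.1 (hG2 (k - 1) (by omega) hkN)).1
      rw [hcast, sub_div] at e1 e2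
      have : q (k - 1) ≤ t := by
        by_contra! hlt
        have := hF hlt.le
        linarith
      have := hG this
      linarith
    · have : (k : ℝ) ≤ 1 := by exact_mod_cast (by omega : k ≤ 1)
      have h3 : (k : ℝ) / N ≤ 1 / N := by gcongr
      have := (hG01 t).1
      linarith
  · by_cases hk : k + 1 < N
    · have e1 := hq (k + 1) (by omega) hk
      have e2 := (abs_le.1 (hG2 (k + 1) (by omega) hk)).2
      push_cast at e1 e2
      have : t ≤ q (k + 1) := by
        by_contra! hlt
        have := hF hlt.le
        linarith
      have := hG this
      linarith
    · have : (N : ℝ) ≤ k + 1 := by exact_mod_cast not_lt.1 hk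
      have h3 : 1 ≤ ((k : ℝ) + 1) / N := by rwa [le_div_iff₀ hNR, one_mul]
      have := (hG01 t).2
      linarith

/-- The Glivenko–Cantelli theorem for a continuous distribution function. -/
theorem ae_eventually_abs_sampleRank_sub_cdf_le (hY : ∀ i, Measurable (Y i)) (hind : iIndepFun Y P)
    (hlaw : ∀ i, P.map (Y i) = ν) (hc : Continuous (cdf ν)) {ε : ℝ} (hε : 0 < ε) :
    ∀ᵐ ω ∂P, ∀ᶠ n : ℕ in atTop, ∀ t,
      |sampleRank (fun i : Fin n => Y i ω) t / n - cdf ν t| ≤ ε := by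
  obtain ⟨N, hN⟩ := exists_nat_gt (4 / ε)
  have hNR : (0 : ℝ) < N := (by positivity : 0 < 4 / ε).trans hN
  have hN0 : 0 < N := by exact_mod_cast hNR
  have hq : ∀ k : ℕ, ∃ t, 0 < k → k < N → cdf ν t = k / N := by
    intro k
    by_cases hk : 0 < k ∧ k < N
    · have hkR : (0 : ℝ) < k := by exact_mod_cast hk.1
      have hkN : (k : ℝ) < N := by exact_mod_cast hk.2
      obtain ⟨t, ht⟩ := exists_cdf_eq hc (show (0 : ℝ) < k / N by positivity)
        (by rwa [div_lt_one hNR])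
      exact ⟨t, fun _ _ => ht⟩
    · exact ⟨0, fun h1 h2 => (hk ⟨h1, h2⟩).elim⟩
  choose q hq using hq
  have hslln := fun k : ℕ => tendsto_average_of_bounded hY hind hlaw
    (f := (Set.Iic (q k)).indicator fun _ => (1 : ℝ)) (measurable_const.indicator measurableSet_Iic)
    ((integrable_const _).indicator measurableSet_Iic)
  filter_upwards [ae_all_iff.2 hslln] with ω hω
  have h1 : ∀ᶠ n : ℕ in atTop, ∀ k ∈ Finset.range N,
      |sampleRank (fun i : Fin n => Y i ω) (q k) / n - cdf ν (q k)| ≤ ε / 2 := by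
    refine (Filter.eventually_all_finset _).2 fun k _ => ?_
    have h2 := hω k
    rw [integral_indicator_const _ measurableSet_Iic, smul_eq_mul, mul_one, ← cdf_eq_real] at h2
    filter_upwards [Metric.tendsto_nhds.1 h2 (ε / 2) (by positivity)] with n hn
    exact hn.le
  filter_upwards [h1] with n hn t
  have h3 := abs_sub_le_of_grid (F := cdf ν) (G := fun t => sampleRank (fun i : Fin n => Y i ω) t / n)
    (monotone_cdf ν) (fun a b hab => div_le_div_of_nonneg_right (sampleRank_mono _ hab)
      (Nat.cast_nonneg n)) (cdf_mem_Icc ν) (sampleRank_div_mem_Icc _) hN0 hq (ε := ε / 2)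
    (fun k h1 h2 => by rw [← hq k h1 h2]; exact hn k (Finset.mem_range.2 h2)) (by positivity) t
  have h4 : 2 / (N : ℝ) ≤ ε / 2 := by
    rw [div_lt_iff₀ hε] at hN
    rw [div_le_iff₀ hNR]
    linarith
  exact h3.trans (by linarith)

end GlivenkoCantelli

/-! ### Almost sure convergence of the rank variation. -/

theorem ae_tendsto_of_forall_eps {Ω : Type*} [MeasurableSpace Ω] {P : Measure Ω} {u : ℕ → Ω → ℝ}
    {l : ℝ} (hu : ∀ ε > 0, ∀ᵐ ω ∂P, ∀ᶠ n in atTop, |u n ω - l| ≤ ε) :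
    ∀ᵐ ω ∂P, Tendsto (fun n => u n ω) atTop (𝓝 l) := by
  have h1 : ∀ᵐ ω ∂P, ∀ k : ℕ, ∀ᶠ n in atTop, |u n ω - l| ≤ 1 / (k + 1 : ℝ) :=
    ae_all_iff.2 fun k => hu _ (by positivity)
  filter_upwards [h1] with ω hω
  rw [Metric.tendsto_nhds]
  intro ε hε
  obtain ⟨k, hk⟩ := exists_nat_one_div_lt hε
  filter_upwards [hω k] with n hn
  rw [Real.dist_eq]
  exact hn.trans_lt hk

section AlmostSure

variable {Ω : Type*} [MeasurableSpace Ω] {P : Measure Ω} [IsProbabilityMeasure P]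
  {X Y : Ω → ℝ} {Xs Ys : ℕ → Ω → ℝ} {π : (n : ℕ) → Ω → Equiv.Perm (Fin n)} {h : ℝ → ℝ → ℝ} {K B : ℝ}

/-- A Markov kernel into ℝ can be simulated from one uniform variable, so given `X` all remaining
randomness is noise independent of `X`. -/
theorem exists_noise_representation (X : Ω → ℝ) (hY : Measurable Y) :
    ∃ G : ℝ → unitInterval → ℝ, Measurable (Function.uncurry G) ∧
      (∀ x, (volume : Measure unitInterval).map (G x) = condDistrib Y X P x) ∧
      ((P.map X).prod volume).map (fun p => (p.1, G p.1 p.2)) = P.map fun ω => (X ω, Y ω) := by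
  obtain ⟨G, hG, hG2⟩ := (condDistrib Y X P).exists_measurable_map_eq_unitInterval
  refine ⟨G, hG, hG2, ?_⟩
  have hm : Measurable fun p : ℝ × unitInterval => (p.1, G p.1 p.2) := measurable_fst.prodMk hG
  rw [← compProd_map_condDistrib hY.aemeasurable]
  ext s hs
  rw [Measure.map_apply hm hs, Measure.prod_apply (hm hs), Measure.compProd_apply hs]
  refine lintegral_congr fun x => ?_
  have hGx : Measurable (G x) := hG.comp measurable_prodMk_left
  rw [← hG2 x, Measure.map_apply hGx (measurable_prodMk_left hs)]
  rfl

/-- The event that `π n` fails to sort gets the conditional bound `c = 0`, as it is empty for every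
permutation that does sort. -/
theorem IsUniformTieBreaking.ae_sorting (hπ : IsUniformTieBreaking P Xs Ys π)
    (hX : Measurable X) (hY : Measurable Y)
    (hXs : ∀ i, Measurable (Xs i)) (hYs : ∀ i, Measurable (Ys i))
    (h_indep : iIndepFun (fun i ω => (Xs i ω, Ys i ω)) P)
    (h_ident : ∀ i, IdentDistrib (fun ω => (Xs i ω, Ys i ω)) (fun ω => (X ω, Y ω)) P P) :
    ∀ᵐ ω ∂P, ∀ n, π n ω ∈ sortingPerms fun i : Fin n => Xs i ω := by
  obtain ⟨G, hG, -, hlaw⟩ := exists_noise_representation (P := P) X hY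
  have : IsProbabilityMeasure (P.map X) := Measure.isProbabilityMeasure_map hX.aemeasurable
  refine ae_all_iff.2 fun n => ?_
  have h1 := hπ.measure_le hXs hYs h_indep h_ident hG hlaw (n := n) (c := 0)
    (A := fun σ => {s | σ ∈ sortingPerms fun i => (s i).1}ᶜ)
    (fun σ => ((measurableSet_sorting σ).preimage
      (f := fun (s : Fin n → ℝ × ℝ) i => (s i).1) (by fun_prop)).compl)
    (fun x σ hσ => by simp [hσ])
  exact nonpos_iff_eq_zero.1 h1

theorem limitVariation_eq {G : ℝ → unitInterval → ℝ} (hG : Measurable (Function.uncurry G))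
    (hG2 : ∀ x, (volume : Measure unitInterval).map (G x) = condDistrib Y X P x)
    (hh : BoundedLipschitz h K B) :
    limitVariation P h X Y
      = ∫ x, mixedKernel volume (fun x v => cdf (P.map Y) (G x v)) h x x ∂(P.map X) := by
  unfold limitVariation
  refine integral_congr_ae (ae_of_all _ fun x => ?_)
  simp only
  have hGx : Measurable (G x) := hG.comp measurable_prodMk_left
  have hF := measurable_cdf (P.map Y)
  rw [← hG2 x]
  have hm : Measurable (Function.uncurry fun z y => h (cdf (P.map Y) y) (cdf (P.map Y) z)) :=
    hh.measurable.comp ((hF.comp measurable_snd).prodMk (hF.comp measurable_fst))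
  rw [integral_map hGx.aemeasurable]
  · have h1 : ∀ z, ∫ y, h (cdf (P.map Y) y) (cdf (P.map Y) (G x z)) ∂(volume.map (G x))
        = ∫ a, h (cdf (P.map Y) (G x a)) (cdf (P.map Y) (G x z)) := fun z => by
      rw [integral_map hGx.aemeasurable]
      exact (hm.comp measurable_prodMk_left).aestronglyMeasurable
    simp_rw [h1]
    rw [mixedKernel, integral_integral_swap]
    refine Integrable.of_bound (C := B) ?_ (ae_of_all _ fun p => hh.bdd _ _)
    exact (hh.measurable.comp ((hF.comp (hGx.comp measurable_snd)).prodMk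
      (hF.comp (hGx.comp measurable_fst)))).aestronglyMeasurable
  · have := Measure.isProbabilityMeasure_map (μ := (volume : Measure unitInterval)) hGx.aemeasurable
    exact hm.stronglyMeasurable.integral_prod_right.aestronglyMeasurable

/-- Almost sure convergence of the rank-based variation statistic. -/
theorem ae_tendsto_rankVariation (hh : BoundedLipschitz h K B)
    (hX : Measurable X) (hY : Measurable Y) (hY_cont : Continuous (cdf (P.map Y)))
    (hXs : ∀ i, Measurable (Xs i)) (hYs : ∀ i, Measurable (Ys i))
    (h_indep : iIndepFun (fun i ω => (Xs i ω, Ys i ω)) P)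
    (h_ident : ∀ i, IdentDistrib (fun ω => (Xs i ω, Ys i ω)) (fun ω => (X ω, Y ω)) P P)
    (hπ : IsUniformTieBreaking P Xs Ys π) :
    ∀ᵐ ω ∂P, Tendsto (fun n : ℕ => rankVariation h (fun i : Fin n => Ys i ω) (π n ω)) atTop
      (𝓝 (limitVariation P h X Y)) := by
  obtain ⟨G, hG, hG2, hlaw⟩ := exists_noise_representation (P := P) X hY
  have : IsProbabilityMeasure (P.map X) := Measure.isProbabilityMeasure_map hX.aemeasurable
  have : IsProbabilityMeasure (P.map Y) := Measure.isProbabilityMeasure_map hY.aemeasurable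
  have hlim := limitVariation_eq hG hG2 hh
  have hF := measurable_cdf (P.map Y)
  set F := cdf (P.map Y)
  set φ : ℝ → unitInterval → ℝ := fun x v => F (G x v) with hφdef
  have hφ : Measurable (Function.uncurry φ) := hF.comp hG
  have hφ01 : ∀ x v, φ x v ∈ Set.Icc (0 : ℝ) 1 := fun x v => cdf_mem_Icc _ _
  have hK := hh.nonneg_left
  have hB := hh.nonneg_right
  have hindX : iIndepFun Xs P := h_indep.comp (fun _ => Prod.fst) (fun _ => measurable_fst)
  have hindY : iIndepFun Ys P := h_indep.comp (fun _ => Prod.snd) (fun _ => measurable_snd)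
  have hlawX : ∀ i, P.map (Xs i) = P.map X := fun i =>
    ((h_ident i).comp (u := Prod.fst) measurable_fst).map_eq
  have hlawY : ∀ i, P.map (Ys i) = P.map Y := fun i =>
    ((h_ident i).comp (u := Prod.snd) measurable_snd).map_eq
  have hHm := measurable_mixedKernel (lam := (volume : Measure unitInterval)) hφ hh
  set H := mixedKernel (volume : Measure unitInterval) φ h
  have hHB : ∀ x x', |H x x'| ≤ B := abs_mixedKernel_le hh
  refine ae_tendsto_of_forall_eps fun ε hε => ?_
  -- The three errors are 2Kη from the ranks (two arguments of `h`), `η` from concentration and `η`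
  -- from the mixed kernel.
  let η := ε / (2 * K + 3)
  have hη : 0 < η := by positivity
  -- the conditional concentration
  let A : (n : ℕ) → Equiv.Perm (Fin n) → Set (Fin n → ℝ × ℝ) := fun n σ =>
    {s | η * n ≤ |∑ i : Fin (n - 1), (h (F (s (σ ⟨i, by omega⟩)).2) (F (s (σ ⟨i + 1, by omega⟩)).2)
      - H (s (σ ⟨i, by omega⟩)).1 (s (σ ⟨i + 1, by omega⟩)).1)|}
  have hA : ∀ n σ, MeasurableSet (A n σ) := by
    intro n σ
    refine measurableSet_le measurable_const (Finset.measurable_sum _ fun i _ => ?_).abs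
    refine Measurable.sub ?_ ?_
    · exact hh.measurable.comp ((hF.comp (by fun_prop)).prodMk (hF.comp (by fun_prop)))
    · exact hHm.comp (g := fun p : ℝ × ℝ => H p.1 p.2)
        (f := fun s : Fin n → ℝ × ℝ => ((s (σ ⟨i, by omega⟩)).1, (s (σ ⟨i + 1, by omega⟩)).1))
        (by fun_prop)
  have hbad : ∀ n, P {ω | sampleVec Xs Ys n ω ∈ A n (π n ω)}
      ≤ ENNReal.ofReal (4 * Real.exp (-(η ^ 2 / (8 * (2 * B + 1) ^ 2)) * n)) := by
    intro n
    refine hπ.measure_le hXs hYs h_indep h_ident hG hlaw (hA n) fun x σ _ => ?_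
    rw [← ofReal_measureReal]
    refine ENNReal.ofReal_le_ofReal ?_
    -- For frozen `x` the centred terms are bounded by 2B; the extra 1 keeps the bound positive even
    -- if B = 0.
    have h1 := measure_abs_adjacent_sum_ge_le (lam := (volume : Measure unitInterval)) (n := n)
      (B := 2 * B + 1) (ε := η) (D := fun i a b => h (φ (x (σ ⟨i, by omega⟩)) a)
        (φ (x (σ ⟨i + 1, by omega⟩)) b) - H (x (σ ⟨i, by omega⟩)) (x (σ ⟨i + 1, by omega⟩)))
      σ (by positivity) hη ?_ ?_ ?_
    · refine le_trans (le_of_eq rfl) (h1.trans_eq ?_)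
      congr 2
      ring
    · intro i
      refine Measurable.sub_const ?_ _
      exact hh.measurable.comp (((hφ.comp measurable_prodMk_left).comp measurable_fst).prodMk
        ((hφ.comp measurable_prodMk_left).comp measurable_snd))
    · intro i a b
      refine (abs_sub _ _).trans ?_
      linarith [hh.bdd (φ (x (σ ⟨i, by omega⟩)) a) (φ (x (σ ⟨i + 1, by omega⟩)) b),
        hHB (x (σ ⟨i, by omega⟩)) (x (σ ⟨i + 1, by omega⟩))]
    · intro i
      have h2 : ∀ a, Integrable (fun b => h (φ (x (σ ⟨i, by omega⟩)) a)
          (φ (x (σ ⟨i + 1, by omega⟩)) b)) (volume : Measure unitInterval) := fun a =>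
        Integrable.of_bound ((hh.measurable.comp measurable_prodMk_left).comp
          (hφ.comp measurable_prodMk_left)).aestronglyMeasurable B (ae_of_all _ fun b => hh.bdd _ _)
      refine (integral_congr_ae (ae_of_all _ fun a =>
        integral_sub (h2 a) (integrable_const _))).trans ?_
      rw [integral_sub (integrable_inner hφ hh _ _) (by fun_prop)]
      simp only [integral_const, probReal_univ, smul_eq_mul, one_mul]
      exact sub_self _
  -- Summability suffices for Borel–Cantelli, so only the law of each single `π n` with the sample
  -- matters.
  have hsum : ∑' n, P {ω | sampleVec Xs Ys n ω ∈ A n (π n ω)} ≠ ⊤ := by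
    refine ne_top_of_le_ne_top ?_ (ENNReal.tsum_le_tsum hbad)
    exact ((summable_exp_neg_mul_nat (by positivity)).mul_left 4).tsum_ofReal_ne_top
  filter_upwards [ae_eventually_notMem hsum,
    hπ.ae_sorting hX hY hXs hYs h_indep h_ident,
    ae_eventually_mixedKernel_sum (lam := (volume : Measure unitInterval)) hφ hφ01 hh hXs hindX
      hlawX hη,
    ae_eventually_abs_sampleRank_sub_cdf_le hYs hindY hlawY hY_cont hη] with ω h1 h2 h3 h4
  filter_upwards [h1, h3, h4, eventually_gt_atTop 0] with n h1 h3 h4 hn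
  have hnR : (0 : ℝ) < n := by exact_mod_cast hn
  specialize h3 _ (h2 n)
  rw [hlim]
  set I := ∫ x, H x x ∂(P.map X)
  set σ := π n ω
  have h5 : |∑ i : Fin (n - 1), (h (F (Ys (σ ⟨i, by omega⟩) ω)) (F (Ys (σ ⟨i + 1, by omega⟩) ω))
      - H (Xs (σ ⟨i, by omega⟩) ω) (Xs (σ ⟨i + 1, by omega⟩) ω))| < η * n := not_le.1 h1
  rw [Finset.sum_sub_distrib] at h5
  set R := sampleRank fun i : Fin n => Ys i ω
  have h6 : |∑ i : Fin (n - 1), h (R (Ys (σ ⟨i, by omega⟩) ω) / n)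
        (R (Ys (σ ⟨i + 1, by omega⟩) ω) / n)
      - ∑ i : Fin (n - 1), h (F (Ys (σ ⟨i, by omega⟩) ω)) (F (Ys (σ ⟨i + 1, by omega⟩) ω))|
      ≤ 2 * K * η * n := by
    rw [← Finset.sum_sub_distrib]
    refine (Finset.abs_sum_le_sum_abs _ _).trans ?_
    have h7 : ∀ i : Fin (n - 1), |h (R (Ys (σ ⟨i, by omega⟩) ω) / n)
        (R (Ys (σ ⟨i + 1, by omega⟩) ω) / n) - h (F (Ys (σ ⟨i, by omega⟩) ω))
          (F (Ys (σ ⟨i + 1, by omega⟩) ω))| ≤ 2 * K * η := fun i => by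
      refine (hh.lip _ _ _ _).trans ?_
      have h8 := h4 (Ys (σ ⟨i, by omega⟩) ω)
      have h9 := h4 (Ys (σ ⟨i + 1, by omega⟩) ω)
      have := mul_le_mul_of_nonneg_left (add_le_add h8 h9) hK
      linarith
    refine (Finset.sum_le_sum fun i _ => h7 i).trans ?_
    rw [Finset.sum_const, Finset.card_univ, Fintype.card_fin, nsmul_eq_mul, mul_comm]
    gcongr
    omega
  have h7 : rankVariation h (fun i : Fin n => Ys i ω) σ
      = (∑ i : Fin (n - 1), h (R (Ys (σ ⟨i, by omega⟩) ω) / n)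
        (R (Ys (σ ⟨i + 1, by omega⟩) ω) / n)) / n := by
    rw [rankVariation, one_div, inv_mul_eq_div]
  have h8 : ∀ a : ℝ, a / n - I = (a - n * I) / n := fun a => by field_simp
  rw [h7, h8, abs_div, abs_of_pos hnR, div_le_iff₀ hnR]
  have h9 : ε * n = (2 * K + 3) * (η * n) := by simp only [η]; field_simp
  have h10 : 0 < η * n := by positivity
  have a3 := abs_le.1 h3; have a5 := abs_lt.1 h5; have a6 := abs_le.1 h6
  rw [abs_le, h9]
  constructor <;> nlinarith [a3.1, a3.2, a5.1, a5.2, a6.1, a6.2]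

end AlmostSure

/-! ### Comparison of characteristic functions. -/

section CharFun

variable {Ω : Type*} [MeasurableSpace Ω] {P : Measure Ω} [IsProbabilityMeasure P]

theorem integral_abs_le_sqrt_integral_sq {W : Ω → ℝ} (hW : MemLp W 2 P) :
    ∫ ω, |W ω| ∂P ≤ √(∫ ω, W ω ^ 2 ∂P) := by
  refine Real.le_sqrt_of_sq_le ?_
  -- The Cauchy–Schwarz bound is read off from the non-negative variance of |W|.
  have h1 := variance_eq_sub (hW.norm)
  have h2 := variance_nonneg (fun ω => ‖W ω‖) P
  rw [h1] at h2
  have h3 : P[(fun ω => ‖W ω‖) ^ 2] = ∫ ω, W ω ^ 2 ∂P := by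
    refine integral_congr_ae (ae_of_all _ fun ω => ?_)
    simp
  rw [h3] at h2
  simpa using h2

/-- Since |e^{ia} - e^{ib}| ≤ |a - b|, closeness in mean square transfers to characteristic
functions. Every approximation in the central limit theorem goes through this bound. -/
theorem norm_charFun_sub_le {U V : Ω → ℝ} (hU : Measurable U) (hV : Measurable V)
    (hUV : MemLp (fun ω => U ω - V ω) 2 P) (t : ℝ) :
    ‖charFun (P.map U) t - charFun (P.map V) t‖ ≤ |t| * √(∫ ω, (U ω - V ω) ^ 2 ∂P) := by
  have hcf : ∀ W : Ω → ℝ, Measurable W →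
      charFun (P.map W) t = ∫ ω, Complex.exp (t * W ω * Complex.I) ∂P := by
    intro W hW
    rw [charFun_apply_real, integral_map hW.aemeasurable]
    fun_prop
  have hi : ∀ W : Ω → ℝ, Measurable W →
      Integrable (fun ω => Complex.exp (t * W ω * Complex.I)) P := by
    intro W hW
    refine Integrable.of_bound (C := 1) (by fun_prop) (ae_of_all _ fun ω => ?_)
    rw [← Complex.ofReal_mul, Complex.norm_exp_ofReal_mul_I]
  rw [hcf U hU, hcf V hV, ← integral_sub (hi U hU) (hi V hV)]
  refine (norm_integral_le_integral_norm _).trans ?_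
  calc _ ≤ ∫ ω, |t| * |U ω - V ω| ∂P := by
        refine integral_mono_of_nonneg (ae_of_all _ fun ω => norm_nonneg _)
          ((hUV.integrable (by norm_num)).abs.const_mul _) (ae_of_all _ fun ω => ?_)
        have h1 : Complex.exp (t * U ω * Complex.I) - Complex.exp (t * V ω * Complex.I)
            = Complex.exp ((t * V ω : ℝ) * Complex.I)
              * (Complex.exp (Complex.I * (t * (U ω - V ω) : ℝ)) - 1) := by
          rw [mul_sub, mul_one, ← Complex.exp_add]
          push_cast
          congr 2
          ring
        simp only
        rw [h1, norm_mul, Complex.norm_exp_ofReal_mul_I, one_mul, ← abs_mul]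
        exact Real.norm_exp_I_mul_ofReal_sub_one_le
    _ = |t| * ∫ ω, |U ω - V ω| ∂P := integral_const_mul _ _
    _ ≤ _ := mul_le_mul_of_nonneg_left (integral_abs_le_sqrt_integral_sq hUV) (abs_nonneg t)

theorem tendstoInDistribution_gaussian_of_charFun {Z : ℕ → Ω → ℝ} (hZ : ∀ n, Measurable (Z n))
    {v : ℝ} (hv : 0 ≤ v)
    (h : ∀ t : ℝ, Tendsto (fun n => charFun (P.map (Z n)) t) atTop
      (𝓝 (Complex.exp (-(v * t ^ 2 / 2 : ℝ))))) :
    TendstoInDistribution Z atTop (id : ℝ → ℝ) (fun _ => P) (gaussianReal 0 v.toNNReal) where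
  forall_aemeasurable n := (hZ n).aemeasurable
  aemeasurable_limit := aemeasurable_id
  tendsto := by
    refine ProbabilityMeasure.tendsto_iff_tendsto_charFun.2 fun t => ?_
    simp only [ProbabilityMeasure.coe_mk, Measure.map_id, charFun_gaussianReal]
    convert h t using 2
    congr 1
    rw [Real.coe_toNNReal _ hv]
    push_cast
    ring

end CharFun

/-! ### Orthogonality of the terms of a degenerate neighbour sum. -/

section DegenerateSums

variable {Ω : Type*} [MeasurableSpace Ω] {P : Measure Ω} [IsProbabilityMeasure P]
  {Y : ℕ → Ω → ℝ} {ν : Measure ℝ} {k : ℝ → ℝ → ℝ} {B : ℝ}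

/-- A bounded kernel whose first-order projections vanish. -/
structure DegenerateKernel (ν : Measure ℝ) (k : ℝ → ℝ → ℝ) (B : ℝ) : Prop where
  measurable : Measurable (Function.uncurry k)
  bdd : ∀ a b, |k a b| ≤ B
  left : ∀ b, ∫ a, k a b ∂ν = 0
  right : ∀ a, ∫ b, k a b ∂ν = 0

theorem map_initial_segment (hY : ∀ i, Measurable (Y i)) (hind : iIndepFun Y P)
    (hlaw : ∀ i, P.map (Y i) = ν) (n : ℕ) :
    P.map (fun ω (i : Fin n) => Y i ω) = Measure.pi fun _ : Fin n => ν := by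
  have h := hind.precomp (g := fun i : Fin n => (i : ℕ)) Fin.val_injective
  have h2 := (iIndepFun_iff_map_fun_eq_pi_map (f := fun (i : Fin n) ω => Y i ω)
    (fun i => (hY i).aemeasurable)).1 h
  simpa only [hlaw] using h2

namespace DegenerateKernel

theorem nonneg (hk : DegenerateKernel ν k B) : 0 ≤ B := (abs_nonneg _).trans (hk.bdd 0 0)

theorem measurable_comp (hk : DegenerateKernel ν k B) {E : Type*} [MeasurableSpace E] {f g : E → ℝ}
    (hf : Measurable f) (hg : Measurable g) : Measurable fun x => k (f x) (g x) :=
  hk.measurable.comp (hf.prodMk hg)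

variable [IsProbabilityMeasure ν]

/-- The variable of index j + 1 occurs in the last factor only, and integrating it out gives zero.
-/
theorem integral_adjacent_mul_of_lt (hk : DegenerateKernel ν k B) (hY : ∀ i, Measurable (Y i))
    (hind : iIndepFun Y P) (hlaw : ∀ i, P.map (Y i) = ν) {i j : ℕ} (hij : i < j) :
    ∫ ω, k (Y i ω) (Y (i + 1) ω) * k (Y j ω) (Y (j + 1) ω) ∂P = 0 := by
  let i0 : Fin (j + 2) := ⟨i, by omega⟩
  let i1 : Fin (j + 2) := ⟨i + 1, by omega⟩
  let j0 : Fin (j + 2) := ⟨j, by omega⟩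
  let j1 : Fin (j + 2) := ⟨j + 1, by omega⟩
  have hm : Measurable fun y : Fin (j + 2) → ℝ => k (y i0) (y i1) * k (y j0) (y j1) :=
    (hk.measurable_comp (by fun_prop) (by fun_prop)).mul
      (hk.measurable_comp (by fun_prop) (by fun_prop))
  have h1 : ∫ y, k (y i0) (y i1) * k (y j0) (y j1) ∂(Measure.pi fun _ : Fin (j + 2) => ν) = 0 := by
    refine integral_pi_eq_zero_of_update ν j1 hm (B := B * B) (fun y => ?_) fun y => ?_
    · rw [abs_mul]
      exact mul_le_mul (hk.bdd _ _) (hk.bdd _ _) (abs_nonneg _) hk.nonneg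
    · have e0 : i0 ≠ j1 := by simp [i0, j1]; omega
      have e1 : i1 ≠ j1 := by simp [i1, j1]; omega
      have e2 : j0 ≠ j1 := by simp [j0, j1]
      simp only [Function.update_of_ne e0, Function.update_of_ne e1, Function.update_of_ne e2,
        Function.update_self]
      rw [integral_const_mul, hk.right, mul_zero]
  rw [← map_initial_segment hY hind hlaw, integral_map] at h1
  · exact h1
  · exact (measurable_pi_lambda _ fun i => hY _).aemeasurable
  · exact hm.aestronglyMeasurable

theorem integral_adjacent_sq (hk : DegenerateKernel ν k B) (hY : ∀ i, Measurable (Y i))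
    (hind : iIndepFun Y P) (hlaw : ∀ i, P.map (Y i) = ν) (i : ℕ) :
    ∫ ω, k (Y i ω) (Y (i + 1) ω) ^ 2 ∂P = ∫ a, ∫ b, k a b ^ 2 ∂ν ∂ν := by
  have hne : (⟨i, by omega⟩ : Fin (i + 2)) ≠ ⟨i + 1, by omega⟩ := by simp
  have hm : Measurable (Function.uncurry fun a b => k a b ^ 2) := hk.measurable.pow_const 2
  rw [← integral_pi_pair ν hne hm (B := B ^ 2) (fun a b => by
    rw [abs_pow]; exact pow_le_pow_left₀ (abs_nonneg _) (hk.bdd a b) 2),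
    ← map_initial_segment hY hind hlaw, integral_map]
  · exact (measurable_pi_lambda _ fun i => hY _).aemeasurable
  · exact ((hk.measurable_comp (measurable_pi_apply _)
      (measurable_pi_apply _)).pow_const 2).aestronglyMeasurable

/-- Orthogonality leaves only the squares. The weights `c` serve to select the pairs inside blocks,
or the complementary pairs. -/
theorem integral_sum_sq (hk : DegenerateKernel ν k B) (hY : ∀ i, Measurable (Y i))
    (hind : iIndepFun Y P) (hlaw : ∀ i, P.map (Y i) = ν) (c : ℕ → ℝ) (N : ℕ) :
    ∫ ω, (∑ i ∈ Finset.range N, c i * k (Y i ω) (Y (i + 1) ω)) ^ 2 ∂P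
      = (∫ a, ∫ b, k a b ^ 2 ∂ν ∂ν) * ∑ i ∈ Finset.range N, c i ^ 2 := by
  have hi : ∀ i j : ℕ, Integrable (fun ω => (c i * k (Y i ω) (Y (i + 1) ω))
      * (c j * k (Y j ω) (Y (j + 1) ω))) P := by
    intro i j
    refine Integrable.of_bound (C := |c i| * B * (|c j| * B)) ?_ (ae_of_all _ fun ω => ?_)
    · exact (((hk.measurable_comp (hY _) (hY _)).const_mul _).mul
        ((hk.measurable_comp (hY _) (hY _)).const_mul _)).aestronglyMeasurable
    · rw [norm_mul, Real.norm_eq_abs, Real.norm_eq_abs, abs_mul, abs_mul]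
      have := hk.nonneg
      have h1 := hk.bdd (Y i ω) (Y (i + 1) ω)
      have h2 := hk.bdd (Y j ω) (Y (j + 1) ω)
      gcongr
  have h1 : ∀ i j : ℕ, ∫ ω, (c i * k (Y i ω) (Y (i + 1) ω))
      * (c j * k (Y j ω) (Y (j + 1) ω)) ∂P
        = if i = j then (∫ a, ∫ b, k a b ^ 2 ∂ν ∂ν) * c i ^ 2 else 0 := by
    intro i j
    split_ifs with hij
    · subst hij
      rw [← hk.integral_adjacent_sq hY hind hlaw i, mul_comm, ← integral_const_mul]
      refine integral_congr_ae (ae_of_all _ fun ω => ?_)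
      simp only
      ring
    · have h2 : ∀ ω, (c i * k (Y i ω) (Y (i + 1) ω)) * (c j * k (Y j ω) (Y (j + 1) ω))
          = (c i * c j) * (k (Y i ω) (Y (i + 1) ω) * k (Y j ω) (Y (j + 1) ω)) := fun ω => by ring
      simp_rw [h2]
      rw [integral_const_mul]
      rcases lt_or_gt_of_ne hij with h | h
      · rw [hk.integral_adjacent_mul_of_lt hY hind hlaw h, mul_zero]
      · simp_rw [mul_comm (k (Y i _) _)]
        rw [hk.integral_adjacent_mul_of_lt hY hind hlaw h, mul_zero]
  simp_rw [sq (∑ i ∈ Finset.range N, _), Finset.sum_mul_sum]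
  rw [integral_finsetSum _ fun i _ => integrable_finsetSum _ fun j _ => hi i j]
  simp_rw [integral_finsetSum _ fun j _ => hi _ j, h1, Finset.mul_sum]
  refine Finset.sum_congr rfl fun i hi => ?_
  rw [Finset.sum_ite_eq, if_pos hi]

end DegenerateKernel

end DegenerateSums

/-! ### Blocking and the central limit theorem for degenerate sums. -/

theorem sum_range_mul_eq_sum_blocks (g : ℕ → ℝ) (m N : ℕ) :
    ∑ i ∈ Finset.range (N * m), g i
      = ∑ l ∈ Finset.range N, ∑ r ∈ Finset.range m, g (l * m + r) := by
  induction N with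
  | zero => simp
  | succ N ih => rw [Finset.sum_range_succ, ← ih, Nat.succ_mul, Finset.sum_range_add]

namespace DegenerateKernel

variable {Ω : Type*} [MeasurableSpace Ω] {P : Measure Ω} [IsProbabilityMeasure P]
  {Y : ℕ → Ω → ℝ} {ν : Measure ℝ} {k : ℝ → ℝ → ℝ} {B : ℝ}

/-- The indicator of the indices `i` such that `i` and `i + 1` lie in a common block of length `m`,
among the first `N` blocks. -/
noncomputable def blockWeight (m N i : ℕ) : ℝ := if i < N * m ∧ i % m ≠ m - 1 then 1 else 0

theorem blockWeight_sq (m N i : ℕ) : blockWeight m N i ^ 2 = blockWeight m N i := by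
  unfold blockWeight; split_ifs <;> simp

/-- The hypothesis allows the range to stop one short of N * m: the last index ends a block, so its
weight is zero. With M = n - 1 this is exactly the number of neighbour pairs. -/
theorem sum_blockWeight_mul {m : ℕ} (hm : 0 < m) {N M : ℕ} (hN : N * m ≤ M + 1) (g : ℕ → ℝ) :
    ∑ i ∈ Finset.range M, blockWeight m N i * g i
      = ∑ l ∈ Finset.range N, ∑ r ∈ Finset.range (m - 1), g (l * m + r) := by
  have h1 : ∑ i ∈ Finset.range M, blockWeight m N i * g i
      = ∑ i ∈ Finset.range (N * m), blockWeight m N i * g i := by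
    have h2 : ∀ i, (M ≤ i ∨ N * m ≤ i) → blockWeight m N i = 0 := by
      intro i hi
      rw [blockWeight, if_neg]
      rintro ⟨h3, h4⟩
      have h5 : i + 1 = N * m := by omega
      apply h4
      have h6 : i = (N - 1) * m + (m - 1) := by
        have : N = N - 1 + 1 := by
          rcases N with _ | N
          · simp at h5
          · simp
        rw [this, Nat.succ_mul] at h5
        omega
      rw [h6, Nat.mul_add_mod_of_lt (by omega)]
    rcases le_total M (N * m) with h | h
    · refine Finset.sum_subset (Finset.range_mono h) fun i _ hi => ?_
      rw [h2 i (Or.inl (by simpa using hi)), zero_mul]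
    · refine (Finset.sum_subset (Finset.range_mono h) fun i _ hi => ?_).symm
      rw [h2 i (Or.inr (by simpa using hi)), zero_mul]
  rw [h1, sum_range_mul_eq_sum_blocks]
  refine Finset.sum_congr rfl fun l hl => ?_
  obtain ⟨m, rfl⟩ : ∃ m', m = m' + 1 := ⟨m - 1, by omega⟩
  have hl' := Finset.mem_range.1 hl
  have h3 : ∀ r < m + 1, l * (m + 1) + r < N * (m + 1) := by
    intro r hr
    have : (l + 1) * (m + 1) ≤ N * (m + 1) := Nat.mul_le_mul_right _ hl'
    rw [Nat.succ_mul] at this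
    omega
  have h4 : ∀ r < m + 1, (l * (m + 1) + r) % (m + 1) = r := fun r hr => by
    rw [Nat.mul_add_mod_of_lt hr]
  rw [Finset.sum_range_succ]
  have h5 : blockWeight (m + 1) N (l * (m + 1) + m) = 0 := by
    rw [blockWeight, if_neg]
    rw [h4 m (by omega)]
    simp
  rw [h5, zero_mul, add_zero]
  refine Finset.sum_congr rfl fun r hr => ?_
  have hr' : r < m := Finset.mem_range.1 hr
  rw [blockWeight, if_pos, one_mul]
  refine ⟨h3 r (by omega), ?_⟩
  rw [h4 r (by omega)]
  simp; omega

theorem sum_blockWeight {m : ℕ} (hm : 0 < m) {N M : ℕ} (hN : N * m ≤ M + 1) :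
    ∑ i ∈ Finset.range M, blockWeight m N i = N * (m - 1) := by
  have := sum_blockWeight_mul hm hN fun _ => 1
  simp only [mul_one] at this
  rw [this]
  simp [Nat.cast_sub hm, mul_sub]

/-- The sum of the kernel over the pairs of neighbours in the `l`-th block of length `m`. -/
noncomputable def blockSum (k : ℝ → ℝ → ℝ) (Y : ℕ → Ω → ℝ) (m l : ℕ) (ω : Ω) : ℝ :=
  ∑ r ∈ Finset.range (m - 1), k (Y (l * m + r) ω) (Y (l * m + r + 1) ω)

theorem measurable_blockSum (hk : DegenerateKernel ν k B) (hY : ∀ i, Measurable (Y i)) (m l : ℕ) :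
    Measurable (blockSum k Y m l) :=
  Finset.measurable_sum _ fun _ _ => hk.measurable_comp (hY _) (hY _)

variable [IsProbabilityMeasure ν]

theorem integral_blockSum_sum_sq (hk : DegenerateKernel ν k B) (hY : ∀ i, Measurable (Y i))
    (hind : iIndepFun Y P) (hlaw : ∀ i, P.map (Y i) = ν) {m : ℕ} (hm : 0 < m) (N : ℕ) :
    ∫ ω, (∑ l ∈ Finset.range N, blockSum k Y m l ω) ^ 2 ∂P
      = (∫ a, ∫ b, k a b ^ 2 ∂ν ∂ν) * (N * (m - 1)) := by
  have h1 := hk.integral_sum_sq hY hind hlaw (blockWeight m N) (N * m)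
  simp_rw [blockWeight_sq, sum_blockWeight hm (Nat.le_succ (N * m))] at h1
  rw [← h1]
  refine integral_congr_ae (ae_of_all _ fun ω => ?_)
  simp only
  rw [sum_blockWeight_mul hm (Nat.le_succ (N * m)) fun i => k (Y i ω) (Y (i + 1) ω)]
  rfl

/-- Omitting the pair that straddles two consecutive blocks makes the block sums functions of
disjoint sets of variables, so they are i.i.d. and the classical theorem applies. -/
theorem tendsto_charFun_blockSum (hk : DegenerateKernel ν k B) (hY : ∀ i, Measurable (Y i))
    (hind : iIndepFun Y P) (hlaw : ∀ i, P.map (Y i) = ν) {m : ℕ} (hm : 0 < m) (t : ℝ) :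
    Tendsto (fun N : ℕ => charFun (P.map fun ω =>
        (√(N : ℝ))⁻¹ * ∑ l ∈ Finset.range N, blockSum k Y m l ω) t) atTop
      (𝓝 (Complex.exp (-((∫ a, ∫ b, k a b ^ 2 ∂ν ∂ν) * (m - 1) * t ^ 2 / 2 : ℝ)))) := by
  let g : ℕ × Fin m → ℕ := fun p => p.1 * m + p.2
  have hg : Function.Injective g := by
    rintro ⟨l, r⟩ ⟨l', r'⟩ h
    simp only [g] at h
    have h1 : l = l' := by
      have h0 := congrArg (· / m) h
      simpa only [Nat.mul_comm _ m, Nat.mul_add_div hm, Nat.div_eq_of_lt r.2,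
        Nat.div_eq_of_lt r'.2, add_zero] using h0
    subst h1
    have h2 : r = r' := Fin.ext (by omega)
    rw [h2]
  have hind2 := iIndepFun_blocks (f := fun p ω => Y (g p) ω) (fun p => hY (g p)) (hind.precomp hg)
  let S : (Fin m → ℝ) → ℝ := fun y => ∑ r : Fin (m - 1), k (y ⟨r, by omega⟩) (y ⟨r + 1, by omega⟩)
  have hS : Measurable S := Finset.measurable_sum _ fun r _ =>
    hk.measurable_comp (measurable_pi_apply _) (measurable_pi_apply _)
  have hbs : ∀ l, blockSum k Y m l = fun ω => S fun r => Y (g (l, r)) ω := by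
    intro l
    ext ω
    simp only [blockSum, S, g, Finset.sum_range]
    rfl
  have hindZ : iIndepFun (blockSum k Y m) P := by
    have := hind2.comp (fun _ => S) fun _ => hS
    convert this using 1
    ext l ω
    rw [hbs l]
    rfl
  have hident : ∀ l, IdentDistrib (blockSum k Y m l) (blockSum k Y m 0) P P := by
    have hmap : ∀ l, P.map (fun ω (r : Fin m) => Y (g (l, r)) ω)
        = Measure.pi fun _ : Fin m => ν := by
      intro l
      have h := hind.precomp (g := fun r : Fin m => g (l, r))
        fun a b hab => by simpa using hg hab
      have h2 := (iIndepFun_iff_map_fun_eq_pi_map (f := fun (r : Fin m) ω => Y (g (l, r)) ω)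
        (fun i => (hY _).aemeasurable)).1 h
      simpa only [hlaw] using h2
    have hmm : ∀ l, Measurable (fun ω (r : Fin m) => Y (g (l, r)) ω) := fun l =>
      measurable_pi_lambda _ fun r => hY _
    intro l
    have h3 : IdentDistrib (fun ω (r : Fin m) => Y (g (l, r)) ω)
        (fun ω (r : Fin m) => Y (g (0, r)) ω) P P :=
      ⟨(hmm l).aemeasurable, (hmm 0).aemeasurable, by rw [hmap, hmap]⟩
    rw [hbs l, hbs 0]
    exact h3.comp hS
  have hbdd : ∀ ω, ‖blockSum k Y m 0 ω‖ ≤ (m - 1 : ℕ) * B := by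
    intro ω
    refine (norm_sum_le_of_le _ fun r _ => hk.bdd _ _).trans_eq ?_
    simp
  have hL2 : MemLp (blockSum k Y m 0) 2 P :=
    MemLp.of_bound (hk.measurable_blockSum hY m 0).aestronglyMeasurable _ (ae_of_all _ hbdd)
  have hmean : P[blockSum k Y m 0] = 0 := by
    have h1 : ∀ r : ℕ, ∫ ω, k (Y (0 * m + r) ω) (Y (0 * m + r + 1) ω) ∂P = 0 := by
      intro r
      have hne : (⟨0 * m + r, by omega⟩ : Fin (0 * m + r + 2)) ≠ ⟨0 * m + r + 1, by omega⟩ := by simp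
      have h2 := integral_pi_pair ν hne hk.measurable hk.bdd
      simp only [hk.right, integral_zero] at h2
      rw [← map_initial_segment hY hind hlaw, integral_map] at h2
      · exact h2
      · exact (measurable_pi_lambda _ fun i => hY _).aemeasurable
      · exact (hk.measurable_comp (measurable_pi_apply _)
          (measurable_pi_apply _)).aestronglyMeasurable
    unfold blockSum
    rw [integral_finsetSum]
    · simp only [h1, Finset.sum_const_zero]
    · intro r _
      exact Integrable.of_bound (hk.measurable_comp (hY _) (hY _)).aestronglyMeasurable B
        (ae_of_all _ fun ω => hk.bdd _ _)
  have hvar : Var[blockSum k Y m 0; P] = (∫ a, ∫ b, k a b ^ 2 ∂ν ∂ν) * (m - 1) := by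
    rw [variance_eq_integral (hk.measurable_blockSum hY m 0).aemeasurable, hmean]
    have := hk.integral_blockSum_sum_sq hY hind hlaw hm 1
    simpa using this
  have hclt := tendstoInDistribution_inv_sqrt_mul_sum_sub (P := P) (X := blockSum k Y m)
    (Y := (id : ℝ → ℝ)) (P' := gaussianReal 0 Var[blockSum k Y m 0; P].toNNReal)
    HasLaw.id hL2 hindZ hident
  have h4 := ProbabilityMeasure.tendsto_iff_tendsto_charFun.1 hclt.tendsto t
  simp only [ProbabilityMeasure.coe_mk, Measure.map_id, charFun_gaussianReal, hmean, mul_zero,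
    sub_zero] at h4
  convert h4 using 2
  congr 1
  rw [Real.coe_toNNReal _ (variance_nonneg _ _), hvar]
  push_cast
  ring

/-- The difference between the full sum and the sum over blocks. -/
theorem integral_sub_blockSum_sq_le (hk : DegenerateKernel ν k B) (hY : ∀ i, Measurable (Y i))
    (hind : iIndepFun Y P) (hlaw : ∀ i, P.map (Y i) = ν) {m : ℕ} (hm : 0 < m) {n : ℕ} (hn : 0 < n) :
    ∫ ω, (∑ i ∈ Finset.range (n - 1), k (Y i ω) (Y (i + 1) ω)
        - ∑ l ∈ Finset.range (n / m), blockSum k Y m l ω) ^ 2 ∂P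
      ≤ (∫ a, ∫ b, k a b ^ 2 ∂ν ∂ν) * (n / m + m) := by
  have hN : n / m * m ≤ n - 1 + 1 := by
    rw [Nat.sub_add_cancel hn]; exact Nat.div_mul_le_self n m
  -- The omitted pairs are selected by the complementary weights: about one per block, plus fewer
  -- than `m` after the last full block.
  have h1 := hk.integral_sum_sq hY hind hlaw (fun i => 1 - blockWeight m (n / m) i) (n - 1)
  have h2 : ∀ ω, ∑ i ∈ Finset.range (n - 1), (1 - blockWeight m (n / m) i) * k (Y i ω) (Y (i + 1) ω)
      = ∑ i ∈ Finset.range (n - 1), k (Y i ω) (Y (i + 1) ω)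
        - ∑ l ∈ Finset.range (n / m), blockSum k Y m l ω := by
    intro ω
    simp_rw [sub_mul, one_mul]
    rw [Finset.sum_sub_distrib, sum_blockWeight_mul hm hN fun i => k (Y i ω) (Y (i + 1) ω)]
    rfl
  simp_rw [h2] at h1
  rw [h1]
  refine mul_le_mul_of_nonneg_left ?_ (integral_nonneg fun a => integral_nonneg fun b => sq_nonneg _)
  have h3 : ∀ i, (1 - blockWeight m (n / m) i) ^ 2 = 1 - blockWeight m (n / m) i := fun i => by
    have := blockWeight_sq m (n / m) i
    linear_combination this
  simp_rw [h3]
  rw [Finset.sum_sub_distrib, sum_blockWeight hm hN]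
  have h4 : (n : ℝ) ≤ (n / m : ℕ) * m + m := by
    have h5 := Nat.div_add_mod n m
    have h6 := Nat.mod_lt n hm
    have h7 : n ≤ n / m * m + m := by rw [mul_comm]; omega
    exact_mod_cast h7
  have h5 : ((n / m : ℕ) : ℝ) ≤ n / m := Nat.cast_div_le
  have h6 : ((n - 1 : ℕ) : ℝ) ≤ n := by exact_mod_cast Nat.sub_le n 1
  simp only [Finset.sum_const, Finset.card_range, nsmul_eq_mul, mul_one]
  linarith

/-- There are two errors. The omitted pairs have mean square at most s(1/m + m/n) ≤ 2s/m after
normalization, which uses m² ≤ n. Replacing √n by √(mN), where N is the number of blocks, costs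
√s/m. The argument t/√m adjusts the scale of the block limit. -/
theorem norm_charFun_sub_blockSum_le (hk : DegenerateKernel ν k B) (hY : ∀ i, Measurable (Y i))
    (hind : iIndepFun Y P) (hlaw : ∀ i, P.map (Y i) = ν) {m : ℕ} (hm : 0 < m) {n : ℕ}
    (hn : m ^ 2 ≤ n) (t : ℝ) :
    ‖charFun (P.map fun ω => (√(n : ℝ))⁻¹
        * ∑ i ∈ Finset.range (n - 1), k (Y i ω) (Y (i + 1) ω)) t
      - charFun (P.map fun ω => (√(n / m : ℕ))⁻¹
        * ∑ l ∈ Finset.range (n / m), blockSum k Y m l ω) (t / √m)‖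
      ≤ |t| * √(∫ a, ∫ b, k a b ^ 2 ∂ν ∂ν) * (√(2 / m) + 1 / m) := by
  set s := ∫ a, ∫ b, k a b ^ 2 ∂ν ∂ν with hs
  have hs0 : 0 ≤ s := integral_nonneg fun a => integral_nonneg fun b => sq_nonneg _
  have hmR : (0 : ℝ) < m := by exact_mod_cast hm
  have hn0 : 0 < n := lt_of_lt_of_le (by positivity) hn
  have hnR : (0 : ℝ) < n := by exact_mod_cast hn0
  have hmn : (m : ℝ) ^ 2 ≤ n := by exact_mod_cast hn
  set N := n / m with hNdef
  have hN0 : 0 < N := Nat.div_pos (by nlinarith) hm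
  have hNR : (0 : ℝ) < N := by exact_mod_cast hN0
  set D : Ω → ℝ := fun ω => ∑ i ∈ Finset.range (n - 1), k (Y i ω) (Y (i + 1) ω) with hD
  set W : Ω → ℝ := fun ω => ∑ l ∈ Finset.range N, blockSum k Y m l ω with hW
  have hDm : Measurable D := Finset.measurable_sum _ fun _ _ => hk.measurable_comp (hY _) (hY _)
  have hWm : Measurable W := Finset.measurable_sum _ fun _ _ => hk.measurable_blockSum hY m _
  have hDL : MemLp D 2 P := by
    refine MemLp.of_bound hDm.aestronglyMeasurable ((n - 1 : ℕ) * B) (ae_of_all _ fun ω => ?_)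
    refine (norm_sum_le_of_le _ fun r _ => hk.bdd _ _).trans_eq ?_
    simp
  have hWL : MemLp W 2 P := by
    refine MemLp.of_bound hWm.aestronglyMeasurable (N * ((m - 1 : ℕ) * B)) (ae_of_all _ fun ω => ?_)
    refine (norm_sum_le_of_le _ fun r _ => ?_).trans_eq
      (by rw [Finset.sum_const, Finset.card_range, nsmul_eq_mul])
    refine (norm_sum_le_of_le _ fun r _ => hk.bdd _ _).trans_eq ?_
    simp
  -- compare on the two scales
  have h1 : ‖charFun (P.map fun ω => (√(n : ℝ))⁻¹ * D ω) t
      - charFun (P.map fun ω => (√(n : ℝ))⁻¹ * W ω) t‖ ≤ |t| * (√s * √(2 / m)) := by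
    refine (norm_charFun_sub_le (hDm.const_mul _) (hWm.const_mul _)
      ((hDL.const_mul _).sub (hWL.const_mul _)) t).trans ?_
    refine mul_le_mul_of_nonneg_left ?_ (abs_nonneg t)
    rw [← Real.sqrt_mul hs0]
    refine Real.sqrt_le_sqrt ?_
    have h2 : ∀ ω, ((√(n : ℝ))⁻¹ * D ω - (√(n : ℝ))⁻¹ * W ω) ^ 2 = (n : ℝ)⁻¹ * (D ω - W ω) ^ 2 := by
      intro ω
      rw [← mul_sub, mul_pow, inv_pow, Real.sq_sqrt hnR.le]
    simp_rw [h2]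
    rw [integral_const_mul]
    refine (mul_le_mul_of_nonneg_left (hk.integral_sub_blockSum_sq_le hY hind hlaw hm hn0)
      (by positivity)).trans ?_
    rw [← hs]
    have h3 : (n : ℝ)⁻¹ * (s * (n / m + m)) = s * (1 / m + m / n) := by field_simp
    rw [h3]
    have h4 : (m : ℝ) / n ≤ 1 / m := by
      rw [div_le_div_iff₀ hnR hmR]; nlinarith
    have h5 : (2 : ℝ) / m = 1 / m + 1 / m := by ring
    rw [h5]
    gcongr
  have h2 : charFun (P.map fun ω => (√(N : ℝ))⁻¹ * W ω) (t / √m)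
      = charFun (P.map fun ω => (√m)⁻¹ * ((√(N : ℝ))⁻¹ * W ω)) t := by
    rw [charFun_apply_real, charFun_apply_real, integral_map (hWm.const_mul _).aemeasurable
      (by fun_prop), integral_map ((hWm.const_mul _).const_mul _).aemeasurable (by fun_prop)]
    refine integral_congr_ae (ae_of_all _ fun ω => ?_)
    simp only
    push_cast
    congr 2
    ring
  have h3 : ‖charFun (P.map fun ω => (√(n : ℝ))⁻¹ * W ω) t
      - charFun (P.map fun ω => (√m)⁻¹ * ((√(N : ℝ))⁻¹ * W ω)) t‖ ≤ |t| * (√s * (1 / m)) := by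
    refine (norm_charFun_sub_le (hWm.const_mul _) ((hWm.const_mul _).const_mul _)
      ((hWL.const_mul _).sub ((hWL.const_mul _).const_mul _)) t).trans ?_
    refine mul_le_mul_of_nonneg_left ?_ (abs_nonneg t)
    rw [Real.sqrt_le_iff]
    refine ⟨by positivity, ?_⟩
    have h4 : ∀ ω, ((√(n : ℝ))⁻¹ * W ω - (√m)⁻¹ * ((√(N : ℝ))⁻¹ * W ω)) ^ 2
        = ((√(n : ℝ))⁻¹ - (√(m : ℝ))⁻¹ * (√(N : ℝ))⁻¹) ^ 2 * W ω ^ 2 := fun ω => by ring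
    simp_rw [h4]
    rw [integral_const_mul, hk.integral_blockSum_sum_sq hY hind hlaw hm N, ← hs, mul_pow,
      Real.sq_sqrt hs0, ← mul_inv, ← Real.sqrt_mul hmR.le]
    have hNm : (m : ℝ) * N ≤ n := by
      have : m * N ≤ n := Nat.mul_div_le n m
      exact_mod_cast this
    have hNm2 : (n : ℝ) ≤ m * N + m := by
      have h6 := Nat.mod_lt n hm
      have h7 : n ≤ m * N + m := by
        have := Nat.div_add_mod n m
        rw [← hNdef] at this
        omega
      exact_mod_cast h7
    set q : ℝ := m * N with hq
    have hq0 : 0 < q := by positivity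
    have h5 : ((√(n : ℝ))⁻¹ - (√q)⁻¹) ^ 2 * q ≤ (1 / m) ^ 2 := by
      have h6 : ((√(n : ℝ))⁻¹ - (√q)⁻¹) ^ 2 * q = (√q / √n - 1) ^ 2 := by
        have e1 : √q ≠ 0 := (Real.sqrt_pos.2 hq0).ne'
        have e2 : √(n : ℝ) ≠ 0 := (Real.sqrt_pos.2 hnR).ne'
        nth_rewrite 2 [← Real.sq_sqrt hq0.le]
        field_simp
      rw [h6, ← Real.sqrt_div hq0.le]
      have h7 : q / n ≤ 1 := by rw [div_le_one hnR]; exact hNm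
      -- On [0,1] the square root dominates the identity, so 1 - √(q/n) ≤ 1 - q/n ≤ m/n ≤ 1/m.
      have h8 : q / n ≤ √(q / n) := by
        refine Real.le_sqrt_of_sq_le ?_
        have : 0 ≤ q / n := by positivity
        nlinarith
      have h9 : √(q / n) ≤ 1 := Real.sqrt_le_one.2 h7
      have h10 : 1 - q / n ≤ 1 / m := by
        have : 1 - q / n = (n - q) / n := by field_simp
        rw [this, div_le_div_iff₀ hnR hmR]
        nlinarith
      have h11 : 0 ≤ 1 - √(q / n) := by linarith
      calc (√(q / n) - 1) ^ 2 = (1 - √(q / n)) ^ 2 := by ring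
        _ ≤ (1 / (m : ℝ)) ^ 2 := pow_le_pow_left₀ h11 (by linarith) 2
    have h6 : (N : ℝ) * (m - 1) ≤ q := by rw [hq]; nlinarith
    calc _ ≤ ((√(n : ℝ))⁻¹ - (√q)⁻¹) ^ 2 * (s * q) := by gcongr
      _ = s * (((√(n : ℝ))⁻¹ - (√q)⁻¹) ^ 2 * q) := by ring
      _ ≤ _ := by gcongr
  rw [h2]
  calc _ ≤ |t| * (√s * √(2 / m)) + |t| * (√s * (1 / m)) :=
        (norm_sub_le_norm_sub_add_norm_sub _ _ _).trans (add_le_add h1 h3)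
    _ = _ := by ring

/-- The central limit theorem for sums of a degenerate kernel over neighbours. -/
theorem tendsto_charFun_adjacent_sum (hk : DegenerateKernel ν k B) (hY : ∀ i, Measurable (Y i))
    (hind : iIndepFun Y P) (hlaw : ∀ i, P.map (Y i) = ν) (t : ℝ) :
    Tendsto (fun n : ℕ => charFun (P.map fun ω => (√(n : ℝ))⁻¹
        * ∑ i ∈ Finset.range (n - 1), k (Y i ω) (Y (i + 1) ω)) t) atTop
      (𝓝 (Complex.exp (-((∫ a, ∫ b, k a b ^ 2 ∂ν ∂ν) * t ^ 2 / 2 : ℝ)))) := by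
  set s := ∫ a, ∫ b, k a b ^ 2 ∂ν ∂ν with hs
  rw [Metric.tendsto_nhds]
  intro ε hε
  have hinv : Tendsto (fun m : ℕ => ((m : ℝ))⁻¹) atTop (𝓝 0) := tendsto_inv_atTop_nhds_zero_nat
  have hlim1 : Tendsto (fun m : ℕ => |t| * √s * (√(2 / m) + 1 / m)) atTop (𝓝 0) := by
    have h1 : Tendsto (fun m : ℕ => √(2 / (m : ℝ))) atTop (𝓝 0) := by
      have := (hinv.const_mul 2).sqrt
      simpa [div_eq_mul_inv] using this
    have h2 := (h1.add hinv).const_mul (|t| * √s)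
    simpa [one_div] using h2
  have hlim2 : Tendsto (fun m : ℕ => Complex.exp (-(s * (m - 1) * (t / √m) ^ 2 / 2 : ℝ))) atTop
      (𝓝 (Complex.exp (-(s * t ^ 2 / 2 : ℝ)))) := by
    refine (Complex.continuous_exp.tendsto _).comp (Tendsto.neg ?_)
    refine (Complex.continuous_ofReal.tendsto _).comp ?_
    have h1 : Tendsto (fun m : ℕ => s * t ^ 2 / 2 * (1 - (m : ℝ)⁻¹)) atTop
        (𝓝 (s * t ^ 2 / 2 * (1 - 0))) := (tendsto_const_nhds.sub hinv).const_mul _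
    rw [sub_zero, mul_one] at h1
    refine h1.congr' ?_
    filter_upwards [eventually_gt_atTop 0] with m hm
    have hmR : (0 : ℝ) < m := by exact_mod_cast hm
    rw [div_pow, Real.sq_sqrt hmR.le]
    field_simp
  -- The block length is fixed before n grows: it makes both the block error and the variance defect
  -- s(m-1)/m versus s small.
  obtain ⟨m, h1, h2, hm⟩ := ((hlim1.eventually (gt_mem_nhds (show (0 : ℝ) < ε / 3 by positivity))).and
    ((Metric.tendsto_nhds.1 hlim2 (ε / 3) (by positivity)).and (eventually_gt_atTop 0))).exists
  have h3 := (hk.tendsto_charFun_blockSum hY hind hlaw hm (t / √m)).comp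
    (Nat.tendsto_div_const_atTop hm.ne')
  filter_upwards [Metric.tendsto_nhds.1 h3 (ε / 3) (by positivity), eventually_ge_atTop (m ^ 2)]
    with n h4 h5
  have h6 := hk.norm_charFun_sub_blockSum_le hY hind hlaw hm h5 t
  rw [← dist_eq_norm] at h6
  simp only [Function.comp] at h4
  refine (dist_triangle _ _ _).trans_lt ((add_lt_add_of_le_of_lt h6
    ((dist_triangle _ _ _).trans_lt (add_lt_add h4 h2))).trans_le ?_)
  linarith

end DegenerateKernel

/-! ### The probability integral transform. -/

section ProbabilityIntegralTransform

variable {ν : Measure ℝ} [IsProbabilityMeasure ν]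

/-- Were the mass r of {F ≤ a} larger than `a`, a point s with F(s) midway between would bound that
set from above and give r ≤ F(s) < r. Conversely the set contains the half-line below a quantile of
level `a`; level 0 is separate as it may not be attained. -/
theorem measureReal_cdf_le (hc : Continuous (cdf ν)) {a : ℝ} (h0 : 0 ≤ a) (h1 : a < 1) :
    ν.real {y | cdf ν y ≤ a} = a := by
  apply le_antisymm
  · by_contra! hlt
    have hr1 : ν.real {y | cdf ν y ≤ a} ≤ 1 := measureReal_le_one
    set r := ν.real {y | cdf ν y ≤ a}
    obtain ⟨s, hs⟩ := exists_cdf_eq hc (c := (a + r) / 2) (by linarith) (by linarith)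
    have : r ≤ ν.real (Set.Iic s) := by
      refine measureReal_mono fun y hy => ?_
      by_contra hys
      have h2 := monotone_cdf ν (not_le.1 hys).le
      simp only [Set.mem_ofPred_eq] at hy
      linarith
    rw [← cdf_eq_real, hs] at this
    linarith
  · rcases h0.eq_or_lt with rfl | h0
    · exact measureReal_nonneg
    · obtain ⟨t, ht⟩ := exists_cdf_eq hc h0 h1
      have h2 : ν.real (Set.Iic t) ≤ ν.real {y | cdf ν y ≤ a} :=
        measureReal_mono fun y hy => (monotone_cdf ν hy).trans_eq ht
      rwa [← cdf_eq_real, ht] at h2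

/-- The probability integral transform. -/
theorem map_cdf (hc : Continuous (cdf ν)) :
    ν.map (cdf ν) = (volume : Measure ℝ).restrict (Set.Ioc 0 1) := by
  have := Measure.isProbabilityMeasure_map (μ := ν) (measurable_cdf ν).aemeasurable
  have : IsFiniteMeasure ((volume : Measure ℝ).restrict (Set.Ioc 0 1)) := inferInstance
  refine Measure.ext_of_Iic _ _ fun a => ?_
  rw [Measure.map_apply (measurable_cdf ν) measurableSet_Iic,
    Measure.restrict_apply measurableSet_Iic]
  rcases lt_or_ge a 0 with h0 | h0
  · have e1 : cdf ν ⁻¹' Set.Iic a = ∅ := by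
      ext y
      simpa using h0.trans_le (cdf_nonneg ν y)
    have e2 : Set.Iic a ∩ Set.Ioc 0 1 = ∅ := by
      ext y
      simp only [Set.mem_inter_iff, Set.mem_Iic, Set.mem_Ioc, Set.mem_empty_iff_false, iff_false]
      rintro ⟨h1, h2, -⟩
      linarith
    rw [e1, e2]
    simp
  rcases lt_or_ge a 1 with h1 | h1
  · have e2 : Set.Iic a ∩ Set.Ioc 0 1 = Set.Ioc 0 a := by
      ext y
      simp only [Set.mem_inter_iff, Set.mem_Iic, Set.mem_Ioc]
      exact ⟨fun h => ⟨h.2.1, h.1⟩, fun h => ⟨h.2, h.1, h.2.trans h1.le⟩⟩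
    rw [e2, Real.volume_Ioc, sub_zero, ← ofReal_measureReal]
    exact congrArg _ (measureReal_cdf_le hc h0 h1)
  · have e1 : cdf ν ⁻¹' Set.Iic a = Set.univ := by
      ext y
      simpa using (cdf_le_one ν y).trans h1
    have e2 : Set.Iic a ∩ Set.Ioc (0 : ℝ) 1 = Set.Ioc 0 1 :=
      Set.inter_eq_right.2 fun y hy => hy.2.trans h1
    rw [e1, e2]
    simp

theorem integral_comp_cdf (hc : Continuous (cdf ν)) {f : ℝ → ℝ} (hf : Continuous f) :
    ∫ y, f (cdf ν y) ∂ν = ∫ u in (0 : ℝ)..1, f u := by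
  rw [intervalIntegral.integral_of_le zero_le_one, ← map_cdf hc,
    integral_map (measurable_cdf ν).aemeasurable hf.aestronglyMeasurable]

end ProbabilityIntegralTransform

/-! ### Sums over ranks as deterministic Riemann sums. -/

section RiemannSum

theorem abs_sum_sub_integral_le {f : ℝ → ℝ} {L : ℝ} (hf : ∀ x y, |f x - f y| ≤ L * |x - y|)
    {n : ℕ} (hn : 0 < n) :
    |∑ k ∈ Finset.range n, f ((k + 1) / n) - n * ∫ x in (0 : ℝ)..1, f x| ≤ L := by
  have hL : 0 ≤ L := by simpa using (abs_nonneg _).trans (hf 1 0)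
  have hnR : (0 : ℝ) < n := by exact_mod_cast hn
  have hfc : Continuous f := by
    refine (LipschitzWith.of_dist_le_mul (K := L.toNNReal) fun x y => ?_).continuous
    rw [Real.coe_toNNReal _ hL, Real.dist_eq, Real.dist_eq]
    exact hf x y
  have h1 := intervalIntegral.sum_integral_adjacent_intervals (f := f) (μ := volume) (n := n)
    (a := fun k : ℕ => (k : ℝ) / n) fun k _ => hfc.intervalIntegrable _ _
  simp only [Nat.cast_zero, zero_div, div_self hnR.ne'] at h1
  rw [← h1, Finset.mul_sum, ← Finset.sum_sub_distrib]
  refine (Finset.abs_sum_le_sum_abs _ _).trans ?_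
  have h2 : ∀ k ∈ Finset.range n, |f ((k + 1) / n)
      - n * ∫ x in (k : ℝ) / n..((k + 1 : ℕ) : ℝ) / n, f x| ≤ L / n := by
    intro k _
    have hlen : ((k + 1 : ℕ) : ℝ) / n - k / n = 1 / n := by push_cast; ring
    have h3 : f ((k + 1) / n) - n * ∫ x in (k : ℝ) / n..((k + 1 : ℕ) : ℝ) / n, f x
        = n * ∫ x in (k : ℝ) / n..((k + 1 : ℕ) : ℝ) / n, (f ((k + 1) / n) - f x) := by
      rw [intervalIntegral.integral_sub (by simp) (hfc.intervalIntegrable _ _),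
        intervalIntegral.integral_const, hlen, smul_eq_mul]
      field_simp
    rw [h3, abs_mul, abs_of_pos hnR]
    have h4 := intervalIntegral.norm_integral_le_of_norm_le_const (C := L / n)
      (f := fun x => f ((k + 1) / n) - f x) (a := (k : ℝ) / n) (b := ((k + 1 : ℕ) : ℝ) / n) ?_
    · rw [hlen, Real.norm_eq_abs, abs_of_pos (show 0 < 1 / (n : ℝ) by positivity)] at h4
      calc _ ≤ n * (L / n * (1 / n)) := mul_le_mul_of_nonneg_left h4 hnR.le
        _ = L / n := by field_simp
    · intro x hx
      rw [Set.uIoc_of_le (by gcongr; simp)] at hx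
      have h5 : |((k : ℝ) + 1) / n - x| ≤ 1 / n := by
        push_cast at hx hlen
        rw [abs_le]
        constructor <;> linarith [hx.1, hx.2, show 0 < 1 / (n : ℝ) by positivity]
      exact (hf _ _).trans ((mul_le_mul_of_nonneg_left h5 hL).trans_eq (by ring))
  refine (Finset.sum_le_sum h2).trans_eq ?_
  simp only [Finset.sum_const, Finset.card_range, nsmul_eq_mul]
  field_simp

/-- For distinct values, the ranks run through `1, …, n`. -/
theorem sum_comp_sampleRank {n : ℕ} {y : Fin n → ℝ} (hy : Function.Injective y) (f : ℝ → ℝ) :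
    ∑ j, f (sampleRank y (y j)) = ∑ k ∈ Finset.range n, f (k + 1) := by
  classical
  have hlt : ∀ j, (Finset.univ.filter fun i => y i < y j).card < n := by
    intro j
    have h1 : (Finset.univ.filter fun i => y i < y j) ⊂ Finset.univ := by
      rw [Finset.filter_ssubset]
      exact ⟨j, Finset.mem_univ j, lt_irrefl _⟩
    simpa using Finset.card_lt_card h1
  let ρ : Fin n → Fin n := fun j => ⟨_, hlt j⟩
  have hmono : ∀ j j', y j < y j' → ρ j < ρ j' := by
    intro j j' h
    have hsub : (Finset.univ.filter fun i => y i < y j) ⊂ Finset.univ.filter fun i => y i < y j' := by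
      rw [Finset.ssubset_iff_of_subset]
      · exact ⟨j, by simpa using h, by simp⟩
      · intro i hi
        simp only [Finset.mem_filter, Finset.mem_univ, true_and] at hi ⊢
        exact hi.trans h
    exact Fin.lt_def.2 (Finset.card_lt_card hsub)
  have hinj : Function.Injective ρ := by
    intro j j' h
    by_contra hne
    rcases lt_or_gt_of_ne (hy.ne hne) with h1 | h1
    · exact (hmono _ _ h1).ne h
    · exact (hmono _ _ h1).ne h.symm
  have hrank : ∀ j, sampleRank y (y j) = (ρ j : ℕ) + 1 := by
    intro j
    have h1 : sampleRank y (y j) = ((Finset.univ.filter fun i => y i ≤ y j).card : ℝ) := by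
      simp only [sampleRank, Set.indicator_apply, Set.mem_Iic, Finset.sum_boole]
    have h2 : (Finset.univ.filter fun i => y i ≤ y j)
        = insert j (Finset.univ.filter fun i => y i < y j) := by
      ext i
      simp only [Finset.mem_filter, Finset.mem_univ, true_and, Finset.mem_insert]
      rw [le_iff_eq_or_lt, hy.eq_iff]
    rw [h1, h2, Finset.card_insert_of_notMem (by simp)]
    push_cast
    rfl
  simp_rw [hrank]
  rw [(Finite.injective_iff_bijective.1 hinj).sum_comp fun k : Fin n => f ((k : ℕ) + 1),
    Finset.sum_range fun k => f ((k : ℝ) + 1)]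

/-- Without ties, the sum of a function of one rank is not random at all. This removes the linear
part of the statistic. -/
theorem abs_sum_rank_sub_integral_le {f : ℝ → ℝ} {L : ℝ} (hf : ∀ x y, |f x - f y| ≤ L * |x - y|)
    {n : ℕ} (hn : 0 < n) {y : Fin n → ℝ} (hy : Function.Injective y) :
    |∑ j, f (sampleRank y (y j) / n) - n * ∫ x in (0 : ℝ)..1, f x| ≤ L := by
  rw [sum_comp_sampleRank hy fun r => f (r / n)]
  exact abs_sum_sub_integral_le hf hn

end RiemannSum

/-! ### Hoeffding decomposition of the kernel. -/

section Projection

variable {ν : Measure ℝ} {h : ℝ → ℝ → ℝ} {K B : ℝ}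

/-- The first-order projection of the kernel `h (F ·) (F ·)`, as a function on `[0,1]`. -/
noncomputable def kernelProj (ν : Measure ℝ) (h : ℝ → ℝ → ℝ) (u : ℝ) : ℝ :=
  ∫ b, h u (cdf ν b) ∂ν

/-- The degenerate part of `h`. -/
noncomputable def degeneratePart (ν : Measure ℝ) (h : ℝ → ℝ → ℝ) (u v : ℝ) : ℝ :=
  h u v - kernelProj ν h u - kernelProj ν h v + ∫ a, kernelProj ν h (cdf ν a) ∂ν

theorem degeneratePart_symm (hsymm : ∀ x y, h x y = h y x) (u v : ℝ) :
    degeneratePart ν h u v = degeneratePart ν h v u := by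
  unfold degeneratePart
  rw [hsymm u v]
  ring

variable [IsProbabilityMeasure ν]

theorem BoundedLipschitz.continuous_right (hh : BoundedLipschitz h K B) (u : ℝ) :
    Continuous (h u) := hh.continuous.comp (by fun_prop : Continuous fun v : ℝ => (u, v))

theorem BoundedLipschitz.integrable_cdf (hh : BoundedLipschitz h K B) (u : ℝ) :
    Integrable (fun b => h u (cdf ν b)) ν :=
  Integrable.of_bound ((hh.continuous_right u).measurable.comp
    (measurable_cdf ν)).aestronglyMeasurable B (ae_of_all _ fun _ => hh.bdd _ _)

theorem abs_kernelProj_sub_le (hh : BoundedLipschitz h K B) (u v : ℝ) :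
    |kernelProj ν h u - kernelProj ν h v| ≤ K * |u - v| := by
  rw [kernelProj, kernelProj, ← integral_sub (hh.integrable_cdf u) (hh.integrable_cdf v)]
  refine abs_integral_le_of_bound fun b => ?_
  simpa using hh.lip u (cdf ν b) v (cdf ν b)

theorem abs_kernelProj_le (hh : BoundedLipschitz h K B) (u : ℝ) : |kernelProj ν h u| ≤ B :=
  abs_integral_le_of_bound fun _ => hh.bdd _ _

theorem continuous_kernelProj (hh : BoundedLipschitz h K B) : Continuous (kernelProj ν h) := by
  refine (LipschitzWith.of_dist_le_mul (K := K.toNNReal) fun x y => ?_).continuous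
  rw [Real.coe_toNNReal _ hh.nonneg_left, Real.dist_eq, Real.dist_eq]
  exact abs_kernelProj_sub_le hh x y

theorem integrable_kernelProj (hh : BoundedLipschitz h K B) :
    Integrable (fun a => kernelProj ν h (cdf ν a)) ν :=
  Integrable.of_bound ((continuous_kernelProj hh).measurable.comp
    (measurable_cdf ν)).aestronglyMeasurable B (ae_of_all _ fun _ => abs_kernelProj_le hh _)

theorem degeneratePart_boundedLipschitz (hh : BoundedLipschitz h K B) :
    BoundedLipschitz (degeneratePart ν h) (2 * K) (4 * B) where
  lip a b c d := by
    have h1 := abs_le.1 (hh.lip a b c d)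
    have h2 := abs_le.1 (abs_kernelProj_sub_le (ν := ν) hh a c)
    have h3 := abs_le.1 (abs_kernelProj_sub_le (ν := ν) hh b d)
    unfold degeneratePart
    rw [abs_le]
    constructor <;> nlinarith [h1.1, h1.2, h2.1, h2.2, h3.1, h3.2]
  bdd a b := by
    have h1 := abs_le.1 (hh.bdd a b)
    have h2 := abs_le.1 (abs_kernelProj_le (ν := ν) hh a)
    have h3 := abs_le.1 (abs_kernelProj_le (ν := ν) hh b)
    have h4 : |∫ a, kernelProj ν h (cdf ν a) ∂ν| ≤ B :=
      abs_integral_le_of_bound fun _ => abs_kernelProj_le hh _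
    have h4 := abs_le.1 h4
    unfold degeneratePart
    rw [abs_le]
    constructor <;> linarith [h1.1, h1.2, h2.1, h2.2, h3.1, h3.2, h4.1, h4.2]

theorem integral_degeneratePart_right (hh : BoundedLipschitz h K B) (u : ℝ) :
    ∫ b, degeneratePart ν h u (cdf ν b) ∂ν = 0 := by
  unfold degeneratePart
  rw [integral_add, integral_sub, integral_sub (hh.integrable_cdf u) (integrable_const _)]
  · simp only [integral_const, probReal_univ, smul_eq_mul, one_mul]
    simp [kernelProj]
  · exact (hh.integrable_cdf u).sub (integrable_const _)
  · exact integrable_kernelProj hh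
  · exact ((hh.integrable_cdf u).sub (integrable_const _)).sub (integrable_kernelProj hh)
  · exact integrable_const _

theorem degenerateKernel_degeneratePart (hh : BoundedLipschitz h K B)
    (hsymm : ∀ x y, h x y = h y x) :
    DegenerateKernel ν (fun a b => degeneratePart ν h (cdf ν a) (cdf ν b)) (4 * B) where
  measurable := (degeneratePart_boundedLipschitz hh).measurable.comp
    (((measurable_cdf ν).comp measurable_fst).prodMk ((measurable_cdf ν).comp measurable_snd))
  bdd a b := (degeneratePart_boundedLipschitz hh).bdd _ _
  left b := by
    simp_rw [fun a => degeneratePart_symm (ν := ν) hsymm (cdf ν a) (cdf ν b)]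
    exact integral_degeneratePart_right hh _
  right a := integral_degeneratePart_right hh _

end Projection

/-! ### The asymptotic variance and its positivity. -/

section Variance

variable {ν : Measure ℝ} [IsProbabilityMeasure ν] {h : ℝ → ℝ → ℝ} {K B : ℝ}

theorem integrable_comp_cdf {f : ℝ → ℝ} (hf : Continuous f) :
    Integrable (fun a => f (cdf ν a)) ν := by
  obtain ⟨C, hC⟩ := isCompact_Icc.exists_bound_of_continuousOn (s := Set.Icc (0 : ℝ) 1)
    hf.continuousOn
  exact Integrable.of_bound (hf.measurable.comp (measurable_cdf ν)).aestronglyMeasurable C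
    (ae_of_all _ fun a => hC _ (cdf_mem_Icc ν a))

theorem continuous_integral_comp_cdf {f : ℝ → ℝ → ℝ} (hf : Continuous (Function.uncurry f)) {C : ℝ}
    (hC : ∀ a b, |f a b| ≤ C) : Continuous fun u => ∫ b, f u (cdf ν b) ∂ν := by
  refine continuous_of_dominated (bound := fun _ => C) (fun u => ?_)
    (fun u => ae_of_all _ fun b => hC _ _) (integrable_const _) (ae_of_all _ fun b => ?_)
  · exact ((hf.comp (by fun_prop : Continuous fun v : ℝ => (u, v))).measurable.comp
      (measurable_cdf ν)).aestronglyMeasurable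
  · exact hf.comp (by fun_prop : Continuous fun u : ℝ => (u, cdf ν b))

/-- Expand the square for fixed `u`, with c - γ(u) as a constant, and integrate. The only mixed term
that is not immediate reduces to ∫γ² by Fubini and symmetry (`hM`). -/
theorem integral_degeneratePart_sq (hh : BoundedLipschitz h K B) (hsymm : ∀ x y, h x y = h y x) :
    ∫ a, ∫ b, degeneratePart ν h (cdf ν a) (cdf ν b) ^ 2 ∂ν ∂ν
      = (∫ a, ∫ b, h (cdf ν a) (cdf ν b) ^ 2 ∂ν ∂ν)
        - 2 * (∫ a, kernelProj ν h (cdf ν a) ^ 2 ∂ν)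
        + (∫ a, kernelProj ν h (cdf ν a) ∂ν) ^ 2 := by
  set γ := kernelProj ν h with hγ
  set c := ∫ a, γ (cdf ν a) ∂ν with hc
  set G := ∫ a, γ (cdf ν a) ^ 2 ∂ν with hG
  have hγc : Continuous γ := continuous_kernelProj hh
  have hγB : ∀ u, |γ u| ≤ B := abs_kernelProj_le hh
  have hB := hh.nonneg_right
  have hhc := hh.continuous
  have hu : ∀ u, Continuous (h u) := hh.continuous_right
  have inner : ∀ u, ∫ b, degeneratePart ν h u (cdf ν b) ^ 2 ∂ν
      = (∫ b, h u (cdf ν b) ^ 2 ∂ν) - 2 * (∫ b, h u (cdf ν b) * γ (cdf ν b) ∂ν)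
        + (G - (c - γ u) ^ 2) := by
    intro u
    have i1 : Integrable (fun b => h u (cdf ν b) ^ 2) ν :=
      integrable_comp_cdf (f := fun v => h u v ^ 2) ((hu u).pow 2)
    have i2 : Integrable (fun b => h u (cdf ν b) * γ (cdf ν b)) ν :=
      integrable_comp_cdf (f := fun v => h u v * γ v) ((hu u).mul hγc)
    have i3 : Integrable (fun b => γ (cdf ν b) ^ 2) ν :=
      integrable_comp_cdf (f := fun v => γ v ^ 2) (hγc.pow 2)
    have i4 : Integrable (fun b => h u (cdf ν b)) ν := integrable_comp_cdf (hu u)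
    have i5 : Integrable (fun b => γ (cdf ν b)) ν := integrable_comp_cdf hγc
    have s1 := i1.sub (i2.const_mul 2)
    have s2 := s1.add i3
    have s3 := s2.add (i4.const_mul (2 * (c - γ u)))
    have s4 := s3.sub (i5.const_mul (2 * (c - γ u)))
    have e : ∀ b, degeneratePart ν h u (cdf ν b) ^ 2
        = ((((h u (cdf ν b) ^ 2 - 2 * (h u (cdf ν b) * γ (cdf ν b))) + γ (cdf ν b) ^ 2)
          + 2 * (c - γ u) * h u (cdf ν b)) - 2 * (c - γ u) * γ (cdf ν b)) + (c - γ u) ^ 2 := by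
      intro b
      unfold degeneratePart
      rw [← hγ, ← hc]
      ring
    simp_rw [e]
    rw [integral_add, integral_sub, integral_add, integral_add, integral_sub, integral_const_mul,
      integral_const_mul, integral_const_mul, integral_const]
    · have e1 : ∫ b, h u (cdf ν b) ∂ν = γ u := rfl
      rw [e1, ← hc, ← hG]
      simp only [probReal_univ, smul_eq_mul, one_mul]
      ring
    exacts [i1, i2.const_mul 2, s1, i3, s2, i4.const_mul _, s3, i5.const_mul _, s4,
      integrable_const _]
  simp_rw [inner]
  have j1 : Integrable (fun a => ∫ b, h (cdf ν a) (cdf ν b) ^ 2 ∂ν) ν :=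
    integrable_comp_cdf (f := fun u => ∫ b, h u (cdf ν b) ^ 2 ∂ν)
      (continuous_integral_comp_cdf (f := fun u v => h u v ^ 2) (hhc.pow 2) (C := B ^ 2)
        fun a b => by rw [abs_pow]; exact pow_le_pow_left₀ (abs_nonneg _) (hh.bdd a b) 2)
  have j2 : Integrable (fun a => ∫ b, h (cdf ν a) (cdf ν b) * γ (cdf ν b) ∂ν) ν :=
    integrable_comp_cdf (f := fun u => ∫ b, h u (cdf ν b) * γ (cdf ν b) ∂ν)
      (continuous_integral_comp_cdf (f := fun u v => h u v * γ v)
        (hhc.mul (hγc.comp continuous_snd)) (C := B * B)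
        fun a b => by rw [abs_mul]; exact mul_le_mul (hh.bdd _ _) (hγB _) (abs_nonneg _) hB)
  have j3 : Integrable (fun a => γ (cdf ν a) ^ 2) ν :=
    integrable_comp_cdf (f := fun v => γ v ^ 2) (hγc.pow 2)
  have j4 : Integrable (fun a => γ (cdf ν a)) ν := integrable_comp_cdf hγc
  have s1 := (integrable_const (μ := ν) (G - c ^ 2)).add (j4.const_mul (2 * c))
  have hM : ∫ a, ∫ b, h (cdf ν a) (cdf ν b) * γ (cdf ν b) ∂ν ∂ν = G := by
    rw [integral_integral_swap]
    · rw [hG]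
      refine integral_congr_ae (ae_of_all _ fun b => ?_)
      simp only
      rw [integral_mul_const, sq]
      congr 1
      rw [hγ, kernelProj]
      simp_rw [fun a => hsymm (cdf ν a) (cdf ν b)]
    · refine Integrable.of_bound (C := B * B) ?_ (ae_of_all _ fun p => ?_)
      · exact ((hh.measurable.comp (((measurable_cdf ν).comp measurable_fst).prodMk
          ((measurable_cdf ν).comp measurable_snd))).mul (hγc.measurable.comp
          ((measurable_cdf ν).comp measurable_snd))).aestronglyMeasurable
      · simp only [Function.uncurry]
        rw [norm_mul]
        exact mul_le_mul (hh.bdd _ _) (hγB _) (norm_nonneg _) hB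
  have e2 : ∀ a, G - (c - γ (cdf ν a)) ^ 2
      = (G - c ^ 2) + 2 * c * γ (cdf ν a) - γ (cdf ν a) ^ 2 := fun a => by ring
  simp_rw [e2]
  rw [integral_add, integral_sub, integral_sub, integral_add, integral_const_mul,
    integral_const_mul, integral_const, hM, ← hc, ← hG]
  · simp only [probReal_univ, smul_eq_mul, one_mul]
    ring
  exacts [integrable_const _, j4.const_mul _, s1, j3, j1, j2.const_mul 2, j1.sub (j2.const_mul 2),
    s1.sub j3]

/-- Given the first variable, h₁₂ and h₁₃ are independent with mean γ, so E[h₁₂h₁₃] is the second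
moment of the projection. -/
theorem asymptoticVariance_eq (hh : BoundedLipschitz h K B) (hsymm : ∀ x y, h x y = h y x) :
    asymptoticVariance h (cdf ν) ν
      = (∫ a, ∫ b, degeneratePart ν h (cdf ν a) (cdf ν b) ^ 2 ∂ν ∂ν)
        / (∫ a, kernelProj ν h (cdf ν a) ∂ν) ^ 2 := by
  rw [integral_degeneratePart_sq hh hsymm, asymptoticVariance]
  simp_rw [integral_const_mul, integral_mul_const]
  simp only [kernelProj, sq]

theorem kernelProj_eq (hc : Continuous (cdf ν)) (hh : BoundedLipschitz h K B) (u : ℝ) :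
    kernelProj ν h u = ∫ v in (0 : ℝ)..1, h u v :=
  integral_comp_cdf hc (hh.continuous_right u)

theorem kernelMean_eq (hc : Continuous (cdf ν)) (hh : BoundedLipschitz h K B)
    (hsymm : ∀ x y, h x y = h y x) :
    kernelMean h = ∫ a, kernelProj ν h (cdf ν a) ∂ν := by
  rw [integral_comp_cdf hc (continuous_kernelProj hh), kernelMean]
  simp_rw [kernelProj_eq hc hh, fun v u => hsymm u v]

theorem kernelProj_mean_pos (hc : Continuous (cdf ν)) (hh : BoundedLipschitz h K B)
    (hpos : ∀ x ∈ Set.Icc (0 : ℝ) 1, ∀ y ∈ Set.Icc (0 : ℝ) 1, x ≠ y → 0 < h x y)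
    (hdiag : ∀ x ∈ Set.Icc (0 : ℝ) 1, h x x = 0) :
    0 < ∫ a, kernelProj ν h (cdf ν a) ∂ν := by
  have hnn : ∀ x ∈ Set.Icc (0 : ℝ) 1, ∀ y ∈ Set.Icc (0 : ℝ) 1, 0 ≤ h x y := by
    intro x hx y hy
    by_cases hxy : x = y
    · rw [← hxy, hdiag x hx]
    · exact (hpos x hx y hy hxy).le
  have h0 : (0 : ℝ) ∈ Set.Icc (0 : ℝ) 1 := by simp
  have h1 : (1 : ℝ) ∈ Set.Icc (0 : ℝ) 1 := by simp
  have hγ0 : ∀ u ∈ Set.Icc (0 : ℝ) 1, 0 ≤ kernelProj ν h u := fun u hu =>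
    integral_nonneg fun b => hnn u hu _ (cdf_mem_Icc ν b)
  rw [integral_comp_cdf hc (continuous_kernelProj hh)]
  refine intervalIntegral.integral_pos zero_lt_one (continuous_kernelProj hh).continuousOn
    (fun u hu => hγ0 u ⟨hu.1.le, hu.2⟩) ⟨0, h0, ?_⟩
  rw [kernelProj_eq hc hh]
  exact intervalIntegral.integral_pos zero_lt_one (hh.continuous_right 0).continuousOn
    (fun v hv => hnn 0 h0 v ⟨hv.1.le, hv.2⟩) ⟨1, h1, hpos 0 h0 1 h1 zero_ne_one⟩

/-- If the degenerate part vanished at (0,0), (1,1) and (0,1), then γ(0) = γ(1) = c/2 because h is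
zero on the diagonal, whence h(0,1) = 0. Continuity turns one nonzero value into a positive
integral. -/
theorem integral_degeneratePart_sq_pos (hc : Continuous (cdf ν)) (hh : BoundedLipschitz h K B)
    (hpos : ∀ x ∈ Set.Icc (0 : ℝ) 1, ∀ y ∈ Set.Icc (0 : ℝ) 1, x ≠ y → 0 < h x y)
    (hdiag : ∀ x ∈ Set.Icc (0 : ℝ) 1, h x x = 0) :
    0 < ∫ a, ∫ b, degeneratePart ν h (cdf ν a) (cdf ν b) ^ 2 ∂ν ∂ν := by
  have h0 : (0 : ℝ) ∈ Set.Icc (0 : ℝ) 1 := by simp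
  have h1 : (1 : ℝ) ∈ Set.Icc (0 : ℝ) 1 := by simp
  have hd := degeneratePart_boundedLipschitz (ν := ν) hh
  have hcont : Continuous fun u => ∫ b, degeneratePart ν h u (cdf ν b) ^ 2 ∂ν :=
    continuous_integral_comp_cdf (f := fun u v => degeneratePart ν h u v ^ 2) (hd.continuous.pow 2)
      (C := (4 * B) ^ 2)
      fun a b => by rw [abs_pow]; exact pow_le_pow_left₀ (abs_nonneg _) (hd.bdd a b) 2
  obtain ⟨u, hu, v, hv, huv⟩ : ∃ u ∈ Set.Icc (0 : ℝ) 1, ∃ v ∈ Set.Icc (0 : ℝ) 1,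
      degeneratePart ν h u v ≠ 0 := by
    by_contra! hcon
    have e1 := hcon 0 h0 0 h0
    have e2 := hcon 1 h1 1 h1
    have e3 := hcon 0 h0 1 h1
    have e4 := hpos 0 h0 1 h1 zero_ne_one
    have e5 := hdiag 0 h0
    have e6 := hdiag 1 h1
    unfold degeneratePart at e1 e2 e3
    linarith
  rw [integral_comp_cdf hc hcont]
  refine intervalIntegral.integral_pos zero_lt_one hcont.continuousOn
    (fun u _ => integral_nonneg fun b => sq_nonneg _) ⟨u, hu, ?_⟩
  have hcu : Continuous fun v => degeneratePart ν h u v ^ 2 := (hd.continuous_right u).pow 2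
  rw [integral_comp_cdf hc hcu]
  exact intervalIntegral.integral_pos zero_lt_one hcu.continuousOn (fun v _ => sq_nonneg _)
    ⟨v, hv, by positivity⟩

end Variance

theorem integral_fintype_sum_sq {Ω ι : Type*} [MeasurableSpace Ω] {P : Measure Ω}
    [IsProbabilityMeasure P] [Fintype ι] {f : ι → Ω → ℝ} (hf : ∀ i, Measurable (f i)) {C : ℝ}
    (hC : ∀ i ω, |f i ω| ≤ C) :
    ∫ ω, (∑ i, f i ω) ^ 2 ∂P = ∑ i, ∑ j, ∫ ω, f i ω * f j ω ∂P := by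
  have hi : ∀ i j, Integrable (fun ω => f i ω * f j ω) P := fun i j =>
    Integrable.of_bound (C := C * C) ((hf i).mul (hf j)).aestronglyMeasurable
      (ae_of_all _ fun ω => by
        rw [norm_mul]
        exact mul_le_mul (hC i ω) (hC j ω) (norm_nonneg _) ((abs_nonneg _).trans (hC i ω)))
  simp_rw [sq, Finset.sum_mul_sum]
  rw [integral_finsetSum _ fun i _ => integrable_finsetSum _ fun j _ => hi i j]
  simp_rw [integral_finsetSum _ fun j _ => hi _ j]

/-- Continuity of F excludes atoms, hence ties; the Riemann-sum bounds for ranks rely on this. -/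
theorem ae_pi_injective {n : ℕ} {ν : Measure ℝ} [IsProbabilityMeasure ν]
    (hc : Continuous (cdf ν)) :
    ∀ᵐ y ∂(Measure.pi fun _ : Fin n => ν), Function.Injective y := by
  have hat : ∀ x, ν {x} = 0 := by
    intro x
    rw [← measure_cdf ν, StieltjesFunction.measure_singleton,
      hc.continuousAt.continuousWithinAt.leftLim_eq, sub_self, ENNReal.ofReal_zero]
  have hdiag : (ν.prod ν) {p | p.1 = p.2} = 0 := by
    rw [Measure.measure_prod_null (measurableSet_eq_fun measurable_fst measurable_snd)]
    refine ae_of_all _ fun x => ?_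
    have : Prod.mk x ⁻¹' {p : ℝ × ℝ | p.1 = p.2} = {x} := by
      ext y
      simp [eq_comm]
    simp only [this, hat, Pi.zero_apply]
  have h1 : ∀ i j : Fin n, ∀ᵐ y ∂(Measure.pi fun _ : Fin n => ν), i ≠ j → y i ≠ y j := by
    intro i j
    by_cases hij : i = j
    · exact ae_of_all _ fun y h => (h hij).elim
    · have hm : Measurable fun y : Fin n → ℝ => (y i, y j) := by fun_prop
      rw [← pi_map_pair ν hij, Measure.map_apply hm
        (measurableSet_eq_fun measurable_fst measurable_snd)] at hdiag
      have : ∀ᵐ y ∂(Measure.pi fun _ : Fin n => ν), y i ≠ y j := by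
        rw [ae_iff]
        simpa using hdiag
      exact this.mono fun y h _ => h
  filter_upwards [ae_all_iff.2 fun i => ae_all_iff.2 (h1 i)] with y hy i j hij
  by_contra hne
  exact hy i j hne hij

/-! ### Mean-square error of replacing ranks by distribution function values. -/

section RankApproximation

variable {n : ℕ} {ν : Measure ℝ} {q : ℝ → ℝ → ℝ} {K B : ℝ}

theorem measurable_sampleRank_self (i : Fin n) :
    Measurable fun y : Fin n → ℝ => sampleRank y (y i) := by
  refine Finset.measurable_sum _ fun j _ => ?_
  have : (fun y : Fin n → ℝ => (Set.Iic (y i)).indicator (fun _ => (1 : ℝ)) (y j))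
      = fun y => if y j ≤ y i then 1 else 0 := by
    ext y
    simp only [Set.indicator_apply, Set.mem_Iic]
  rw [this]
  exact Measurable.ite (measurableSet_le (measurable_pi_apply j) (measurable_pi_apply i))
    measurable_const measurable_const

theorem sampleRank_comp_perm (y : Fin n → ℝ) (σ : Equiv.Perm (Fin n)) (t : ℝ) :
    sampleRank (fun i => y (σ i)) t = sampleRank y t :=
  Equiv.sum_comp σ fun j => (Set.Iic t).indicator (fun _ => (1 : ℝ)) (y j)

/-- The normalized rank of the `i`-th value. -/
noncomputable def normRank (y : Fin n → ℝ) (i : Fin n) : ℝ := sampleRank y (y i) / n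

theorem measurable_normRank (i : Fin n) : Measurable fun y : Fin n → ℝ => normRank y i :=
  (measurable_sampleRank_self i).div_const _

/-- The normalized ranks approximate the values of the distribution function. -/
theorem integral_normRank_sub_cdf_sq_le [IsProbabilityMeasure ν] (hn : 0 < n) (i : Fin n) :
    ∫ y, (normRank y i - cdf ν (y i)) ^ 2 ∂(Measure.pi fun _ : Fin n => ν) ≤ 2 / n := by
  have hnR : (0 : ℝ) < n := by exact_mod_cast hn
  let ψ : Fin n → (Fin n → ℝ) → ℝ := fun j y =>
    (Set.Iic (y i)).indicator (fun _ => (1 : ℝ)) (y j) - cdf ν (y i)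
  have hind : ∀ a b : ℝ, (Set.Iic a).indicator (fun _ => (1 : ℝ)) b = if b ≤ a then 1 else 0 :=
    fun a b => by simp only [Set.indicator_apply, Set.mem_Iic]
  have hψm : ∀ j, Measurable (ψ j) := by
    intro j
    simp only [ψ, hind]
    exact (Measurable.ite (measurableSet_le (measurable_pi_apply j) (measurable_pi_apply i))
      measurable_const measurable_const).sub ((measurable_cdf ν).comp (measurable_pi_apply i))
  have hψB : ∀ j y, |ψ j y| ≤ 1 := by
    intro j y
    obtain ⟨h0, h1⟩ := cdf_mem_Icc ν (y i)
    simp only [ψ, hind]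
    rw [abs_le]
    split_ifs <;> constructor <;> linarith
  have h1 : ∀ y, normRank y i - cdf ν (y i) = (n : ℝ)⁻¹ * ∑ j, ψ j y := by
    intro y
    simp only [ψ, Finset.sum_sub_distrib, Finset.sum_const, Finset.card_univ, Fintype.card_fin,
      nsmul_eq_mul]
    rw [normRank, sampleRank]
    field_simp
  -- Given `y i`, the summand with index j ≠ i is centred, so a product survives only if j = i or j
  -- = k. These cases number at most 2n, which gives the bound 2/n.
  have h2 : ∀ j k, ∫ y, ψ j y * ψ k y ∂(Measure.pi fun _ : Fin n => ν)
      ≤ (if j = i then 1 else 0) + if j = k then 1 else 0 := by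
    intro j k
    by_cases hj : j = i ∨ j = k
    · have h3 : ∫ y, ψ j y * ψ k y ∂(Measure.pi fun _ : Fin n => ν) ≤ 1 := by
        refine (le_abs_self _).trans (abs_integral_le_of_bound fun y => ?_)
        rw [abs_mul]
        exact mul_le_one₀ (hψB j y) (abs_nonneg _) (hψB k y)
      rcases hj with hj | hj
      · rw [if_pos hj]; split_ifs <;> linarith
      · rw [if_pos hj]; split_ifs <;> linarith
    · push Not at hj
      rw [if_neg hj.1, if_neg hj.2, add_zero]
      refine le_of_eq (integral_pi_eq_zero_of_update ν j ((hψm j).mul (hψm k)) (B := 1) (fun y => ?_)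
        fun y => ?_)
      · simp only [abs_mul]
        exact mul_le_one₀ (hψB j y) (abs_nonneg _) (hψB k y)
      · simp only [ψ, Function.update_self, Function.update_of_ne hj.1.symm,
          Function.update_of_ne hj.2.symm]
        rw [integral_mul_const, integral_sub ((integrable_const _).indicator measurableSet_Iic)
          (integrable_const _), integral_indicator_const _ measurableSet_Iic]
        simp [cdf_eq_real]
  simp_rw [h1, mul_pow]
  rw [integral_const_mul, integral_fintype_sum_sq hψm hψB]
  have h4 : ∑ j, ∑ k, ∫ y, ψ j y * ψ k y ∂(Measure.pi fun _ : Fin n => ν) ≤ 2 * n := by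
    refine (Finset.sum_le_sum fun j _ => Finset.sum_le_sum fun k _ => h2 j k).trans_eq ?_
    simp [Finset.sum_add_distrib]
    ring
  calc _ ≤ (n : ℝ)⁻¹ ^ 2 * (2 * n) := by gcongr
    _ = 2 / n := by field_simp

/-- The error of replacing normalized ranks by values of the distribution function. -/
noncomputable def rankError (ν : Measure ℝ) (q : ℝ → ℝ → ℝ) (y : Fin n → ℝ) (i j : Fin n) : ℝ :=
  q (normRank y i) (normRank y j) - q (cdf ν (y i)) (cdf ν (y j))

theorem measurable_rankError (hq : BoundedLipschitz q K B) (i j : Fin n) :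
    Measurable fun y : Fin n → ℝ => rankError ν q y i j :=
  (hq.measurable.comp ((measurable_normRank i).prodMk (measurable_normRank j))).sub
    (hq.measurable.comp (((measurable_cdf ν).comp (measurable_pi_apply i)).prodMk
      ((measurable_cdf ν).comp (measurable_pi_apply j))))

theorem abs_rankError_le (hq : BoundedLipschitz q K B) (y : Fin n → ℝ) (i j : Fin n) :
    |rankError ν q y i j| ≤ 2 * B := by
  refine (abs_sub _ _).trans ?_
  linarith [hq.bdd (normRank y i) (normRank y j), hq.bdd (cdf ν (y i)) (cdf ν (y j))]

variable [IsProbabilityMeasure ν]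

theorem integral_rankError_sq_le (hq : BoundedLipschitz q K B) (hn : 0 < n) (i j : Fin n) :
    ∫ y, rankError ν q y i j ^ 2 ∂(Measure.pi fun _ : Fin n => ν) ≤ 8 * K ^ 2 / n := by
  have hK := hq.nonneg_left
  have hi : ∀ i : Fin n, Integrable (fun y => (normRank y i - cdf ν (y i)) ^ 2)
      (Measure.pi fun _ : Fin n => ν) := by
    intro i
    refine Integrable.of_bound (C := 1) (((measurable_normRank i).sub
      ((measurable_cdf ν).comp (measurable_pi_apply i))).pow_const 2).aestronglyMeasurable
      (ae_of_all _ fun y => ?_)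
    obtain ⟨h0, h1⟩ := cdf_mem_Icc ν (y i)
    obtain ⟨h2, h3⟩ := sampleRank_div_mem_Icc y (y i)
    rw [Real.norm_eq_abs, abs_pow, sq_abs, normRank, sq_le_one_iff_abs_le_one, abs_le]
    constructor <;> linarith
  calc _ ≤ ∫ y, 2 * K ^ 2 * ((normRank y i - cdf ν (y i)) ^ 2
        + (normRank y j - cdf ν (y j)) ^ 2) ∂(Measure.pi fun _ : Fin n => ν) := by
        refine integral_mono_of_nonneg (ae_of_all _ fun y => sq_nonneg _)
          (((hi i).add (hi j)).const_mul _) (ae_of_all _ fun y => ?_)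
        have h1 := hq.lip (normRank y i) (normRank y j) (cdf ν (y i)) (cdf ν (y j))
        have h2 : rankError ν q y i j ^ 2 ≤ (K * (|normRank y i - cdf ν (y i)|
            + |normRank y j - cdf ν (y j)|)) ^ 2 := by
          rw [← sq_abs]
          exact pow_le_pow_left₀ (abs_nonneg _) h1 2
        refine h2.trans ?_
        simp only
        rw [← sq_abs (normRank y i - _), ← sq_abs (normRank y j - _)]
        generalize |normRank y i - cdf ν (y i)| = a
        generalize |normRank y j - cdf ν (y j)| = b
        nlinarith [mul_nonneg (sq_nonneg K) (sq_nonneg (a - b))]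
    _ ≤ 2 * K ^ 2 * (2 / n + 2 / n) := by
        rw [integral_const_mul, integral_add (hi i) (hi j)]
        gcongr <;> exact integral_normRank_sub_cdf_sq_le hn _
    _ = 8 * K ^ 2 / n := by ring

theorem abs_integral_rankError_mul_le (hq : BoundedLipschitz q K B) (hn : 0 < n) (i j k l : Fin n) :
    |∫ y, rankError ν q y i j * rankError ν q y k l ∂(Measure.pi fun _ : Fin n => ν)|
      ≤ 8 * K ^ 2 / n := by
  have hi : ∀ i j : Fin n, Integrable (fun y => rankError ν q y i j ^ 2)
      (Measure.pi fun _ : Fin n => ν) := fun i j =>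
    Integrable.of_bound (C := (2 * B) ^ 2) ((measurable_rankError hq i j).pow_const 2).aestronglyMeasurable
      (ae_of_all _ fun y => by
        rw [norm_pow]; exact pow_le_pow_left₀ (norm_nonneg _) (abs_rankError_le hq y i j) 2)
  refine (abs_integral_le_integral_abs).trans ?_
  calc _ ≤ ∫ y, (rankError ν q y i j ^ 2 + rankError ν q y k l ^ 2) / 2
        ∂(Measure.pi fun _ : Fin n => ν) := by
        refine integral_mono_of_nonneg (ae_of_all _ fun y => abs_nonneg _)
          (((hi i j).add (hi k l)).div_const _) (ae_of_all _ fun y => ?_)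
        simp only
        rw [abs_mul, ← sq_abs (rankError ν q y i j), ← sq_abs (rankError ν q y k l)]
        nlinarith [sq_nonneg (|rankError ν q y i j| - |rankError ν q y k l|)]
    _ ≤ _ := by
        rw [integral_div, integral_add (hi i j) (hi k l)]
        linarith [integral_rankError_sq_le (ν := ν) hq hn i j,
          integral_rankError_sq_le (ν := ν) hq hn k l]

/-- Ranks are equivariant under relabelling and the product measure is invariant, so mixed moments
depend only on the coincidence pattern of the indices. -/
theorem integral_rankError_mul_perm (hq : BoundedLipschitz q K B) (τ : Equiv.Perm (Fin n))
    (i j k l : Fin n) :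
    ∫ y, rankError ν q y (τ i) (τ j) * rankError ν q y (τ k) (τ l) ∂(Measure.pi fun _ : Fin n => ν)
      = ∫ y, rankError ν q y i j * rankError ν q y k l ∂(Measure.pi fun _ : Fin n => ν) := by
  have hm : Measurable fun (y : Fin n → ℝ) i => y (τ i) := by fun_prop
  conv_rhs => rw [← pi_map_comp_perm ν τ]
  have hm2 : Measurable fun y : Fin n → ℝ => rankError ν q y i j * rankError ν q y k l :=
    (measurable_rankError hq i j).mul (measurable_rankError hq k l)
  rw [integral_map hm.aemeasurable hm2.aestronglyMeasurable]
  simp only [rankError, normRank, sampleRank_comp_perm]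

theorem exists_perm_of_distinct {i j k l i' j' k' l' : Fin n} (h : [i, j, k, l].Nodup)
    (h' : [i', j', k', l'].Nodup) :
    ∃ τ : Equiv.Perm (Fin n), τ i = i' ∧ τ j = j' ∧ τ k = k' ∧ τ l = l' := by
  have inj : ∀ a b c d : Fin n, [a, b, c, d].Nodup → Function.Injective ![a, b, c, d] := by
    intro a b c d h
    rw [← List.nodup_ofFn]
    simpa [List.ofFn_succ] using h
  obtain ⟨τ, hτ⟩ := (Equiv.Perm.isMultiplyPretransitive (Fin n) 4).exists_smul_eq
    ⟨_, inj _ _ _ _ h⟩ ⟨_, inj _ _ _ _ h'⟩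
  refine ⟨τ, ?_, ?_, ?_, ?_⟩
  · exact DFunLike.congr_fun hτ 0
  · exact DFunLike.congr_fun hτ 1
  · exact DFunLike.congr_fun hτ 2
  · exact DFunLike.congr_fun hτ 3

end RankApproximation

/-! ### Counting coincidences among four indices. -/

/-- The number of coincidences among four indices is at least one unless they are distinct. -/
theorem one_le_coincidences_of_not_nodup {n : ℕ} {i j k l : Fin n} (h : ¬ [i, j, k, l].Nodup) :
    (1 : ℝ) ≤ (if i = j then 1 else 0) + (if i = k then 1 else 0) + (if i = l then 1 else 0)
      + (if j = k then 1 else 0) + (if j = l then 1 else 0) + if k = l then 1 else 0 := by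
  have h0 : ∀ a b : Fin n, (0 : ℝ) ≤ if a = b then 1 else 0 := fun a b => by
    split_ifs <;> norm_num
  have h3 : i = j ∨ i = k ∨ i = l ∨ j = k ∨ j = l ∨ k = l := by
    by_contra! hcon
    exact h (by simp [hcon])
  have e1 := h0 i j
  have e2 := h0 i k
  have e3 := h0 i l
  have e4 := h0 j k
  have e5 := h0 j l
  have e6 := h0 k l
  rcases h3 with e | e | e | e | e | e <;> rw [if_pos e] at * <;> linarith

/-- The total number of coincidences, over all quadruples of indices. -/
theorem sum_coincidences (n : ℕ) : ∑ p : Fin n × Fin n, ∑ r : Fin n × Fin n,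
    ((if p.1 = p.2 then (1 : ℝ) else 0) + (if p.1 = r.1 then 1 else 0)
      + (if p.1 = r.2 then 1 else 0) + (if p.2 = r.1 then 1 else 0)
      + (if p.2 = r.2 then 1 else 0) + if r.1 = r.2 then 1 else 0) = 6 * (n : ℝ) ^ 3 := by
  have e1 : ∑ p : Fin n × Fin n, ∑ r : Fin n × Fin n, (if p.1 = p.2 then (1 : ℝ) else 0)
      = (n : ℝ) ^ 3 := by
    simp_rw [Fintype.sum_prod_type]
    change ∑ a : Fin n, ∑ b : Fin n, ∑ c : Fin n, ∑ d : Fin n,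
      (if a = b then (1 : ℝ) else 0) = _
    simp
    ring
  have e2 : ∑ p : Fin n × Fin n, ∑ r : Fin n × Fin n, (if p.1 = r.1 then (1 : ℝ) else 0)
      = (n : ℝ) ^ 3 := by
    simp_rw [Fintype.sum_prod_type]
    change ∑ a : Fin n, ∑ b : Fin n, ∑ c : Fin n, ∑ d : Fin n,
      (if a = c then (1 : ℝ) else 0) = _
    simp
    ring
  have e3 : ∑ p : Fin n × Fin n, ∑ r : Fin n × Fin n, (if p.1 = r.2 then (1 : ℝ) else 0)
      = (n : ℝ) ^ 3 := by
    simp_rw [Fintype.sum_prod_type]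
    change ∑ a : Fin n, ∑ b : Fin n, ∑ c : Fin n, ∑ d : Fin n,
      (if a = d then (1 : ℝ) else 0) = _
    simp
    ring
  have e4 : ∑ p : Fin n × Fin n, ∑ r : Fin n × Fin n, (if p.2 = r.1 then (1 : ℝ) else 0)
      = (n : ℝ) ^ 3 := by
    simp_rw [Fintype.sum_prod_type]
    change ∑ a : Fin n, ∑ b : Fin n, ∑ c : Fin n, ∑ d : Fin n,
      (if b = c then (1 : ℝ) else 0) = _
    simp
    ring
  have e5 : ∑ p : Fin n × Fin n, ∑ r : Fin n × Fin n, (if p.2 = r.2 then (1 : ℝ) else 0)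
      = (n : ℝ) ^ 3 := by
    simp_rw [Fintype.sum_prod_type]
    change ∑ a : Fin n, ∑ b : Fin n, ∑ c : Fin n, ∑ d : Fin n,
      (if b = d then (1 : ℝ) else 0) = _
    simp
    ring
  have e6 : ∑ p : Fin n × Fin n, ∑ r : Fin n × Fin n, (if r.1 = r.2 then (1 : ℝ) else 0)
      = (n : ℝ) ^ 3 := by
    simp_rw [Fintype.sum_prod_type]
    change ∑ a : Fin n, ∑ b : Fin n, ∑ c : Fin n, ∑ d : Fin n,
      (if c = d then (1 : ℝ) else 0) = _
    simp
    ring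
  simp only [Finset.sum_add_distrib, e1, e2, e3, e4, e5, e6]
  ring

/-- A bounded four-index array that is constant off the diagonals has a small constant if its total
sum is small. -/
theorem pow_card_mul_abs_le {n : ℕ} {R : Fin n → Fin n → Fin n → Fin n → ℝ} {Q δ : ℝ} (hδ : 0 ≤ δ)
    (hRδ : ∀ i j k l, |R i j k l| ≤ δ) (hQδ : |Q| ≤ δ)
    (hRQ : ∀ i j k l, [i, j, k, l].Nodup → R i j k l = Q) :
    (n : ℝ) ^ 4 * |Q| ≤ |∑ p : Fin n × Fin n, ∑ r : Fin n × Fin n, R p.1 p.2 r.1 r.2|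
      + 12 * δ * n ^ 3 := by
  have hdiff : ∀ i j k l : Fin n, |Q - R i j k l| ≤ 2 * δ * ((if i = j then 1 else 0)
      + (if i = k then 1 else 0) + (if i = l then 1 else 0) + (if j = k then 1 else 0)
      + (if j = l then 1 else 0) + if k = l then 1 else 0) := by
    intro i j k l
    by_cases h : [i, j, k, l].Nodup
    · rw [hRQ i j k l h, sub_self, abs_zero]
      positivity
    · have h2 : |Q - R i j k l| ≤ 2 * δ := by
        refine (abs_sub _ _).trans ?_
        linarith [hRδ i j k l]
      exact h2.trans (le_mul_of_one_le_right (by positivity) (one_le_coincidences_of_not_nodup h))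
  have hcount : ∑ p : Fin n × Fin n, ∑ r : Fin n × Fin n, |Q - R p.1 p.2 r.1 r.2|
      ≤ 12 * δ * n ^ 3 := by
    refine (Finset.sum_le_sum fun p _ => Finset.sum_le_sum fun r _ =>
      hdiff p.1 p.2 r.1 r.2).trans_eq ?_
    simp_rw [← Finset.mul_sum, sum_coincidences]
    ring
  have hQ : (n : ℝ) ^ 4 * Q = ∑ p : Fin n × Fin n, ∑ r : Fin n × Fin n, R p.1 p.2 r.1 r.2
      + ∑ p : Fin n × Fin n, ∑ r : Fin n × Fin n, (Q - R p.1 p.2 r.1 r.2) := by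
    simp only [Finset.sum_sub_distrib, add_sub_cancel, Finset.sum_const, Finset.card_univ,
      Fintype.card_prod, Fintype.card_fin, nsmul_eq_mul]
    push_cast
    ring
  rw [← abs_of_nonneg (show 0 ≤ (n : ℝ) ^ 4 by positivity), ← abs_mul, hQ]
  refine (abs_add_le _ _).trans (add_le_add le_rfl ?_)
  refine (Finset.abs_sum_le_sum_abs _ _).trans (le_trans ?_ hcount)
  exact Finset.sum_le_sum fun p _ => Finset.abs_sum_le_sum_abs _ _

/-! ### Cancellation of rank errors over neighbours. -/

section RankSums

variable {n : ℕ} {ν : Measure ℝ} [IsProbabilityMeasure ν] {q : ℝ → ℝ → ℝ} {K B : ℝ}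

theorem DegenerateKernel.integral_mul_eq_zero {k : ℝ → ℝ → ℝ} (hk : DegenerateKernel ν k B)
    {i j l m : Fin n} (h1 : i ≠ j) (h2 : i ≠ l) (h3 : i ≠ m) :
    ∫ y, k (y i) (y j) * k (y l) (y m) ∂(Measure.pi fun _ : Fin n => ν) = 0 := by
  have hm : Measurable fun y : Fin n → ℝ => k (y i) (y j) * k (y l) (y m) :=
    (hk.measurable_comp (measurable_pi_apply _) (measurable_pi_apply _)).mul
      (hk.measurable_comp (measurable_pi_apply _) (measurable_pi_apply _))
  refine integral_pi_eq_zero_of_update ν i hm (B := B * B) (fun y => ?_) fun y => ?_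
  · rw [abs_mul]
    exact mul_le_mul (hk.bdd _ _) (hk.bdd _ _) (abs_nonneg _) hk.nonneg
  · simp only [Function.update_self, Function.update_of_ne h1.symm, Function.update_of_ne h2.symm,
      Function.update_of_ne h3.symm]
    rw [integral_mul_const, hk.left, zero_mul]

/-- Second moment of the full double sum of a degenerate kernel. -/
theorem DegenerateKernel.integral_double_sum_sq_le {k : ℝ → ℝ → ℝ} (hk : DegenerateKernel ν k B)
    (hsymm : ∀ a b, k a b = k b a) :
    ∫ y, (∑ p : Fin n × Fin n, k (y p.1) (y p.2)) ^ 2 ∂(Measure.pi fun _ : Fin n => ν)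
      ≤ 3 * B ^ 2 * n ^ 2 := by
  have hB := hk.nonneg
  rw [integral_fintype_sum_sq (fun p => hk.measurable_comp (measurable_pi_apply _)
    (measurable_pi_apply _)) (fun p y => hk.bdd _ _)]
  have h1 : ∀ p r : Fin n × Fin n,
      ∫ y, k (y p.1) (y p.2) * k (y r.1) (y r.2) ∂(Measure.pi fun _ : Fin n => ν)
        ≤ B ^ 2 * ((if p.1 = p.2 then 1 else 0) * (if r.1 = r.2 then 1 else 0)
          + (if p = r then 1 else 0) + if p = r.swap then 1 else 0) := by
    rintro ⟨i, j⟩ ⟨l, m⟩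
    simp only [Prod.mk.injEq, Prod.swap_prod_mk]
    -- An index that differs from the other three can be integrated out. If there is none, the four
    -- indices match up in one of three ways, each allowing n² choices.
    by_cases hpair : (i = j ∧ l = m) ∨ (i = l ∧ j = m) ∨ (i = m ∧ j = l)
    · have h2 : ∫ y, k (y i) (y j) * k (y l) (y m) ∂(Measure.pi fun _ : Fin n => ν) ≤ B ^ 2 := by
        refine (le_abs_self _).trans (abs_integral_le_of_bound fun y => ?_)
        rw [abs_mul, sq]
        exact mul_le_mul (hk.bdd _ _) (hk.bdd _ _) (abs_nonneg _) hB
      refine h2.trans (le_mul_of_one_le_right (by positivity) ?_)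
      rcases hpair with ⟨e1, e2⟩ | e | e
      · rw [if_pos e1, if_pos e2]; split_ifs <;> norm_num
      · rw [if_pos e]; split_ifs <;> norm_num
      · rw [if_pos e]; split_ifs <;> norm_num
    · have h0 : ∫ y, k (y i) (y j) * k (y l) (y m) ∂(Measure.pi fun _ : Fin n => ν) = 0 := by
        by_cases c1 : i ≠ j ∧ i ≠ l ∧ i ≠ m
        · exact hk.integral_mul_eq_zero c1.1 c1.2.1 c1.2.2
        by_cases c2 : j ≠ i ∧ j ≠ l ∧ j ≠ m
        · simp_rw [fun y : Fin n → ℝ => hsymm (y i) (y j)]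
          exact hk.integral_mul_eq_zero c2.1 c2.2.1 c2.2.2
        by_cases c3 : l ≠ m ∧ l ≠ i ∧ l ≠ j
        · simp_rw [fun y : Fin n → ℝ => mul_comm (k (y i) (y j))]
          exact hk.integral_mul_eq_zero c3.1 c3.2.1 c3.2.2
        by_cases c4 : m ≠ l ∧ m ≠ i ∧ m ≠ j
        · simp_rw [fun y : Fin n → ℝ => mul_comm (k (y i) (y j)),
            fun y : Fin n → ℝ => hsymm (y l) (y m)]
          exact hk.integral_mul_eq_zero c4.1 c4.2.1 c4.2.2
        exfalso
        grind
      rw [h0]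
      refine mul_nonneg (by positivity) ?_
      split_ifs <;> norm_num
  refine (Finset.sum_le_sum fun p _ => Finset.sum_le_sum fun r _ => h1 p r).trans_eq ?_
  simp_rw [← Finset.mul_sum, Finset.sum_add_distrib]
  have e1 : ∑ p : Fin n × Fin n, (if p.1 = p.2 then (1 : ℝ) else 0) = n := by
    rw [Fintype.sum_prod_type]
    simp
  have e2 : ∑ p : Fin n × Fin n, ∑ r : Fin n × Fin n, (if p = r then (1 : ℝ) else 0) = n ^ 2 := by
    simp [sq]
  have e3 : ∑ p : Fin n × Fin n, ∑ r : Fin n × Fin n, (if p = r.swap then (1 : ℝ) else 0)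
      = n ^ 2 := by
    rw [← e2]
    refine Finset.sum_congr rfl fun p _ => ?_
    exact Equiv.sum_comp (Equiv.prodComm (Fin n) (Fin n)) fun r => if p = r then (1 : ℝ) else 0
  rw [e2, e3, ← Finset.sum_mul_sum, e1]
  ring

variable (hc : Continuous (cdf ν)) (hq : BoundedLipschitz q K B) (hsymm : ∀ u v, q u v = q v u)
  (h0 : ∀ u, ∫ b, q u (cdf ν b) ∂ν = 0)
include hc hq hsymm h0

/-- Bounding every error separately would give order n³. Over ranks, each row is a Riemann sum of a
function with integral zero, hence at most `K`, and the double sum at most K * n. The double sum at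
true distribution values is controlled by degeneracy. -/
theorem integral_rankError_double_sum_sq_le (hn : 0 < n) :
    ∫ y, (∑ p : Fin n × Fin n, rankError ν q y p.1 p.2) ^ 2 ∂(Measure.pi fun _ : Fin n => ν)
      ≤ (2 * K ^ 2 + 6 * B ^ 2) * n ^ 2 := by
  have hk : DegenerateKernel ν (fun a b => q (cdf ν a) (cdf ν b)) B :=
    { measurable := hq.measurable.comp (((measurable_cdf ν).comp measurable_fst).prodMk
        ((measurable_cdf ν).comp measurable_snd))
      bdd := fun a b => hq.bdd _ _
      left := fun b => by
        simp_rw [fun a => hsymm (cdf ν a) (cdf ν b)]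
        exact h0 _
      right := fun a => h0 _ }
  have hK := hq.nonneg_left
  have hB := hq.nonneg_right
  have h1 := hk.integral_double_sum_sq_le (n := n) fun a b => hsymm _ _
  have hmS : Measurable fun y : Fin n → ℝ =>
      ∑ p : Fin n × Fin n, q (cdf ν (y p.1)) (cdf ν (y p.2)) :=
    Finset.measurable_sum _ fun p _ =>
      hk.measurable_comp (measurable_pi_apply p.1) (measurable_pi_apply p.2)
  have hiS : Integrable (fun y : Fin n → ℝ =>
      (∑ p : Fin n × Fin n, q (cdf ν (y p.1)) (cdf ν (y p.2))) ^ 2)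
      (Measure.pi fun _ : Fin n => ν) := by
    refine Integrable.of_bound (C := (n * n * B) ^ 2) (hmS.pow_const 2).aestronglyMeasurable
      (ae_of_all _ fun y => ?_)
    rw [norm_pow]
    refine pow_le_pow_left₀ (norm_nonneg _) ?_ 2
    refine (norm_sum_le_of_le _ fun p _ => hq.bdd _ _).trans_eq ?_
    simp
  calc _ ≤ ∫ y, (2 * (K * n) ^ 2 + 2 * (∑ p : Fin n × Fin n,
        q (cdf ν (y p.1)) (cdf ν (y p.2))) ^ 2) ∂(Measure.pi fun _ : Fin n => ν) := by
        refine integral_mono_of_nonneg (ae_of_all _ fun y => sq_nonneg _)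
          ((integrable_const _).add (hiS.const_mul 2)) ?_
        filter_upwards [ae_pi_injective (n := n) hc] with y hy
        simp only [rankError, Finset.sum_sub_distrib]
        have h2 : |∑ p : Fin n × Fin n, q (normRank y p.1) (normRank y p.2)| ≤ K * n := by
          rw [Fintype.sum_prod_type]
          refine (Finset.abs_sum_le_sum_abs _ _).trans ?_
          have h3 : ∀ i, |∑ j, q (normRank y i) (normRank y j)| ≤ K := by
            intro i
            have h4 := abs_sum_rank_sub_integral_le (f := q (normRank y i)) (L := K)
              (fun a b => by simpa using hq.lip (normRank y i) a (normRank y i) b) hn hy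
            rw [← integral_comp_cdf hc (hq.continuous_right _), h0, mul_zero, sub_zero] at h4
            exact h4
          refine (Finset.sum_le_sum fun i _ => h3 i).trans_eq ?_
          simp [mul_comm]
        have h5 := pow_le_pow_left₀ (abs_nonneg _) h2 2
        rw [sq_abs] at h5
        generalize ∑ p : Fin n × Fin n, q (normRank y p.1) (normRank y p.2) = a at *
        generalize ∑ p : Fin n × Fin n, q (cdf ν (y p.1)) (cdf ν (y p.2)) = b at *
        nlinarith [sq_nonneg (a + b)]
    _ = 2 * (K * n) ^ 2 + 2 * ∫ y, (∑ p : Fin n × Fin n,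
        q (cdf ν (y p.1)) (cdf ν (y p.2))) ^ 2 ∂(Measure.pi fun _ : Fin n => ν) := by
        rw [integral_add (integrable_const _) (hiS.const_mul 2), integral_const]
        simp [integral_const_mul]
    _ ≤ _ := by nlinarith

/-- By exchangeability, the errors over disjoint pairs are almost uncorrelated. -/
theorem exists_integral_rankError_mul_eq (hn : 4 ≤ n) :
    ∃ Q : ℝ, |Q| ≤ (98 * K ^ 2 + 6 * B ^ 2) / n ^ 2 ∧ ∀ i j k l : Fin n, [i, j, k, l].Nodup →
      ∫ y, rankError ν q y i j * rankError ν q y k l ∂(Measure.pi fun _ : Fin n => ν) = Q := by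
  have hn0 : 0 < n := by omega
  have hnR : (0 : ℝ) < n := by exact_mod_cast hn0
  obtain ⟨a0, a1, a2, a3, hnodup⟩ : ∃ a0 a1 a2 a3 : Fin n, [a0, a1, a2, a3].Nodup :=
    ⟨⟨0, by omega⟩, ⟨1, by omega⟩, ⟨2, by omega⟩, ⟨3, by omega⟩, by simp⟩
  have hδ0 : 0 ≤ 8 * K ^ 2 / n := by positivity
  have hRδ := abs_integral_rankError_mul_le (ν := ν) hq hn0
  have hRQ : ∀ i j k l : Fin n, [i, j, k, l].Nodup →
      ∫ y, rankError ν q y i j * rankError ν q y k l ∂(Measure.pi fun _ : Fin n => ν)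
        = ∫ y, rankError ν q y a0 a1 * rankError ν q y a2 a3 ∂(Measure.pi fun _ : Fin n => ν) := by
    intro i j k l h
    obtain ⟨τ, rfl, rfl, rfl, rfl⟩ := exists_perm_of_distinct hnodup h
    exact integral_rankError_mul_perm hq τ _ _ _ _
  refine ⟨_, ?_, hRQ⟩
  have hQδ := hRδ a0 a1 a2 a3
  have hA := integral_rankError_double_sum_sq_le hc hq hsymm h0 hn0
  have hA0 := integral_nonneg (μ := Measure.pi fun _ : Fin n => ν)
    (f := fun y => (∑ p : Fin n × Fin n, rankError ν q y p.1 p.2) ^ 2) fun y => sq_nonneg _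
  rw [integral_fintype_sum_sq (f := fun (p : Fin n × Fin n) y => rankError ν q y p.1 p.2)
    (fun p => measurable_rankError hq p.1 p.2) (fun p y => abs_rankError_le hq y p.1 p.2)] at hA hA0
  have h5 := pow_card_mul_abs_le hδ0 hRδ hQδ hRQ
  rw [abs_of_nonneg hA0] at h5
  -- Non-distinct quadruples contribute 96K²n², and with (2K² + 6B²)n² from the full double sum this
  -- makes 98K² + 6B².
  have h6 : 12 * (8 * K ^ 2 / n) * n ^ 3 = 96 * K ^ 2 * n ^ 2 := by field_simp; ring
  rw [h6] at h5
  generalize ∫ y, rankError ν q y a0 a1 * rankError ν q y a2 a3 ∂(Measure.pi fun _ : Fin n => ν)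
    = Q at *
  rw [le_div_iff₀ (by positivity)]
  have h7 : (n : ℝ) ^ 2 * (|Q| * n ^ 2) ≤ (n : ℝ) ^ 2 * (98 * K ^ 2 + 6 * B ^ 2) := by nlinarith
  exact le_of_mul_le_mul_left h7 (by positivity)

/-- Replacing normalized ranks by values of the distribution function in a sum over neighbours
changes the sum by a quantity that is bounded in mean square. -/
theorem integral_rankError_adjacent_sum_sq_le (hn : 4 ≤ n) :
    ∫ y, (∑ i : Fin (n - 1), rankError ν q y ⟨i, by omega⟩ ⟨i + 1, by omega⟩) ^ 2
      ∂(Measure.pi fun _ : Fin n => ν) ≤ 122 * K ^ 2 + 6 * B ^ 2 := by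
  have hn0 : 0 < n := by omega
  have hnR : (0 : ℝ) < n := by exact_mod_cast hn0
  obtain ⟨Q, hQ, hRQ⟩ := exists_integral_rankError_mul_eq hc hq hsymm h0 hn
  rw [integral_fintype_sum_sq (fun i => measurable_rankError hq _ _)
    (fun i y => abs_rankError_le hq y _ _)]
  have hδ := abs_integral_rankError_mul_le (ν := ν) hq hn0
  set δ := 8 * K ^ 2 / n with hδdef
  have hδ0 : 0 ≤ δ := by positivity
  -- Disjoint pairs contribute `Q`, of order n⁻², to each of at most n² products. Only three values
  -- of `j` per `i` give overlapping pairs; these add 3nδ = 24K².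
  have hterm : ∀ i j : Fin (n - 1), ∫ y, rankError ν q y ⟨i, by omega⟩ ⟨i + 1, by omega⟩
      * rankError ν q y ⟨j, by omega⟩ ⟨j + 1, by omega⟩ ∂(Measure.pi fun _ : Fin n => ν)
      ≤ |Q| + δ * ((if i = j then 1 else 0) + (if (i : ℕ) = j + 1 then 1 else 0)
        + if (j : ℕ) = i + 1 then 1 else 0) := by
    intro i j
    by_cases h : i = j ∨ (i : ℕ) = j + 1 ∨ (j : ℕ) = i + 1
    · refine ((le_abs_self _).trans (hδ _ _ _ _)).trans ?_
      refine le_add_of_nonneg_of_le (abs_nonneg Q) (le_mul_of_one_le_right hδ0 ?_)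
      rcases h with e | e | e <;> rw [if_pos e] <;> split_ifs <;> norm_num
    · push Not at h
      rw [hRQ _ _ _ _ ?_]
      · refine (le_abs_self Q).trans (le_add_of_nonneg_right (mul_nonneg hδ0 ?_))
        split_ifs <;> norm_num
      · have := Fin.val_ne_of_ne h.1
        simp
        omega
  refine (Finset.sum_le_sum fun i _ => Finset.sum_le_sum fun j _ => hterm i j).trans ?_
  have hone : ∀ (s : Fin (n - 1) → Prop) [DecidablePred s], (∀ i j, s i → s j → i = j) →
      ∑ j, (if s j then (1 : ℝ) else 0) ≤ 1 := by
    intro s _ hs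
    rw [Finset.sum_boole]
    have : (Finset.univ.filter s).card ≤ 1 := Finset.card_le_one.2 fun a ha b hb =>
      hs a b (Finset.mem_filter.1 ha).2 (Finset.mem_filter.1 hb).2
    exact_mod_cast this
  have hrow : ∀ i : Fin (n - 1), ∑ j : Fin (n - 1), (|Q| + δ * ((if i = j then 1 else 0)
      + (if (i : ℕ) = j + 1 then 1 else 0) + if (j : ℕ) = i + 1 then 1 else 0))
      ≤ n * |Q| + 3 * δ := by
    intro i
    rw [Finset.sum_add_distrib, ← Finset.mul_sum, Finset.sum_add_distrib, Finset.sum_add_distrib]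
    have e1 := hone (fun j => i = j) fun a b ha hb => ha.symm.trans hb
    have e2 := hone (fun j => (i : ℕ) = j + 1) fun a b ha hb => Fin.ext (by omega)
    have e3 := hone (fun j => (j : ℕ) = i + 1) fun a b ha hb => Fin.ext (by omega)
    have e4 : ∑ _j : Fin (n - 1), |Q| ≤ n * |Q| := by
      rw [Finset.sum_const, Finset.card_univ, Fintype.card_fin, nsmul_eq_mul]
      gcongr
      omega
    have e5 := mul_le_mul_of_nonneg_left (add_le_add (add_le_add e1 e2) e3) hδ0
    linarith
  refine (Finset.sum_le_sum fun i _ => hrow i).trans ?_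
  rw [Finset.sum_const, Finset.card_univ, Fintype.card_fin, nsmul_eq_mul]
  rw [le_div_iff₀ (by positivity)] at hQ
  have h1 : ((n - 1 : ℕ) : ℝ) ≤ n := by exact_mod_cast Nat.sub_le n 1
  calc _ ≤ (n : ℝ) * (n * |Q| + 3 * δ) := by gcongr
    _ = |Q| * n ^ 2 + 24 * K ^ 2 := by rw [hδdef]; field_simp; ring
    _ ≤ _ := by linarith

end RankSums

/-! ### The reordered responses under independence. -/

section Reordering

variable {Ω : Type*} [MeasurableSpace Ω] {P : Measure Ω}
  {X Y : Ω → ℝ} {Xs Ys : ℕ → Ω → ℝ} {π : (n : ℕ) → Ω → Equiv.Perm (Fin n)}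

theorem IsUniformTieBreaking.measurable_reordered (hπ : IsUniformTieBreaking P Xs Ys π)
    (hYs : ∀ i, Measurable (Ys i)) (n : ℕ) :
    Measurable fun ω (i : Fin n) => Ys (π n ω i) ω := by
  intro S hS
  have h1 : (fun ω (i : Fin n) => Ys (π n ω i) ω) ⁻¹' S
      = ⋃ σ : Equiv.Perm (Fin n), {ω | π n ω = σ} ∩ (fun ω (i : Fin n) => Ys (σ i) ω) ⁻¹' S := by
    ext ω
    simp
  rw [h1]
  exact MeasurableSet.iUnion fun σ => (hπ.measurableSet_eq n σ).inter
    ((measurable_pi_lambda _ fun i => hYs _) hS)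

/-- If `X` and `Y` are independent, then the reordered responses form an i.i.d. sample. -/
theorem IsUniformTieBreaking.map_reordered [IsProbabilityMeasure P]
    (hπ : IsUniformTieBreaking P Xs Ys π)
    (hX : Measurable X) (hY : Measurable Y)
    (hXs : ∀ i, Measurable (Xs i)) (hYs : ∀ i, Measurable (Ys i))
    (h_indep : iIndepFun (fun i ω => (Xs i ω, Ys i ω)) P)
    (h_ident : ∀ i, IdentDistrib (fun ω => (Xs i ω, Ys i ω)) (fun ω => (X ω, Y ω)) P P)
    (hXY : IndepFun X Y P) (n : ℕ) :
    P.map (fun ω (i : Fin n) => Ys (π n ω i) ω) = Measure.pi fun _ : Fin n => P.map Y := by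
  have : IsProbabilityMeasure (P.map X) := Measure.isProbabilityMeasure_map hX.aemeasurable
  have : IsProbabilityMeasure (P.map Y) := Measure.isProbabilityMeasure_map hY.aemeasurable
  have hm := hπ.measurable_reordered hYs n
  have := Measure.isProbabilityMeasure_map (μ := P) hm.aemeasurable
  -- Domination between two probability measures forces equality, so an upper bound is enough. By
  -- independence the noise is `Y` itself, and for each `σ` the permuted product law is unchanged.
  refine Measure.eq_of_le_of_measure_univ_eq (Measure.le_iff.2 fun S hS => ?_) (by simp)
  rw [Measure.map_apply hm hS]
  have hsnd : ∀ σ : Equiv.Perm (Fin n), Measurable fun (s : Fin n → ℝ × ℝ) i => (s (σ i)).2 :=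
    fun σ => measurable_pi_lambda _ fun i => (measurable_pi_apply _).snd
  refine hπ.measure_le hXs hYs h_indep h_ident (μ := P.map X) (lam := P.map Y)
    (G := fun _ v => v) measurable_snd ?_
    (A := fun σ => (fun s i => (s (σ i)).2) ⁻¹' S) (fun σ => hsnd σ hS) fun x σ _ => ?_
  · rw [hXY.map_prod_eq_prod_map_map hX.aemeasurable hY.aemeasurable]
    exact Measure.map_id
  · refine le_of_eq ?_
    conv_rhs => rw [← pi_map_comp_perm (P.map Y) σ]
    rw [Measure.map_apply (measurable_pi_lambda _ fun i => measurable_pi_apply _) hS]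
    rfl

end Reordering

/-! ### Reduction to a globally bounded Lipschitz kernel. -/

section Reduction

variable {n : ℕ} {h g : ℝ → ℝ → ℝ}

/-- Ranks do not depend on the order of the sample, so the sorting permutation can be absorbed into
the data. -/
theorem simplifiedCoeff_comp_perm (y : Fin n → ℝ) (σ : Equiv.Perm (Fin n)) :
    simplifiedCoeff h (fun i => y (σ i)) 1 = simplifiedCoeff h y σ := by
  simp [simplifiedCoeff, rankVariation, sampleRank_comp_perm]

theorem measurable_simplifiedCoeff (hh : Measurable (Function.uncurry h))
    (σ : Equiv.Perm (Fin n)) : Measurable fun y => simplifiedCoeff h y σ := by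
  refine measurable_const.sub (Measurable.div_const (Measurable.const_mul ?_ _) _)
  exact Finset.measurable_sum _ fun i _ => hh.comp
    ((measurable_normRank _).prodMk (measurable_normRank _))

theorem simplifiedCoeff_congr
    (hgh : ∀ x ∈ Set.Icc (0 : ℝ) 1, ∀ y ∈ Set.Icc (0 : ℝ) 1, g x y = h x y)
    (y : Fin n → ℝ) (σ : Equiv.Perm (Fin n)) :
    simplifiedCoeff g y σ = simplifiedCoeff h y σ := by
  have hC : kernelMean g = kernelMean h := by
    refine intervalIntegral.integral_congr fun v hv => intervalIntegral.integral_congr fun u hu => ?_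
    rw [Set.uIcc_of_le zero_le_one] at hu hv
    exact hgh u hu v hv
  rw [simplifiedCoeff, simplifiedCoeff, hC, rankVariation, rankVariation]
  simp only [hgh _ (sampleRank_div_mem_Icc y _) _ (sampleRank_div_mem_Icc y _)]

theorem rankCorrelationMeasure_congr {Ω : Type*} [MeasurableSpace Ω] (P : Measure Ω)
    [IsProbabilityMeasure P]
    (hgh : ∀ x ∈ Set.Icc (0 : ℝ) 1, ∀ y ∈ Set.Icc (0 : ℝ) 1, g x y = h x y) (X Y : Ω → ℝ) :
    rankCorrelationMeasure P g X Y = rankCorrelationMeasure P h X Y := by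
  simp only [rankCorrelationMeasure, limitVariation, limitNormalization,
    hgh _ (cdf_mem_Icc (P.map Y) _) _ (cdf_mem_Icc (P.map Y) _)]

theorem asymptoticVariance_congr
    (hgh : ∀ x ∈ Set.Icc (0 : ℝ) 1, ∀ y ∈ Set.Icc (0 : ℝ) 1, g x y = h x y) (ν : Measure ℝ) :
    asymptoticVariance g (cdf ν) ν = asymptoticVariance h (cdf ν) ν := by
  simp only [asymptoticVariance, hgh _ (cdf_mem_Icc ν _) _ (cdf_mem_Icc ν _)]

/-- The extension of a kernel on the unit square that is constant along the projection to it. -/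
noncomputable def clipKernel (h : ℝ → ℝ → ℝ) (x y : ℝ) : ℝ :=
  h (Set.projIcc (0 : ℝ) 1 zero_le_one x) (Set.projIcc (0 : ℝ) 1 zero_le_one y)

theorem clipKernel_eq {x y : ℝ} (hx : x ∈ Set.Icc (0 : ℝ) 1) (hy : y ∈ Set.Icc (0 : ℝ) 1) :
    clipKernel h x y = h x y := by
  rw [clipKernel, Set.projIcc_of_mem _ hx, Set.projIcc_of_mem _ hy]

theorem RegularKernel.clipKernel_symm (hr : RegularKernel h) (x y : ℝ) :
    clipKernel h x y = clipKernel h y x :=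
  hr.symm _ (Subtype.coe_prop _) _ (Subtype.coe_prop _)

theorem RegularKernel.exists_boundedLipschitz_clipKernel (hr : RegularKernel h)
    (hl : LipschitzKernel h) : ∃ K B, BoundedLipschitz (clipKernel h) K B := by
  obtain ⟨K, hK, hl⟩ := hl
  have hproj : ∀ a b : ℝ, |(Set.projIcc (0 : ℝ) 1 zero_le_one a : ℝ)
      - Set.projIcc (0 : ℝ) 1 zero_le_one b| ≤ |a - b| := fun a b => by
    have := (LipschitzWith.projIcc (zero_le_one (α := ℝ))).dist_le_mul a b
    simpa [Real.dist_eq, Subtype.dist_eq] using this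
  -- The bound 2K comes from comparison with h(0,0) = 0.
  refine ⟨K, 2 * K, fun a b c d => ?_, fun a b => ?_⟩
  · refine (hl _ (Subtype.coe_prop _) _ (Subtype.coe_prop _) _ (Subtype.coe_prop _) _
      (Subtype.coe_prop _)).trans ?_
    have := hproj a c
    have := hproj b d
    gcongr
  · have h0 : (0 : ℝ) ∈ Set.Icc (0 : ℝ) 1 := ⟨le_rfl, zero_le_one⟩
    have ha := (Set.projIcc (0 : ℝ) 1 zero_le_one a).2
    have hb := (Set.projIcc (0 : ℝ) 1 zero_le_one b).2
    have h1 := hl _ ha _ hb 0 h0 0 h0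
    rw [hr.diag 0 h0, sub_zero, sub_zero, sub_zero, abs_of_nonneg ha.1, abs_of_nonneg hb.1] at h1
    refine h1.trans ?_
    nlinarith [ha.2, hb.2]

end Reduction

/-! ### Linearization of the coefficient. -/

section Linearization

variable {n : ℕ} {ν : Measure ℝ} [IsProbabilityMeasure ν] {h : ℝ → ℝ → ℝ} {K B : ℝ}

/-- Up to a bounded error, the centred sum over neighbouring ranks only involves the degenerate
part of the kernel. -/
theorem abs_centered_rank_sum_add_le (hc : Continuous (cdf ν)) (hh : BoundedLipschitz h K B)
    (hn : 0 < n) {y : Fin n → ℝ} (hy : Function.Injective y) :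
    |n * (∫ a, kernelProj ν h (cdf ν a) ∂ν)
        - (∑ i : Fin (n - 1), h (normRank y ⟨i, by omega⟩) (normRank y ⟨i + 1, by omega⟩))
        + ∑ i : Fin (n - 1),
          degeneratePart ν h (normRank y ⟨i, by omega⟩) (normRank y ⟨i + 1, by omega⟩)|
      ≤ 2 * K + 3 * B := by
  set C := ∫ a, kernelProj ν h (cdf ν a) ∂ν with hC
  have h1 := abs_sum_rank_sub_integral_le (abs_kernelProj_sub_le (ν := ν) hh) hn hy
  rw [← integral_comp_cdf hc (continuous_kernelProj hh), ← hC] at h1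
  have h2 := sum_adjacent_left_add_last hn fun i => kernelProj ν h (normRank y i)
  have h3 := sum_adjacent_right_add_first hn fun i => kernelProj ν h (normRank y i)
  have h4 : |C| ≤ B := abs_integral_le_of_bound fun a => abs_kernelProj_le hh _
  -- Each of the two projection sums misses one boundary term of the full sum over ranks. The
  -- quantity to bound is thus 2(nC - Σγ) plus two boundary values minus C, whence 2K + 3B.
  have h5 : ∑ i : Fin (n - 1),
      degeneratePart ν h (normRank y ⟨i, by omega⟩) (normRank y ⟨i + 1, by omega⟩)
      = (∑ i : Fin (n - 1), h (normRank y ⟨i, by omega⟩) (normRank y ⟨i + 1, by omega⟩))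
        - (∑ i : Fin (n - 1), kernelProj ν h (normRank y ⟨i, by omega⟩))
        - (∑ i : Fin (n - 1), kernelProj ν h (normRank y ⟨i + 1, by omega⟩)) + (n - 1) * C := by
    simp only [degeneratePart, Finset.sum_add_distrib, Finset.sum_sub_distrib, Finset.sum_const,
      Finset.card_univ, Fintype.card_fin, nsmul_eq_mul, Nat.cast_pred hn]
    rfl
  have h6 := abs_kernelProj_le (ν := ν) hh (normRank y ⟨n - 1, by omega⟩)
  have h7 := abs_kernelProj_le (ν := ν) hh (normRank y ⟨0, hn⟩)
  change |∑ j, kernelProj ν h (normRank y j) - n * C| ≤ K at h1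
  rw [h5]
  rw [abs_le] at *
  constructor <;> linarith [h1.1, h1.2, h4.1, h4.2, h6.1, h6.2, h7.1, h7.2]

/-- Mean-square distance between the normalized coefficient of an independent sample and its
linearization. -/
theorem integral_simplifiedCoeff_sub_sq_le (hc : Continuous (cdf ν)) (hh : BoundedLipschitz h K B)
    (hsymm : ∀ x y, h x y = h y x) (hC : 0 < ∫ a, kernelProj ν h (cdf ν a) ∂ν) (hn : 4 ≤ n) :
    ∫ y, (√(n : ℝ) * simplifiedCoeff h y 1 - (-(∫ a, kernelProj ν h (cdf ν a) ∂ν)⁻¹)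
        * ((√(n : ℝ))⁻¹ * ∑ i : Fin (n - 1), degeneratePart ν h (cdf ν (y ⟨i, by omega⟩))
          (cdf ν (y ⟨i + 1, by omega⟩)))) ^ 2 ∂(Measure.pi fun _ : Fin n => ν)
      ≤ 2 * ((2 * K + 3 * B) ^ 2 + (122 * (2 * K) ^ 2 + 6 * (4 * B) ^ 2))
        / (∫ a, kernelProj ν h (cdf ν a) ∂ν) ^ 2 * (n : ℝ)⁻¹ := by
  have hn0 : 0 < n := by omega
  have hnR : (0 : ℝ) < n := by exact_mod_cast hn0
  have hq := degeneratePart_boundedLipschitz (ν := ν) hh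
  have hE := integral_rankError_adjacent_sum_sq_le hc hq (degeneratePart_symm hsymm)
    (integral_degeneratePart_right hh) hn
  have hb := fun y hy => abs_centered_rank_sum_add_le (n := n) hc hh hn0 (y := y) hy
  have hmean := kernelMean_eq hc hh hsymm
  set C := ∫ a, kernelProj ν h (cdf ν a) ∂ν with hCdef
  have hmE : Measurable fun y : Fin n → ℝ => ∑ i : Fin (n - 1),
      rankError ν (degeneratePart ν h) y ⟨i, by omega⟩ ⟨i + 1, by omega⟩ :=
    Finset.measurable_sum _ fun i _ => measurable_rankError hq _ _
  have hiE : Integrable (fun y : Fin n → ℝ => (∑ i : Fin (n - 1),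
      rankError ν (degeneratePart ν h) y ⟨i, by omega⟩ ⟨i + 1, by omega⟩) ^ 2)
      (Measure.pi fun _ : Fin n => ν) := by
    refine Integrable.of_bound (C := (∑ _i : Fin (n - 1), 2 * (4 * B)) ^ 2)
      (hmE.pow_const 2).aestronglyMeasurable (ae_of_all _ fun y => ?_)
    rw [Real.norm_eq_abs, abs_pow]
    refine pow_le_pow_left₀ (abs_nonneg _) ?_ 2
    exact (Finset.abs_sum_le_sum_abs _ _).trans
      (Finset.sum_le_sum fun i _ => abs_rankError_le hq y _ _)
  calc _ ≤ ∫ y, (2 / (n * C ^ 2)) * ((2 * K + 3 * B) ^ 2 + (∑ i : Fin (n - 1),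
        rankError ν (degeneratePart ν h) y ⟨i, by omega⟩ ⟨i + 1, by omega⟩) ^ 2)
        ∂(Measure.pi fun _ : Fin n => ν) := by
        refine integral_mono_of_nonneg (ae_of_all _ fun y => sq_nonneg _)
          (((integrable_const _).add hiE).const_mul _) ?_
        filter_upwards [ae_pi_injective (n := n) hc] with y hy
        have h1 := hb y hy
        have h2 : √(n : ℝ) * simplifiedCoeff h y 1 = (√(n : ℝ))⁻¹ * C⁻¹ * (n * C
            - ∑ i : Fin (n - 1),
              h (normRank y ⟨i, by omega⟩) (normRank y ⟨i + 1, by omega⟩)) := by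
          rw [simplifiedCoeff, rankVariation, hmean]
          simp only [Equiv.Perm.coe_one, id, normRank]
          generalize ∑ i : Fin (n - 1), h (_ / _) (_ / _) = S
          have h3 : √(n : ℝ) ≠ 0 := by positivity
          have h4 : √(n : ℝ) ^ 2 = n := Real.sq_sqrt hnR.le
          field_simp
          rw [h4]
        rw [h2]
        simp only [rankError, Finset.sum_sub_distrib]
        generalize ∑ i : Fin (n - 1), h (normRank y _) (normRank y _) = S at *
        generalize ∑ i : Fin (n - 1), degeneratePart ν h (normRank y _) (normRank y _) = D at *
        generalize ∑ i : Fin (n - 1), degeneratePart ν h (cdf ν _) (cdf ν _) = D' at *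
        -- The difference splits into the bounded centred sum and the rank error D - D', both over
        -- C√n.
        have h5 : ((√(n : ℝ))⁻¹ * C⁻¹ * (n * C - S) - -C⁻¹ * ((√(n : ℝ))⁻¹ * D')) ^ 2
            = (n : ℝ)⁻¹ * (C ^ 2)⁻¹ * ((n * C - S + D) - (D - D')) ^ 2 := by
          have h6 : ((√(n : ℝ))⁻¹) ^ 2 = (n : ℝ)⁻¹ := by rw [inv_pow, Real.sq_sqrt hnR.le]
          rw [← h6]
          ring
        rw [h5, show 2 / (n * C ^ 2) = (n : ℝ)⁻¹ * (C ^ 2)⁻¹ * 2 by field_simp,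
          mul_assoc _ (2 : ℝ)]
        refine mul_le_mul_of_nonneg_left ?_ (by positivity)
        have h7 := sq_le_sq' (abs_le.1 h1).1 (abs_le.1 h1).2
        nlinarith [sq_nonneg ((n * C - S + D) + (D - D'))]
    _ ≤ _ := by
        rw [integral_const_mul, integral_add (integrable_const _) hiE]
        simp only [integral_const, probReal_univ, one_smul]
        rw [show 2 * ((2 * K + 3 * B) ^ 2 + (122 * (2 * K) ^ 2 + 6 * (4 * B) ^ 2)) / C ^ 2
          * (n : ℝ)⁻¹ = (2 / (n * C ^ 2))
            * ((2 * K + 3 * B) ^ 2 + (122 * (2 * K) ^ 2 + 6 * (4 * B) ^ 2)) by field_simp]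
        gcongr

end Linearization

/-! ### Central limit theorem for the coefficient and conclusion. -/

section CentralLimit

variable {Ω : Type*} [MeasurableSpace Ω] {P : Measure Ω} [IsProbabilityMeasure P]
  {h : ℝ → ℝ → ℝ} {K B : ℝ}

/-- The normalized coefficient of an independent sample is asymptotically Gaussian, in terms of
characteristic functions. -/
theorem tendsto_charFun_pi_simplifiedCoeff {ν : Measure ℝ} [IsProbabilityMeasure ν]
    (hc : Continuous (cdf ν)) (hh : BoundedLipschitz h K B) (hsymm : ∀ x y, h x y = h y x)
    (hC : 0 < ∫ a, kernelProj ν h (cdf ν a) ∂ν) {Y : ℕ → Ω → ℝ} (hY : ∀ i, Measurable (Y i))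
    (hind : iIndepFun Y P) (hlaw : ∀ i, P.map (Y i) = ν) (t : ℝ) :
    Tendsto (fun n : ℕ => charFun ((Measure.pi fun _ : Fin n => ν).map
      fun y => √(n : ℝ) * simplifiedCoeff h y 1) t) atTop
      (𝓝 (Complex.exp (-(asymptoticVariance h (cdf ν) ν * t ^ 2 / 2 : ℝ)))) := by
  have hk := degenerateKernel_degeneratePart (ν := ν) hh hsymm
  have hbound := fun (n : ℕ) (hn : 4 ≤ n) =>
    integral_simplifiedCoeff_sub_sq_le (n := n) hc hh hsymm hC hn
  have hvar := asymptoticVariance_eq (ν := ν) hh hsymm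
  set C := ∫ a, kernelProj ν h (cdf ν a) ∂ν with hCdef
  set D := 2 * ((2 * K + 3 * B) ^ 2 + (122 * (2 * K) ^ 2 + 6 * (4 * B) ^ 2)) / C ^ 2 with hD
  let L : (n : ℕ) → (Fin n → ℝ) → ℝ := fun n y => (√(n : ℝ))⁻¹ * ∑ i : Fin (n - 1),
    degeneratePart ν h (cdf ν (y ⟨i, by omega⟩)) (cdf ν (y ⟨i + 1, by omega⟩))
  have hmL : ∀ n, Measurable (L n) := fun n => (Finset.measurable_sum _ fun i _ =>
    hk.measurable_comp (measurable_pi_apply _) (measurable_pi_apply _)).const_mul _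
  have hmT : ∀ n : ℕ, Measurable fun y : Fin n → ℝ => √(n : ℝ) * simplifiedCoeff h y 1 :=
    fun n => (measurable_simplifiedCoeff hh.measurable 1).const_mul _
  have hlin : Tendsto (fun n : ℕ => charFun ((Measure.pi fun _ : Fin n => ν).map
      fun y => -C⁻¹ * L n y) t) atTop
      (𝓝 (Complex.exp (-(asymptoticVariance h (cdf ν) ν * t ^ 2 / 2 : ℝ)))) := by
    -- The sequence `Y` only realizes the product law: its first n terms, in their original order,
    -- have the same law as the reordered sample.
    have h1 := hk.tendsto_charFun_adjacent_sum hY hind hlaw (-C⁻¹ * t)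
    have h2 : ((∫ a, ∫ b, degeneratePart ν h (cdf ν a) (cdf ν b) ^ 2 ∂ν ∂ν)
        * (-C⁻¹ * t) ^ 2 / 2 : ℝ) = asymptoticVariance h (cdf ν) ν * t ^ 2 / 2 := by
      rw [hvar]
      field_simp
    rw [h2] at h1
    refine h1.congr fun n => ?_
    rw [← charFun_map_mul, ← map_initial_segment hY hind hlaw n]
    rw [Measure.map_map (measurable_const_mul _) (Measurable.const_mul
      (Finset.measurable_sum _ fun i _ => hk.measurable_comp (hY _) (hY _)) _),
      Measure.map_map ((hmL n).const_mul _) (measurable_pi_lambda _ fun i => hY _)]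
    congr 2
    ext ω
    simp only [Function.comp_apply, L, Finset.sum_range]
  have hzero : Tendsto (fun n : ℕ => charFun ((Measure.pi fun _ : Fin n => ν).map
      fun y => √(n : ℝ) * simplifiedCoeff h y 1) t
      - charFun ((Measure.pi fun _ : Fin n => ν).map fun y => -C⁻¹ * L n y) t) atTop (𝓝 0) := by
    refine squeeze_zero_norm' (a := fun n : ℕ => |t| * √(D * (n : ℝ)⁻¹)) ?_ ?_
    · filter_upwards [eventually_ge_atTop 4] with n hn
      have hmem : MemLp (fun y : Fin n → ℝ => √(n : ℝ) * simplifiedCoeff h y 1 - -C⁻¹ * L n y) 2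
          (Measure.pi fun _ : Fin n => ν) := by
        refine MemLp.of_bound ((hmT n).sub ((hmL n).const_mul _)).aestronglyMeasurable
          (√(n : ℝ) * (1 + (1 / (n : ℝ) * ∑ _i : Fin (n - 1), B) / |kernelMean h|)
            + C⁻¹ * ((√(n : ℝ))⁻¹ * ∑ _i : Fin (n - 1), 4 * B)) (ae_of_all _ fun y => ?_)
        rw [Real.norm_eq_abs]
        refine (abs_sub _ _).trans (add_le_add ?_ ?_)
        · rw [abs_mul, abs_of_nonneg (Real.sqrt_nonneg _)]
          refine mul_le_mul_of_nonneg_left ?_ (Real.sqrt_nonneg _)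
          refine (abs_sub _ _).trans ?_
          rw [abs_one, abs_div, rankVariation, abs_mul, abs_of_nonneg (by positivity)]
          gcongr
          exact (Finset.abs_sum_le_sum_abs _ _).trans (Finset.sum_le_sum fun i _ => hh.bdd _ _)
        · rw [abs_mul, abs_neg, abs_of_pos (inv_pos.2 hC), abs_mul,
            abs_of_nonneg (inv_nonneg.2 (Real.sqrt_nonneg _))]
          gcongr
          exact (Finset.abs_sum_le_sum_abs _ _).trans (Finset.sum_le_sum fun i _ => hk.bdd _ _)
      refine (norm_charFun_sub_le (hmT n) ((hmL n).const_mul _) hmem t).trans ?_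
      gcongr
      exact hbound n hn
    · have h1 : Tendsto (fun n : ℕ => D * (n : ℝ)⁻¹) atTop (𝓝 0) := by
        simpa using tendsto_inv_atTop_nhds_zero_nat.const_mul D
      have h2 := (Real.continuous_sqrt.tendsto 0).comp h1
      simpa using h2.const_mul |t|
  simpa using hlin.add hzero

/-- The central limit theorem for the simplified coefficient of independent variables. -/
theorem tendstoInDistribution_simplifiedCoeff (hh : BoundedLipschitz h K B)
    (hsymm : ∀ x y, h x y = h y x)
    {X Y : Ω → ℝ} (hX : Measurable X) (hY : Measurable Y) (hc : Continuous (cdf (P.map Y)))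
    (hC : 0 < ∫ a, kernelProj (P.map Y) h (cdf (P.map Y) a) ∂(P.map Y))
    (hv : 0 ≤ asymptoticVariance h (cdf (P.map Y)) (P.map Y))
    {Xs Ys : ℕ → Ω → ℝ} (hXs : ∀ i, Measurable (Xs i)) (hYs : ∀ i, Measurable (Ys i))
    (h_indep : iIndepFun (fun i ω => (Xs i ω, Ys i ω)) P)
    (h_ident : ∀ i, IdentDistrib (fun ω => (Xs i ω, Ys i ω)) (fun ω => (X ω, Y ω)) P P)
    {π : (n : ℕ) → Ω → Equiv.Perm (Fin n)} (hπ : IsUniformTieBreaking P Xs Ys π)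
    (hXY : IndepFun X Y P) :
    TendstoInDistribution
      (fun (n : ℕ) ω => √(n : ℝ) * simplifiedCoeff h (fun i : Fin n => Ys i ω) (π n ω)) atTop
      (id : ℝ → ℝ) (fun _ => P)
      (gaussianReal 0 (asymptoticVariance h (cdf (P.map Y)) (P.map Y)).toNNReal) := by
  have : IsProbabilityMeasure (P.map Y) := Measure.isProbabilityMeasure_map hY.aemeasurable
  have hmT : ∀ n : ℕ, Measurable fun y : Fin n → ℝ => √(n : ℝ) * simplifiedCoeff h y 1 :=
    fun n => (measurable_simplifiedCoeff hh.measurable 1).const_mul _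
  have hcomp : (fun (n : ℕ) ω => √(n : ℝ) * simplifiedCoeff h (fun i : Fin n => Ys i ω) (π n ω))
      = fun (n : ℕ) ω => √(n : ℝ) * simplifiedCoeff h (fun i : Fin n => Ys (π n ω i) ω) 1 := by
    ext n ω
    rw [← simplifiedCoeff_comp_perm]
  rw [hcomp]
  refine tendstoInDistribution_gaussian_of_charFun
    (fun n => (hmT n).comp (hπ.measurable_reordered hYs n)) hv fun t => ?_
  have hind : iIndepFun Ys P := h_indep.comp (fun _ => Prod.snd) fun _ => measurable_snd
  have hlaw : ∀ i, P.map (Ys i) = P.map Y := fun i => ((h_ident i).comp measurable_snd).map_eq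
  refine (tendsto_charFun_pi_simplifiedCoeff hc hh hsymm hC hYs hind hlaw t).congr fun n => ?_
  rw [← hπ.map_reordered hX hY hXs hYs h_indep h_ident hXY n,
    Measure.map_map (hmT n) (hπ.measurable_reordered hYs n)]

end CentralLimit

theorem limitNormalization_eq {Ω : Type*} [MeasurableSpace Ω] (P : Measure Ω) {h : ℝ → ℝ → ℝ}
    (hsymm : ∀ x y, h x y = h y x) (Y : Ω → ℝ) :
    limitNormalization P h Y = ∫ a, kernelProj (P.map Y) h (cdf (P.map Y) a) ∂(P.map Y) := by
  refine integral_congr_ae (ae_of_all _ fun z => integral_congr_ae (ae_of_all _ fun y => ?_))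
  exact hsymm _ _

theorem corollary2 {Ω : Type*} [MeasurableSpace Ω] (P : Measure Ω) [IsProbabilityMeasure P]
    (h : ℝ → ℝ → ℝ) (h_reg : RegularKernel h) (h_lip : LipschitzKernel h)
    (X Y : Ω → ℝ) (hX : Measurable X) (hY : Measurable Y)
    (hY_cont : Continuous (cdf (P.map Y)))
    (Xs Ys : ℕ → Ω → ℝ) (hXs : ∀ i, Measurable (Xs i)) (hYs : ∀ i, Measurable (Ys i))
    (h_indep : iIndepFun (fun i ω => (Xs i ω, Ys i ω)) P)
    (h_ident : ∀ i, IdentDistrib (fun ω => (Xs i ω, Ys i ω)) (fun ω => (X ω, Y ω)) P P)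
    (π : (n : ℕ) → Ω → Equiv.Perm (Fin n)) (hπ : IsUniformTieBreaking P Xs Ys π) :
    (∀ᵐ ω ∂P, Tendsto (fun n : ℕ => simplifiedCoeff h (fun i : Fin n => Ys i ω) (π n ω)) atTop
      (𝓝 (rankCorrelationMeasure P h X Y))) ∧
    (IndepFun X Y P →
      0 < asymptoticVariance h (cdf (P.map Y)) (P.map Y) ∧
      TendstoInDistribution
        (fun (n : ℕ) ω => √(n : ℝ) * simplifiedCoeff h (fun i : Fin n => Ys i ω) (π n ω)) atTop
        (id : ℝ → ℝ) (fun _ => P)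
        (gaussianReal 0 (asymptoticVariance h (cdf (P.map Y)) (P.map Y)).toNNReal)) := by
  have : IsProbabilityMeasure (P.map Y) := Measure.isProbabilityMeasure_map hY.aemeasurable
  obtain ⟨K, B, hh⟩ := h_reg.exists_boundedLipschitz_clipKernel h_lip
  have heq : ∀ x ∈ Set.Icc (0 : ℝ) 1, ∀ y ∈ Set.Icc (0 : ℝ) 1, clipKernel h x y = h x y :=
    fun x hx y hy => clipKernel_eq hx hy
  have hsymm := h_reg.clipKernel_symm
  have hdiag : ∀ x ∈ Set.Icc (0 : ℝ) 1, clipKernel h x x = 0 := fun x hx => by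
    rw [heq x hx x hx, h_reg.diag x hx]
  have hpos : ∀ x ∈ Set.Icc (0 : ℝ) 1, ∀ y ∈ Set.Icc (0 : ℝ) 1, x ≠ y → 0 < clipKernel h x y :=
    fun x hx y hy hxy => by
      rw [heq x hx y hy]
      exact h_reg.pos x hx y hy hxy
  -- Both claims evaluate the kernel on the unit square only, so `h` may be exchanged for its
  -- clipped extension, which is bounded, symmetric and Lipschitz on the whole plane.
  simp only [← simplifiedCoeff_congr heq, ← rankCorrelationMeasure_congr P heq,
    ← asymptoticVariance_congr heq (P.map Y)]
  have hC := kernelProj_mean_pos hY_cont hh hpos hdiag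
  refine ⟨?_, fun hXY => ?_⟩
  · filter_upwards [ae_tendsto_rankVariation hh hX hY hY_cont hXs hYs h_indep h_ident hπ] with ω hω
    simp only [simplifiedCoeff, rankCorrelationMeasure, limitNormalization_eq P hsymm Y,
      kernelMean_eq hY_cont hh hsymm]
    exact (hω.div_const _).const_sub 1
  · have hv : 0 < asymptoticVariance (clipKernel h) (cdf (P.map Y)) (P.map Y) := by
      rw [asymptoticVariance_eq hh hsymm]
      exact div_pos (integral_degeneratePart_sq_pos hY_cont hh hpos hdiag) (pow_pos hC 2)
    exact ⟨hv, tendstoInDistribution_simplifiedCoeff hh hsymm hX hY hY_cont hC hv.le hXs hYs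
      h_indep h_ident hπ hXY⟩
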